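/- Let $k$ be an algebraically closed field of characteristic $p\ge 3$. Let $A(n)=k[X_1,\dots,X_n]/(X_1^p,\dots,X_n^p)$ with canonical generators $x_1,\dots,x_n$ and partial derivatives $\partial_1,\dots,\partial_n$, and put $y_i=1+x_i$. Let $W(n)=\operatorname{Der}_k(A(n))$, with $p$-map $D\mapsto D^{[p]}=D^p$; let $S(n)=\{D\in W(n):\sum_{i}\partial_i(D(x_i))=0\}$, with derived algebra $S(n)^{(1)}$; and let $$H(2m)=\Big\{\sum_{i=1}^{2m} f_i\partial_i\in W(2m):\ \sigma(i)\,\partial_{j'}(f_i)=\sigma(j)\,\partial_{i'}(f_j)\ \text{for all } i,j\Big\},$$ where $i'=i+m$, $\sigma(i)=1$ for $1\le i\le m$ and $i'=i-m$, $\sigma(i)=-1$ for $m<i\le 2m$, with second derived algebra $H(2m)^{(2)}$. Let $\mathfrak g$ be one of $W(n)$ ($n\ge 1$), $S(n)^{(1)}$ ($n\ge 3$), $H(2m)^{(2)}$ ($m\ge 1$), where $p\ge 5$ is assumed if $\mathfrak g$ is $W(1)$ or $H(2)^{(2)}$. Put $\mu(\mathfrak g)=n$, $n-1$, $m$, respectively.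 For $0\le r\le\mu(\mathfrak g)$ let $\mathfrak t_r^{\mathfrak g}$ be the $k$-span of $d_1^{\mathfrak g,r},\dots,d_{\mu(\mathfrak g)}^{\mathfrak g,r}$, where, with $z_i=y_i$ for $i\le r$ and $z_i=x_i$ for $i>r$, $$d_i^{W,r}=z_i\partial_i,\qquad d_i^{S,r}=z_i\partial_i-x_n\partial_n,\qquad d_i^{H,r}=z_i\partial_i-x_{i'}\partial_{i'}.$$ Let $G=\operatorname{Aut}_p(\mathfrak g)$ be the group of Lie algebra automorphisms of $\mathfrak g$ that commute with the $p$-map. An element $s\in\mathfrak g$ is semisimple if it lies in the $k$-span of the $s^{[p]^j}$, $j\ge 1$. The index of a semisimple element $s$ is $$\operatorname{Ind}(s)=\min\{r : 0\le r\le\mu(\mathfrak g),\ G.s\cap\mathfrak t_r^{\mathfrak g}\ne\emptyset\},$$ and $\mathfrak t_r^{\mathfrak g,r}$ denotes the set of all elements of $\mathfrak t_r^{\mathfrak g}$ that are semisimple elements of $\mathfrak g$ of index $r$. Let $1\le r\le\mu(\mathfrak g)$ and $d=\sum_{i=1}^{\mu(\mathfrak g)}\lambda_i d_i^{\mathfrak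 g,r}$ with $\lambda_1,\dots,\lambda_{\mu(\mathfrak g)}\in k$. Then $d\in\mathfrak t_r^{\mathfrak g,r}$ if and only if $\lambda_1,\dots,\lambda_r$ are linearly independent over $\mathbb F_p$. -/

import Mathlib

noncomputable section

namespace CartanType

/-- The truncated polynomial ring `k[X_i : i ∈ ι] / (X_i ^ p : i ∈ ι)`. -/
abbrev TruncPoly (k : Type*) [Field k] (p : ℕ) (ι : Type*) : Type _ :=
  MvPolynomial ι k ⧸
    Ideal.span (Set.range fun i : ι => (MvPolynomial.X i ^ p : MvPolynomial ι k))

/-- The Jacobson-Witt algebra: the Lie algebra of all `k`-derivations of the truncated polynomial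
ring. -/
abbrev Witt (k : Type*) [Field k] (p : ℕ) (ι : Type*) : Type _ :=
  Derivation k (TruncPoly k p ι) (TruncPoly k p ι)

/-- The canonical generator `x_i` of the truncated polynomial ring. -/
def x (k : Type*) [Field k] (p : ℕ) {ι : Type*} (i : ι) : TruncPoly k p ι :=
  Ideal.Quotient.mkₐ k _ (MvPolynomial.X i)

theorem mk_surjective (k : Type*) [Field k] (p : ℕ) (ι : Type*) :
    Function.Surjective (Ideal.Quotient.mkₐ k
      (Ideal.span (Set.range fun i : ι => (MvPolynomial.X i ^ p : MvPolynomial ι k)))) :=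
  Ideal.Quotient.mkₐ_surjective k _

theorem pderiv_mem (k : Type*) [Field k] (p : ℕ) [CharP k p] {ι : Type*} (i : ι)
    (f : MvPolynomial ι k)
    (hf : Ideal.Quotient.mkₐ k
      (Ideal.span (Set.range fun j : ι => (MvPolynomial.X j ^ p : MvPolynomial ι k))) f = 0) :
    Ideal.Quotient.mkₐ k
      (Ideal.span (Set.range fun j : ι => (MvPolynomial.X j ^ p : MvPolynomial ι k)))
      (MvPolynomial.pderiv i f) = 0 := by
  rw [Ideal.Quotient.mkₐ_eq_mk, Ideal.Quotient.eq_zero_iff_mem] at hf ⊢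
  induction hf using Submodule.span_induction with
  | mem g hg =>
    obtain ⟨j, rfl⟩ := hg
    simp [Derivation.leibniz_pow]
  | zero => simp
  | add g h _ _ hg hh => rw [map_add]; exact add_mem hg hh
  | smul a g hg hh =>
    rw [smul_eq_mul, Derivation.leibniz]
    exact add_mem (Ideal.mul_mem_left _ _ hh) (Ideal.mul_mem_right _ _ hg)

/-- The partial derivative `∂_i` on the truncated polynomial ring, induced by the partial derivative
of polynomials. -/
def pd (k : Type*) [Field k] (p : ℕ) [CharP k p] {ι : Type*} (i : ι) : Witt k p ι :=
  Derivation.liftOfSurjective (mk_surjective k p ι) (d := MvPolynomial.pderiv i)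
    (pderiv_mem k p i)

theorem pd_x (k : Type*) [Field k] (p : ℕ) [CharP k p] {ι : Type*} [DecidableEq ι] (i j : ι) :
    pd k p i (x k p j) = if i = j then 1 else 0 := by
  unfold pd x
  rw [Derivation.liftOfSurjective_apply, MvPolynomial.pderiv_X, Pi.single_apply]
  simp only [eq_comm (a := i)]
  split_ifs <;> simp

theorem witt_ext {k : Type*} [Field k] {p : ℕ} {ι : Type*} {D E : Witt k p ι}
    (h : ∀ i, D (x k p i) = E (x k p i)) : D = E := by
  ext f
  obtain ⟨g, rfl⟩ := mk_surjective k p ι f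
  have : D.compAlgebraMap (MvPolynomial ι k) = E.compAlgebraMap (MvPolynomial ι k) :=
    MvPolynomial.derivation_ext fun i => h i
  exact DFunLike.congr_fun this g

theorem witt_sum_apply {k : Type*} [Field k] {p : ℕ} {ι : Type*} {s : Finset ι}
    (D : ι → Witt k p ι) (f : TruncPoly k p ι) : (∑ i ∈ s, D i) f = ∑ i ∈ s, D i f :=
  map_sum ({ toFun := fun E => E f, map_zero' := rfl, map_add' := fun _ _ => rfl } :
    Witt k p ι →+ TruncPoly k p ι) D s

theorem witt_eq_sum {k : Type*} [Field k] {p : ℕ} [CharP k p] {ι : Type*} [Fintype ι]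
    (D : Witt k p ι) : D = ∑ i, D (x k p i) • pd k p i := by
  classical
  apply witt_ext
  intro j
  have : (∑ i, D (x k p i) • pd k p i) (x k p j) = ∑ i, D (x k p i) • pd k p i (x k p j) :=
    witt_sum_apply _ _
  rw [this]
  simp [pd_x]

/-- `∂_i (D f) - D (∂_i f) = ∑_l ∂_i (D x_l) ∂_l f`. -/
theorem pd_comm {k : Type*} [Field k] {p : ℕ} [CharP k p] {ι : Type*} [Fintype ι]
    (D : Witt k p ι) (i : ι) (f : TruncPoly k p ι) :
    pd k p i (D f) = D (pd k p i f) + ∑ l, pd k p i (D (x k p l)) * pd k p l f := by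
  classical
  have h := witt_eq_sum ⁅pd k p i, D⁆
  have h2 := DFunLike.congr_fun h f
  have h3 : ∀ l, ⁅pd k p i, D⁆ (x k p l) = pd k p i (D (x k p l)) := by
    intro l
    rw [Derivation.commutator_apply, pd_x]
    split_ifs <;> simp
  simp only [h3] at h2
  rw [Derivation.commutator_apply, witt_sum_apply] at h2
  rw [← sub_eq_iff_eq_add', h2]
  rfl

theorem iterate_leibniz {k : Type*} [Field k] {p : ℕ} {ι : Type*} (D : Witt k p ι) (n : ℕ)
    (a b : TruncPoly k p ι) :
    D^[n] (a * b) = ∑ ij ∈ Finset.HasAntidiagonal.antidiagonal n, (n.choose ij.1 : TruncPoly k p ι) *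
      (D^[ij.1] a * D^[ij.2] b) := by
  induction n with
  | zero => simp
  | succ n ih =>
    rw [Finset.sum_antidiagonal_choose_succ_mul (fun i j => D^[i] a * D^[j] b) n,
      Function.iterate_succ_apply', ih, map_sum, ← Finset.sum_add_distrib]
    refine Finset.sum_congr rfl fun ij hij => ?_
    rw [Nat.choose_symm_of_eq_add (Finset.HasAntidiagonal.mem_antidiagonal.mp hij).symm]
    simp only [Derivation.leibniz, Function.iterate_succ_apply', smul_eq_mul,
      Derivation.map_natCast]
    ring

/-- The `p`-map of the Jacobson-Witt algebra: `D ↦ D^p`, the `p`-fold composition of `D` with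
itself, which is again a derivation. -/
def pMap {k : Type*} [Field k] {p : ℕ} [Fact p.Prime] [CharP k p] {ι : Type*}
    (D : Witt k p ι) : Witt k p ι :=
  Derivation.mk' ((D : TruncPoly k p ι →ₗ[k] TruncPoly k p ι) ^ p) (by
    intro a b
    have hp : p.Prime := Fact.out
    have h0 : ∀ c : TruncPoly k p ι, (p : TruncPoly k p ι) * c = 0 := fun c => by
      rw [← map_natCast (algebraMap k (TruncPoly k p ι)), CharP.cast_eq_zero, map_zero, zero_mul]
    simp only [Module.End.pow_apply, Derivation.coeFn_coe, smul_eq_mul]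
    rw [iterate_leibniz, Finset.Nat.sum_antidiagonal_eq_sum_range_succ
      (fun i j => (p.choose i : TruncPoly k p ι) * (D^[i] a * D^[j] b)), Finset.sum_range_succ,
      Finset.sum_eq_single 0]
    · simp
      ring
    · intro i hi hi0
      obtain ⟨c, hc⟩ := hp.dvd_choose_self hi0 (Finset.mem_range.mp hi)
      rw [hc, Nat.cast_mul, mul_assoc, h0]
    · intro h
      exact absurd (Finset.mem_range.mpr hp.pos) h)

theorem pMap_apply {k : Type*} [Field k] {p : ℕ} [Fact p.Prime] [CharP k p] {ι : Type*}
    (D : Witt k p ι) (f : TruncPoly k p ι) : pMap D f = D^[p] f := by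
  simp [pMap, Module.End.pow_apply]

/-- The divergence `div D = ∑ ∂_i (D x_i)`. -/
def divergence {k : Type*} [Field k] {p : ℕ} [CharP k p] {ι : Type*} [Fintype ι]
    (D : Witt k p ι) : TruncPoly k p ι :=
  ∑ i, pd k p i (D (x k p i))

/-- The Lie algebra `S` of all derivations of divergence zero. -/
def divFree (k : Type*) [Field k] (p : ℕ) [CharP k p] (ι : Type*) [Fintype ι] :
    LieSubalgebra k (Witt k p ι) where
  carrier := {D | divergence D = 0}
  zero_mem' := by simp [divergence]
  add_mem' {D E} hD hE := by
    simp only [Set.mem_ofPred_eq, divergence] at *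
    simp [Finset.sum_add_distrib, hD, hE]
  smul_mem' c D hD := by
    simp only [Set.mem_ofPred_eq, divergence] at *
    simp [← Finset.smul_sum, hD]
  lie_mem' {D E} hD hE := by
    have hD' : divergence D = 0 := hD
    have hE' : divergence E = 0 := hE
    unfold divergence at hD' hE'
    change divergence ⁅D, E⁆ = 0
    have h : ∀ i, pd k p i (⁅D, E⁆ (x k p i)) =
        (D (pd k p i (E (x k p i))) + ∑ l, pd k p i (D (x k p l)) * pd k p l (E (x k p i))) -
        (E (pd k p i (D (x k p i))) + ∑ l, pd k p i (E (x k p l)) * pd k p l (D (x k p i))) := by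
      intro i
      rw [← pd_comm, ← pd_comm, Derivation.commutator_apply, map_sub]
    simp only [divergence, h]
    rw [Finset.sum_sub_distrib, Finset.sum_add_distrib, Finset.sum_add_distrib, ← map_sum,
      ← map_sum, hD', hE', Finset.sum_comm]
    simp [mul_comm]

/-- The sign `σ(i)` on the index set `Fin m ⊕ Fin m`; the left summand stands for the indices
`1, …, m`, the right summand for `m + 1, …, 2m`. -/
def sgn (k : Type*) [Field k] {m : ℕ} : Fin m ⊕ Fin m → k :=
  Sum.elim (fun _ => 1) (fun _ => -1)

theorem sgn_swap (k : Type*) [Field k] {m : ℕ} (i : Fin m ⊕ Fin m) :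
    sgn k i.swap = -sgn k i := by
  cases i <;> simp [sgn]

theorem mul_neg_smul_aux {k A : Type*} [CommRing k] [CommRing A] [Algebra k A] (c : k) (a b : A) :
    a * (-c • b) = -(b * c • a) := by
  rw [neg_smul, mul_neg, mul_smul_comm, mul_smul_comm, mul_comm]

/-- The Lie algebra `H(2m)` of all derivations `D = ∑ f_i ∂_i` (so `f_i = D x_i`) with
`σ(i) ∂_{j'} f_i = σ(j) ∂_{i'} f_j` for all `i, j`. The map `i ↦ i'`, `i ± m`, is the swap of the two
summands of the index set. -/
def ham (k : Type*) [Field k] (p : ℕ) [CharP k p] (m : ℕ) :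
    LieSubalgebra k (Witt k p (Fin m ⊕ Fin m)) where
  carrier := {D | ∀ i j, sgn k i • pd k p j.swap (D (x k p i)) =
    sgn k j • pd k p i.swap (D (x k p j))}
  zero_mem' := by simp
  add_mem' {D E} hD hE i j := by
    simp [smul_add, hD i j, hE i j]
  smul_mem' c D hD i j := by
    have := congrArg (c • ·) (hD i j)
    simpa [smul_comm c] using this
  lie_mem' {D E} hD hE := by
    have key : ∀ D E : Witt k p (Fin m ⊕ Fin m),
        (∀ i j, sgn k i • pd k p j.swap (D (x k p i)) =
          sgn k j • pd k p i.swap (D (x k p j))) →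
        (∀ i j, sgn k i • pd k p j.swap (E (x k p i)) =
          sgn k j • pd k p i.swap (E (x k p j))) → ∀ i j,
        sgn k i • ∑ l, pd k p j.swap (D (x k p l)) * pd k p l (E (x k p i)) =
          - (sgn k j • ∑ l, pd k p i.swap (E (x k p l)) * pd k p l (D (x k p j))) := by
      intro D E hD hE i j
      rw [Finset.smul_sum, Finset.smul_sum, ← Finset.sum_neg_distrib,
        ← Equiv.sum_comp (Equiv.sumComm (Fin m) (Fin m))
          (fun l => -(sgn k j • (pd k p i.swap (E (x k p l)) * pd k p l (D (x k p j)))))]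
      refine Finset.sum_congr rfl fun l _ => ?_
      simp only [Equiv.sumComm_apply]
      have h1 := hE i l.swap
      have h2 := hD j l
      rw [Sum.swap_swap, sgn_swap] at h1
      rw [← mul_smul_comm, h1, ← mul_smul_comm, h2]
      exact mul_neg_smul_aux (k := k) (A := TruncPoly k p (Fin m ⊕ Fin m)) (sgn k l) _ _
    intro i j
    have h : ∀ i j, pd k p j (⁅D, E⁆ (x k p i)) =
        (D (pd k p j (E (x k p i))) + ∑ l, pd k p j (D (x k p l)) * pd k p l (E (x k p i))) -
        (E (pd k p j (D (x k p i))) + ∑ l, pd k p j (E (x k p l)) * pd k p l (D (x k p i))) := by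
      intro i j
      rw [← pd_comm, ← pd_comm, Derivation.commutator_apply, map_sub]
    have h1 := congrArg D (hE i j)
    have h2 := congrArg E (hD i j)
    rw [Derivation.map_smul, Derivation.map_smul] at h1 h2
    rw [h, h, smul_sub, smul_sub, smul_add, smul_add, smul_add, smul_add, key D E hD hE i j,
      key E D hE hD i j, h1, h2]
    abel

/-- The `j`-th derived algebra `L^{(j)}` of a Lie subalgebra `L`, again as a Lie subalgebra of the
ambient Lie algebra. -/
def derivedSubalgebra {k W : Type*} [CommRing k] [LieRing W] [LieAlgebra k W]
    (L : LieSubalgebra k W) (j : ℕ) : LieSubalgebra k W :=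
  ((LieAlgebra.derivedSeries k L j).toLieSubalgebra).map L.incl

/-- The Lie algebra `W(n)`. -/
def wAlg (k : Type*) [Field k] (p n : ℕ) : LieSubalgebra k (Witt k p (Fin n)) := ⊤

/-- The special algebra `S(n)^{(1)}`. -/
def sAlg (k : Type*) [Field k] (p : ℕ) [CharP k p] (n : ℕ) : LieSubalgebra k (Witt k p (Fin n)) :=
  derivedSubalgebra (divFree k p (Fin n)) 1

/-- The Hamiltonian algebra `H(2m)^{(2)}`. -/
def hAlg (k : Type*) [Field k] (p : ℕ) [CharP k p] (m : ℕ) :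
    LieSubalgebra k (Witt k p (Fin m ⊕ Fin m)) :=
  derivedSubalgebra (ham k p m) 2

/-- The element `y_i = 1 + x_i` if `shifted` holds, and `x_i` otherwise. -/
def z (k : Type*) [Field k] (p : ℕ) {ι : Type*} (shifted : Prop) [Decidable shifted] (i : ι) :
    TruncPoly k p ι :=
  if shifted then 1 + x k p i else x k p i

/-- `d_i^{W,r}`: `y_i ∂_i` for the first `r` indices, `x_i ∂_i` for the others. (Here and below the
indices start from `0`.) -/
def dW (k : Type*) [Field k] (p : ℕ) [CharP k p] (n r : ℕ) (i : Fin n) : Witt k p (Fin n) :=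
  z k p (i.val < r) i • pd k p i

/-- `d_i^{S,r}` in `S(l + 1)`: `y_i ∂_i - x_n ∂_n` for the first `r` indices, `x_i ∂_i - x_n ∂_n` for
the others, where `n = l + 1` and `i` runs over all indices but the last one. -/
def dS (k : Type*) [Field k] (p : ℕ) [CharP k p] (l r : ℕ) (i : Fin l) :
    Witt k p (Fin (l + 1)) :=
  z k p (i.val < r) i.castSucc • pd k p i.castSucc -
    x k p (Fin.last l) • pd k p (Fin.last l)

/-- `d_i^{H,r}`: `y_i ∂_i - x_{i'} ∂_{i'}` for the first `r` indices, `x_i ∂_i - x_{i'} ∂_{i'}` for the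
others, `i` running over the first half of the `2m` indices. -/
def dH (k : Type*) [Field k] (p : ℕ) [CharP k p] (m r : ℕ) (i : Fin m) :
    Witt k p (Fin m ⊕ Fin m) :=
  z k p (i.val < r) (Sum.inl i : Fin m ⊕ Fin m) • pd k p (Sum.inl i : Fin m ⊕ Fin m) -
    x k p (Sum.inr i : Fin m ⊕ Fin m) • pd k p (Sum.inr i : Fin m ⊕ Fin m)

/-- The standard torus `t_r`, spanned by `d_1^r, …, d_μ^r`. -/
def torus {k W : Type*} [Field k] [AddCommGroup W] [Module k W] {μ : ℕ}
    (d : ℕ → Fin μ → W) (r : ℕ) : Submodule k W :=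
  Submodule.span k (Set.range (d r))

section Index

variable {k : Type*} [Field k] {p : ℕ} [Fact p.Prime] [CharP k p] {ι : Type*}

/-- `σ` is an automorphism of the restricted Lie algebra `g ⊆ W`, that is, an element of
`Aut_p(g)`: a Lie algebra automorphism with `σ (X^{[p]}) = (σ X)^{[p]}`. -/
def IsRestrictedAut (g : LieSubalgebra k (Witt k p ι)) (σ : g ≃ₗ⁅k⁆ g) : Prop :=
  ∀ X Y : g, (Y : Witt k p ι) = pMap (X : Witt k p ι) →
    (σ Y : Witt k p ι) = pMap (σ X : Witt k p ι)

/-- The orbit of `s` under `G = Aut_p(g)`. -/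
def orbit (g : LieSubalgebra k (Witt k p ι)) (s : Witt k p ι) : Set (Witt k p ι) :=
  {t | ∃ hs : s ∈ g, ∃ σ : g ≃ₗ⁅k⁆ g, IsRestrictedAut g σ ∧ (σ ⟨s, hs⟩ : Witt k p ι) = t}

/-- The set `S_g` of semisimple elements of `g`: those `s` which lie in the span of the
`s^{[p]^j}`, `j ≥ 1`. -/
def semisimple (g : LieSubalgebra k (Witt k p ι)) : Set (Witt k p ι) :=
  {s | s ∈ g ∧ s ∈ Submodule.span k (Set.range fun j : ℕ => pMap^[j + 1] s)}

/-- The index `min {r : G.s ∩ t_r ≠ ∅}` of `s`, with respect to the tori `t_0, …, t_μ`. -/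
def index (g : LieSubalgebra k (Witt k p ι)) {μ : ℕ} (d : ℕ → Fin μ → Witt k p ι)
    (s : Witt k p ι) : ℕ :=
  sInf {r | r ≤ μ ∧ (orbit g s ∩ (torus (k := k) d r : Set (Witt k p ι))).Nonempty}

/-- `t_r^{g,r}`: the elements of the torus `t_r` that are semisimple elements of `g` of index `r`. -/
def torusIndex (g : LieSubalgebra k (Witt k p ι)) {μ : ℕ} (d : ℕ → Fin μ → Witt k p ι)
    (r : ℕ) : Set (Witt k p ι) :=
  (torus (k := k) d r : Set (Witt k p ι)) ∩ {s | s ∈ semisimple g ∧ index g d s = r}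

end Index

end CartanType

end

/-! Independence over `F_p` is tied to the index by two facts about the tori `t_r`.

Transvections: for `s ≤ r` the unit `y_s` is an eigenvector of `d` with eigenvalue `λ_s`. The
substitution `z_j ↦ z_j y_s⁻¹` therefore turns `λ_j` into `λ_j + λ_s`. It must be corrected on
further generators so as to preserve the divergence (type `S`) or the Poisson bracket (type `H`);
conjugation by it then lies in `Aut_p(g)`. If `λ_1, …, λ_r` are dependent over `F_p`, transvections
make `λ_r` vanish, the element lands in `t_{r-1}`, and its index is smaller than `r`.

Rigidity: suppose that `λ_1, …, λ_r` are independent and that some `σ` in `Aut_p(g)` moves `d` to an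
element of `t_{r'}` with coordinates `e_i` and `r' < r`. Some `λ_s` with `s ≤ r` lies outside the
`F_p`-span of `e_1, …, e_{r'}`, so there is an `F_p`-linear `ψ : k → F_p` with `ψ(λ_s) = 1` that
kills this span. On finitely many elements `ψ` is an additive polynomial `∑ c_j v^(p^j)`, and `σ`
commutes with the `p`-map. Hence `σ` sends `∑ ψ(λ_i) d_i^r` to `∑ ψ(e_i) d_i^{r'}`, which lies in
`t_0`. Transvections with source `s` carry `d_s^r` to the former element, so `d_s^r` would be
conjugate into `t_0`. `mem_torusIndex_iff` is this argument.

What remains is that no Lie automorphism moves `d_s^r` into `t_0` (`not_conj_of_sandwich`). Call `c`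
a sandwich if `[c,[c,w]] = 0` for all `w ∈ g`. Sandwiches have positive degree in the standard
filtration, and `t_0` normalises the positive part; so if `σ(d_s^r) ∈ t_0`, the preimage `V` of the
positive part contains all sandwiches and is stable under `ad d_s^r`. Now `x_s^(p-1) = ∑_{i<p}
y_s^i` decomposes into eigenvectors of `d_s^r`, so a sandwich with factor `x_s^(p-1)` yields an
element of `V` in which this factor is replaced by `1`. Such elements produce one with an
eigenvector of eigenvalue `-1`, impossible in positive degree. The three types differ only in the
transvections and in the choice of sandwiches. -/

noncomputable section

set_option linter.unusedSectionVars false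

namespace CartanType

/-! ### Additive polynomials and `F_p`-linear maps. -/

section Additive

variable {k : Type*} [Field k] {p : ℕ} [Fact p.Prime] [CharP k p] [Algebra (ZMod p) k]

/-- The `F_p`-linear map `v ↦ ∑ c_j v^(p^j)` attached to an additive polynomial. -/
def additiveMap {N : ℕ} (c : Fin N → k) : k →ₗ[ZMod p] k :=
  AddMonoidHom.toZModLinearMap p
    { toFun := fun v => ∑ j, c j * v ^ p ^ (j : ℕ)
      map_zero' := by
        refine Finset.sum_eq_zero fun j _ => ?_
        rw [zero_pow (pow_ne_zero _ (Fact.out : p.Prime).ne_zero), mul_zero]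
      map_add' := fun v w => by
        simp only [add_pow_char_pow, mul_add, Finset.sum_add_distrib] }

theorem additiveMap_apply {N : ℕ} (c : Fin N → k) (v : k) :
    additiveMap (p := p) c v = ∑ j, c j * v ^ p ^ (j : ℕ) := rfl

/-- An additive polynomial with fewer than `N + 1` coefficients that vanishes on `N` independent
elements is zero (nondegeneracy of the Moore matrix). -/
theorem eq_zero_of_additiveMap_basis_eq_zero {N : ℕ} {v : Fin N → k}
    (hv : LinearIndependent (ZMod p) v)
    (c : Fin N → k) (hc : ∀ i, additiveMap (p := p) c (v i) = 0) : c = 0 := by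
  classical
  have hp : p.Prime := Fact.out
  rcases Nat.eq_zero_or_pos N with rfl | hN
  · exact Subsingleton.elim _ _
  let P : Polynomial k := ∑ j : Fin N, Polynomial.C (c j) * Polynomial.X ^ p ^ (j : ℕ)
  have hP : ∀ u, P.eval u = additiveMap (p := p) c u := fun u => by
    simp [P, additiveMap_apply, Polynomial.eval_finsetSum]
  have hinj : Function.Injective (Fintype.linearCombination (ZMod p) v) :=
    linearIndependent_iff_injective_fintypeLinearCombination.1 hv
  have hzero : P = 0 := by
    -- The degree is at most `p^(N-1)`, while `P` vanishes on all `p^N` combinations of the `v_i`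
    -- with coefficients in `F_p`, which are distinct by independence.
    refine Polynomial.eq_zero_of_natDegree_lt_card_of_eval_eq_zero P hinj (fun a => ?_) ?_
    · rw [hP, Fintype.linearCombination_apply, map_sum]
      exact Finset.sum_eq_zero fun i _ => by rw [map_smul, hc, smul_zero]
    · rw [Fintype.card_fun, ZMod.card, Fintype.card_fin]
      refine lt_of_le_of_lt (Polynomial.natDegree_sum_le_of_forall_le _ _ (n := p ^ (N - 1))
        fun j _ => ?_) (Nat.pow_lt_pow_right hp.one_lt (by omega))
      exact (Polynomial.natDegree_C_mul_X_pow_le _ _).trans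
        (Nat.pow_le_pow_right hp.pos (by omega))
  ext j
  have := congrArg (Polynomial.coeff · (p ^ (j : ℕ))) hzero
  simp only [P, Polynomial.finsetSum_coeff, Polynomial.coeff_C_mul, Polynomial.coeff_X_pow,
    Polynomial.coeff_zero] at this
  rw [Finset.sum_eq_single j] at this
  · simpa using this
  · intro b _ hb
    rw [if_neg, mul_zero]
    exact fun h => hb (Fin.ext (Nat.pow_right_injective hp.two_le h).symm)
  · simp

/-- On finitely many elements, every `F_p`-linear map is given by an additive polynomial. -/
theorem exists_additiveMap_eq {ι : Type*} [Finite ι] (a : ι → k) (ψ : k →ₗ[ZMod p] k) :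
    ∃ (N : ℕ) (c : Fin N → k), ∀ i, additiveMap (p := p) c (a i) = ψ (a i) := by
  classical
  let U := Submodule.span (ZMod p) (Set.range a)
  have : Module.Finite (ZMod p) U := Module.Finite.span_of_finite _ (Set.finite_range a)
  let b := Module.finBasis (ZMod p) U
  let v : Fin (Module.finrank (ZMod p) U) → k := fun i => b i
  have hv : LinearIndependent (ZMod p) v :=
    b.linearIndependent.map' U.subtype U.ker_subtype
  let Θ : (Fin (Module.finrank (ZMod p) U) → k) →ₗ[k] (Fin (Module.finrank (ZMod p) U) → k) :=
    { toFun := fun c i => additiveMap (p := p) c (v i)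
      map_add' := fun c c' => by
        ext i
        simp [additiveMap_apply, add_mul, Finset.sum_add_distrib]
      map_smul' := fun t c => by
        ext i
        simp [additiveMap_apply, mul_assoc, Finset.mul_sum] }
  -- `Θ` is the square Moore matrix of a basis of the span: being injective it is surjective, so any
  -- values on the basis are interpolated.
  have hΘ : Function.Injective Θ := by
    rw [← LinearMap.ker_eq_bot, LinearMap.ker_eq_bot']
    exact fun c hc => eq_zero_of_additiveMap_basis_eq_zero hv c fun i => congrFun hc i
  obtain ⟨c, hc⟩ := LinearMap.surjective_of_injective hΘ fun i => ψ (v i)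
  refine ⟨_, c, fun i => ?_⟩
  have h : (additiveMap (p := p) c).comp U.subtype = ψ.comp U.subtype :=
    b.ext fun i => congrFun hc i
  exact LinearMap.congr_fun h ⟨a i, Submodule.subset_span ⟨i, rfl⟩⟩

end Additive

/-! ### Conjugacy and composition of transvections. -/

section Conjugacy

variable {k : Type*} [Field k] {p : ℕ} [Fact p.Prime] [CharP k p] {ι : Type*}

theorem IsRestrictedAut.refl (g : LieSubalgebra k (Witt k p ι)) :
    IsRestrictedAut g LieEquiv.refl := fun _ _ h => h

theorem IsRestrictedAut.trans {g : LieSubalgebra k (Witt k p ι)} {σ τ : g ≃ₗ⁅k⁆ g}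
    (hσ : IsRestrictedAut g σ) (hτ : IsRestrictedAut g τ) : IsRestrictedAut g (σ.trans τ) :=
  fun X Y h => hτ (σ X) (σ Y) (hσ X Y h)

/-- Two elements of `g` are conjugate under `Aut_p(g)` and under the inverse automorphism. -/
def Conj (g : LieSubalgebra k (Witt k p ι)) (s t : Witt k p ι) : Prop :=
  ∃ (hs : s ∈ g) (σ : g ≃ₗ⁅k⁆ g), IsRestrictedAut g σ ∧ IsRestrictedAut g σ.symm ∧
    (σ ⟨s, hs⟩ : Witt k p ι) = t

theorem Conj.refl {g : LieSubalgebra k (Witt k p ι)} {s : Witt k p ι} (hs : s ∈ g) :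
    Conj g s s :=
  ⟨hs, LieEquiv.refl, IsRestrictedAut.refl g, IsRestrictedAut.refl g, rfl⟩

theorem Conj.trans {g : LieSubalgebra k (Witt k p ι)} {s t u : Witt k p ι} (h : Conj g s t)
    (h' : Conj g t u) : Conj g s u := by
  obtain ⟨hs, σ, h1, h2, rfl⟩ := h
  obtain ⟨ht, τ, h3, h4, rfl⟩ := h'
  exact ⟨hs, σ.trans τ, h1.trans h3, h4.trans h2, rfl⟩

variable {g : LieSubalgebra k (Witt k p ι)} {μ : ℕ} {d : Fin μ → Witt k p ι}

theorem conj_update_add_nsmul (hmem : ∀ i, d i ∈ g) {s j : Fin μ} (hsj : j ≠ s)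
    (htrans : ∀ lam : Fin μ → k,
      Conj g (∑ i, lam i • d i) (∑ i, Function.update lam j (lam j + lam s) i • d i))
    (lam : Fin μ → k) (c : ℕ) :
    Conj g (∑ i, lam i • d i) (∑ i, Function.update lam j (lam j + c * lam s) i • d i) := by
  induction c with
  | zero => simpa using Conj.refl (sum_mem fun i _ => g.smul_mem _ (hmem i))
  | succ c ih =>
    refine ih.trans ?_
    have h := htrans (Function.update lam j (lam j + c * lam s))
    rw [Function.update_idem, Function.update_self, Function.update_of_ne hsj.symm] at h
    have hc : lam j + ((c + 1 : ℕ) : k) * lam s = lam j + c * lam s + lam s := by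
      push_cast
      ring
    rwa [hc]

variable [Algebra (ZMod p) k]

theorem conj_update_add_smul (hmem : ∀ i, d i ∈ g) {s j : Fin μ} (hsj : j ≠ s)
    (htrans : ∀ lam : Fin μ → k,
      Conj g (∑ i, lam i • d i) (∑ i, Function.update lam j (lam j + lam s) i • d i))
    (lam : Fin μ → k) (c : ZMod p) :
    Conj g (∑ i, lam i • d i) (∑ i, Function.update lam j (lam j + c • lam s) i • d i) := by
  have h := conj_update_add_nsmul hmem hsj htrans lam c.val
  have hc : (c.val : k) * lam s = c • lam s := by
    rw [Algebra.smul_def, ← map_natCast (algebraMap (ZMod p) k), ZMod.natCast_zmod_val]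
  rwa [hc] at h

/-- Adding multiples of one coordinate to several others. -/
theorem conj_add_smul_of_source (hmem : ∀ i, d i ∈ g) {s : Fin μ}
    (htrans : ∀ j, j ≠ s → ∀ lam : Fin μ → k,
      Conj g (∑ i, lam i • d i) (∑ i, Function.update lam j (lam j + lam s) i • d i))
    (lam : Fin μ → k) (c : Fin μ → ZMod p) (F : Finset (Fin μ)) (hF : s ∉ F) :
    Conj g (∑ i, lam i • d i) (∑ i, (if i ∈ F then lam i + c i • lam s else lam i) • d i) := by
  induction F using Finset.induction_on with
  | empty => simpa using Conj.refl (sum_mem fun i _ => g.smul_mem _ (hmem i))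
  | insert j F hj ih =>
    rw [Finset.mem_insert, not_or] at hF
    refine (ih hF.2).trans ?_
    convert conj_update_add_smul hmem (Ne.symm hF.1) (htrans j (Ne.symm hF.1))
      (fun i => if i ∈ F then lam i + c i • lam s else lam i) (c j) using 4 with i
    by_cases hij : i = j
    · subst hij
      simp [hj, hF.2]
    · simp [hij]

/-- Adding multiples of several coordinates to a given one. -/
theorem conj_add_sum_smul_of_target (hmem : ∀ i, d i ∈ g) {s : Fin μ} (F : Finset (Fin μ))
    (hF : s ∉ F)
    (htrans : ∀ i ∈ F, ∀ lam : Fin μ → k,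
      Conj g (∑ i, lam i • d i) (∑ l, Function.update lam s (lam s + lam i) l • d l))
    (lam : Fin μ → k) (c : Fin μ → ZMod p) :
    Conj g (∑ i, lam i • d i)
      (∑ i, Function.update lam s (lam s + ∑ l ∈ F, c l • lam l) i • d i) := by
  induction F using Finset.induction_on with
  | empty => simpa using Conj.refl (sum_mem fun i _ => g.smul_mem _ (hmem i))
  | insert j F hj ih =>
    rw [Finset.mem_insert, not_or] at hF
    refine (ih hF.2 fun i hi => htrans i (Finset.mem_insert_of_mem hi)).trans ?_
    have h := conj_update_add_smul hmem hF.1 (htrans j (Finset.mem_insert_self _ _))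
      (Function.update lam s (lam s + ∑ l ∈ F, c l • lam l)) (c j)
    rw [Function.update_idem, Function.update_self, Function.update_of_ne (Ne.symm hF.1),
      add_assoc, add_comm _ (c j • lam j)] at h
    rwa [Finset.sum_insert hj]

end Conjugacy

/-! ### The index criterion, abstracted from the three types. -/

section Criterion

variable {k : Type*} [Field k] {p : ℕ} [Fact p.Prime] [CharP k p] {ι : Type*}
  {g : LieSubalgebra k (Witt k p ι)} {μ : ℕ} {d : Fin μ → Witt k p ι}

theorem pMap_iterate_sum (hpow : ∀ lam : Fin μ → k,
      pMap (∑ i, lam i • d i) = ∑ i, lam i ^ p • d i) (lam : Fin μ → k) (j : ℕ) :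
    pMap^[j] (∑ i, lam i • d i) = ∑ i, lam i ^ p ^ j • d i := by
  induction j with
  | zero => simp
  | succ j ih =>
    rw [Function.iterate_succ_apply', ih, hpow]
    simp only [← pow_mul, pow_succ]

/-- Frobenius is injective and `F_p`-linear, so it has an `F_p`-linear left inverse. Interpolating
this inverse on the `λ_i^p` by an additive polynomial writes the element as a combination of its
iterated `p`-th powers. -/
theorem semisimple_sum [Algebra (ZMod p) k] (hmem : ∀ i, d i ∈ g) (hpow : ∀ lam : Fin μ → k,
      pMap (∑ i, lam i • d i) = ∑ i, lam i ^ p • d i) (lam : Fin μ → k) :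
    ∑ i, lam i • d i ∈ semisimple g := by
  refine ⟨sum_mem fun i _ => g.smul_mem _ (hmem i), ?_⟩
  let Fr : k →ₗ[ZMod p] k := AddMonoidHom.toZModLinearMap p (frobenius k p : k →+ k)
  obtain ⟨ψ, hψ⟩ := Fr.exists_leftInverse_of_injective
    (LinearMap.ker_eq_bot.2 (frobenius k p).injective)
  obtain ⟨N, c, hc⟩ := exists_additiveMap_eq (p := p) (fun i => lam i ^ p) ψ
  have h : ∑ i, lam i • d i = ∑ j : Fin N, c j • pMap^[(j : ℕ) + 1] (∑ i, lam i • d i) := by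
    simp only [pMap_iterate_sum hpow, Finset.smul_sum]
    rw [Finset.sum_comm]
    refine Finset.sum_congr rfl fun i _ => ?_
    simp only [smul_smul, ← Finset.sum_smul]
    congr 1
    have h1 : ψ (lam i ^ p) = lam i := LinearMap.congr_fun hψ (lam i)
    have h2 := hc i
    rw [h1, additiveMap_apply] at h2
    simp only [← pow_mul, ← pow_succ'] at h2
    exact h2.symm
  have hmem' : ∑ j : Fin N, c j • pMap^[(j : ℕ) + 1] (∑ i, lam i • d i) ∈
      Submodule.span k (Set.range fun j : ℕ => pMap^[j + 1] (∑ i, lam i • d i)) :=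
     sum_mem fun j _ => Submodule.smul_mem _ _ (Submodule.subset_span ⟨j, rfl⟩)
  rwa [← h] at hmem'

/-- An automorphism compatible with the `p`-map is compatible with the action of linear maps
`F_p → k` on the coordinates with respect to toral bases. -/
theorem apply_sum_linearMap [Algebra (ZMod p) k] {ν : ℕ} {e : Fin ν → Witt k p ι}
    (hdm : ∀ i, d i ∈ g) (hem : ∀ i, e i ∈ g)
    (hd : ∀ lam : Fin μ → k, pMap (∑ i, lam i • d i) = ∑ i, lam i ^ p • d i)
    (he : ∀ lam : Fin ν → k, pMap (∑ i, lam i • e i) = ∑ i, lam i ^ p • e i)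
    {σ : g ≃ₗ⁅k⁆ g} (hσ : IsRestrictedAut g σ) (lam : Fin μ → k) (κ : Fin ν → k)
    (h : σ (∑ i, lam i • ⟨d i, hdm i⟩) = ∑ i, κ i • ⟨e i, hem i⟩) (ψ : k →ₗ[ZMod p] k) :
    σ (∑ i, ψ (lam i) • ⟨d i, hdm i⟩) = ∑ i, ψ (κ i) • ⟨e i, hem i⟩ := by
  have hcd : ∀ lam : Fin μ → k,
      ((∑ i, lam i • (⟨d i, hdm i⟩ : g) : g) : Witt k p ι) = ∑ i, lam i • d i := fun lam =>
    map_sum g.toSubmodule.subtype _ _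
  have hce : ∀ lam : Fin ν → k,
      ((∑ i, lam i • (⟨e i, hem i⟩ : g) : g) : Witt k p ι) = ∑ i, lam i • e i := fun lam =>
    map_sum g.toSubmodule.subtype _ _
  have hiter : ∀ j : ℕ, σ (∑ i, lam i ^ p ^ j • ⟨d i, hdm i⟩) =
      ∑ i, κ i ^ p ^ j • ⟨e i, hem i⟩ := by
    intro j
    induction j with
    | zero => simpa using h
    | succ j ih =>
      have := hσ (∑ i, lam i ^ p ^ j • ⟨d i, hdm i⟩) (∑ i, lam i ^ p ^ (j + 1) • ⟨d i, hdm i⟩)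
        (by rw [hcd, hcd, hd]; simp only [← pow_mul, pow_succ])
      apply Subtype.ext
      rw [this, ih, hce, hce, he]
      simp only [← pow_mul, pow_succ]
  -- Interpolating on `lam` and `κ` together gives the same coefficients on both sides, so linearity
  -- of `σ` suffices.
  obtain ⟨N, c, hc⟩ := exists_additiveMap_eq (p := p) (Sum.elim lam κ) ψ
  have h1 : ∑ i, ψ (lam i) • (⟨d i, hdm i⟩ : g) =
      ∑ j : Fin N, c j • ∑ i, lam i ^ p ^ (j : ℕ) • (⟨d i, hdm i⟩ : g) := by
    simp only [Finset.smul_sum]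
    rw [Finset.sum_comm]
    refine Finset.sum_congr rfl fun i _ => ?_
    simp only [smul_smul, ← Finset.sum_smul]
    rw [← show _ = ψ (lam i) from hc (Sum.inl i)]
    rfl
  have h2 : ∑ i, ψ (κ i) • (⟨e i, hem i⟩ : g) =
      ∑ j : Fin N, c j • ∑ i, κ i ^ p ^ (j : ℕ) • (⟨e i, hem i⟩ : g) := by
    simp only [Finset.smul_sum]
    rw [Finset.sum_comm]
    refine Finset.sum_congr rfl fun i _ => ?_
    simp only [smul_smul, ← Finset.sum_smul]
    rw [← show _ = ψ (κ i) from hc (Sum.inr i)]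
    rfl
  rw [h1, h2, map_sum]
  exact Finset.sum_congr rfl fun j _ => by rw [map_smul, hiter]

/-- The criterion for an element of the torus `t_r` to have index `r`, for a family of toral bases
for which all transvections with source among the first `r` coordinates are realised by
automorphisms, and for which no shifted toral element is conjugate into `t_0`. -/
theorem mem_torusIndex_iff [Algebra (ZMod p) k] {d : ℕ → Fin μ → Witt k p ι}
    (hmem : ∀ r i, d r i ∈ g)
    (hpow : ∀ r, ∀ lam : Fin μ → k, pMap (∑ i, lam i • d r i) = ∑ i, lam i ^ p • d r i)
    (hcongr : ∀ r r' (i : Fin μ), (i.val < r ↔ i.val < r') → d r i = d r' i)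
    (htrans : ∀ r (s j : Fin μ), s.val < r → j ≠ s → ∀ lam : Fin μ → k,
      Conj g (∑ i, lam i • d r i) (∑ i, Function.update lam j (lam j + lam s) i • d r i))
    (hfix : ∀ r (s : Fin μ), s.val < r → ∀ lam : Fin μ → k,
      ∀ σ : g ≃ₗ⁅k⁆ g, (σ ⟨d r s, hmem r s⟩ : Witt k p ι) ≠ ∑ i, lam i • d 0 i)
    {r : ℕ} (hr : 1 ≤ r) (hrμ : r ≤ μ) (lam : Fin μ → k) :
    (∑ i, lam i • d r i) ∈ torusIndex g d r ↔
      LinearIndependent (ZMod p) (fun i : {i : Fin μ // i.val < r} => lam i) := by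
  classical
  have hsum : ∀ r (lam : Fin μ → k), ∑ i, lam i • d r i ∈ g := fun r lam =>
    sum_mem fun i _ => g.smul_mem _ (hmem r i)
  have htorus : ∀ r (lam : Fin μ → k), ∑ i, lam i • d r i ∈ torus (k := k) d r := fun r lam =>
    sum_mem fun i _ => Submodule.smul_mem _ _ (Submodule.subset_span ⟨i, rfl⟩)
  constructor
  · rintro ⟨-, -, hidx⟩
    by_contra hdep
    obtain ⟨a, ha, ⟨s, hs⟩, has⟩ := Fintype.not_linearIndependent_iff.1 hdep
    -- normalise the relation to `lam s = -∑ c_i lam_i`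
    let c : Fin μ → ZMod p := fun i => if h : i.val < r then (a ⟨s, hs⟩)⁻¹ * a ⟨i, h⟩ else 0
    let F : Finset (Fin μ) := (Finset.univ.filter fun i => i.val < r).erase s
    have hrel : lam s + ∑ l ∈ F, c l • lam l = 0 := by
      have h1 : lam s = c s • lam s := by simp [c, hs, inv_mul_cancel₀ has]
      have hsF : s ∈ Finset.univ.filter fun i : Fin μ => i.val < r := by simp [hs]
      rw [h1, Finset.add_sum_erase _ (fun l => c l • lam l) hsF,
        Finset.sum_subtype (p := fun i : Fin μ => i.val < r) _ (by simp)]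
      have h2 := congrArg ((a ⟨s, hs⟩)⁻¹ • ·) ha
      simp only [Finset.smul_sum, smul_smul, smul_zero] at h2
      rw [← h2]
      exact Finset.sum_congr rfl fun i _ => by simp [c, i.2]
    have h1 := conj_add_sum_smul_of_target (p := p) (hmem r) (s := s) F (by simp [F])
      (fun i hi => htrans r i s (by simp [F] at hi; exact hi.2) (by simp [F] at hi; exact Ne.symm hi.1))
      lam c
    rw [hrel] at h1
    obtain ⟨lam', h2, h3⟩ : ∃ lam' : Fin μ → k,
        Conj g (∑ i, lam i • d r i) (∑ i, lam' i • d r i) ∧ lam' ⟨r - 1, by omega⟩ = 0 := by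
      by_cases hsr : s = ⟨r - 1, by omega⟩
      · exact ⟨_, h1, by rw [← hsr, Function.update_self]⟩
      -- The zero sits in coordinate `s`. Adding coordinate `r - 1` to it and then subtracting the
      -- result from coordinate `r - 1` moves the zero to the last shifted index.
      · have hr1 : (⟨r - 1, by omega⟩ : Fin μ).val < r := by simp; omega
        have h2 := h1.trans (htrans r ⟨r - 1, by omega⟩ s hr1 hsr (Function.update lam s 0))
        have h3 := h2.trans (conj_update_add_smul (hmem r) (Ne.symm hsr)
          (htrans r s ⟨r - 1, by omega⟩ hs (Ne.symm hsr)) _ (-1 : ZMod p))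
        refine ⟨_, h3, ?_⟩
        rw [Function.update_self]
        simp [Function.update_of_ne (Ne.symm hsr)]
    -- The bases of `t_r` and `t_{r-1}` differ only at index `r - 1`, whose coefficient is now zero.
    have h4 : ∑ i, lam' i • d r i = ∑ i, lam' i • d (r - 1) i := by
      refine Finset.sum_congr rfl fun i _ => ?_
      by_cases hi : i = ⟨r - 1, by omega⟩
      · rw [hi, h3, zero_smul, zero_smul]
      · have : i.val ≠ r - 1 := fun h => hi (Fin.ext h)
        rw [hcongr r (r - 1) i (by omega)]
    rw [h4] at h2
    obtain ⟨hs', σ, hσ, -, hσe⟩ := h2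
    have : index g d (∑ i, lam i • d r i) ≤ r - 1 :=
      Nat.sInf_le ⟨by omega, _, ⟨hs', σ, hσ, hσe⟩, htorus _ _⟩
    omega
  · intro hli
    refine ⟨htorus _ _, semisimple_sum (hmem r) (hpow r) lam, ?_⟩
    have hself : r ∈ {r' | r' ≤ μ ∧
        (orbit g (∑ i, lam i • d r i) ∩ (torus (k := k) d r' : Set (Witt k p ι))).Nonempty} :=
      ⟨hrμ, _, ⟨hsum _ _, LieEquiv.refl, IsRestrictedAut.refl g, rfl⟩, htorus _ _⟩
    refine le_antisymm (Nat.sInf_le hself) (le_csInf ⟨r, hself⟩ ?_)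
    rintro r' ⟨-, t, ⟨hs, σ, hσ, hσt⟩, ht⟩
    by_contra! hlt
    obtain ⟨e, rfl⟩ := (Submodule.mem_span_range_iff_exists_fun k).1 ht
    let U := Submodule.span (ZMod p) (Set.range fun i : Fin r' => e ⟨i, by omega⟩)
    -- `U` has dimension at most `r' < r`, too small for `r` independent elements.
    obtain ⟨s, hsU⟩ : ∃ s : {i : Fin μ // i.val < r}, lam s ∉ U := by
      by_contra! hall
      have : Module.Finite (ZMod p) U := Module.Finite.span_of_finite _ (Set.finite_range _)
      have h2 : LinearIndependent (ZMod p)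
          (fun i : {i : Fin μ // i.val < r} => (⟨lam i, hall i⟩ : U)) :=
        LinearIndependent.of_comp U.subtype hli
      have h3 := h2.fintype_card_le_finrank
      have h4 : Module.finrank (ZMod p) U ≤ r' :=
        (finrank_range_le_card (R := ZMod p) fun i : Fin r' => e ⟨i, by omega⟩).trans_eq
          (Fintype.card_fin _)
      have h5 : Fintype.card {i : Fin μ // i.val < r} = r := by
        rw [Fintype.card_subtype, Fin.card_filter_val_lt, min_eq_right hrμ]
      omega
    obtain ⟨φ, hφs, hφU⟩ := Submodule.exists_le_ker_of_notMem hsU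
    -- `ψ` takes values in the prime field: the coordinates it produces are multiples of `ψ (lam s)
    -- = 1` over `F_p`, as clearing by transvections requires.
    let ψ : k →ₗ[ZMod p] k := (Algebra.linearMap (ZMod p) k).comp ((φ (lam s))⁻¹ • φ)
    have hψs : ψ (lam s) = 1 := by simp [ψ, inv_mul_cancel₀ hφs]
    have hψe : ∀ i : Fin μ, i.val < r' → ψ (e i) = 0 := fun i hi => by
      have : φ (e i) = 0 := hφU (Submodule.subset_span ⟨⟨i, hi⟩, rfl⟩)
      simp [ψ, this]
    have hσ' : σ (∑ i, lam i • ⟨d r i, hmem r i⟩) = ∑ i, e i • ⟨d r' i, hmem r' i⟩ := by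
      apply Subtype.ext
      have h1 : (∑ i, lam i • (⟨d r i, hmem r i⟩ : g)) = ⟨∑ i, lam i • d r i, hs⟩ :=
        Subtype.ext (map_sum g.toSubmodule.subtype _ _)
      rw [h1]
      exact hσt.trans (map_sum g.toSubmodule.subtype
        (fun i => e i • (⟨d r' i, hmem r' i⟩ : g)) Finset.univ).symm
    have h1 := congrArg (Subtype.val)
      (apply_sum_linearMap (hmem r) (hmem r') (hpow r) (hpow r') hσ lam e hσ' ψ)
    -- All shifted coordinates are killed by `ψ`, and the remaining basis vectors are those of
    -- `t_0`.
    have h2 : ((∑ i, ψ (e i) • (⟨d r' i, hmem r' i⟩ : g) : g) : Witt k p ι) =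
        ∑ i, ψ (e i) • d 0 i := by
      refine (map_sum g.toSubmodule.subtype _ _).trans (Finset.sum_congr rfl fun i _ => ?_)
      by_cases hi : i.val < r'
      · rw [hψe i hi, zero_smul, zero_smul, map_zero]
      · rw [hcongr 0 r' i (by omega)]
        rfl
    -- Coordinate `s` equals `1`; subtracting the right `F_p`-multiples of it clears all the others
    -- and leaves `d r s`.
    have h3 := conj_add_smul_of_source (p := p) (hmem r) (s := s)
      (fun j hj => htrans r s j s.2 hj) (fun i => ψ (lam i))
      (fun i => -((φ (lam s))⁻¹ • φ) (lam i)) (Finset.univ.erase s.1) (by simp)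
    have h4 : ∑ i, (if i ∈ Finset.univ.erase s.1 then
        ψ (lam i) + (-((φ (lam s))⁻¹ • φ) (lam i)) • ψ (lam s) else ψ (lam i)) • d r i =
        d r s := by
      rw [Finset.sum_eq_single s.1]
      · simp [hψs]
      · intro i _ hi
        rw [if_pos (by simp [hi]), hψs, Algebra.smul_def, mul_one, map_neg]
        simp [ψ]
      · simp
    rw [h4] at h3
    obtain ⟨hs3, τ, -, -, hτ⟩ := h3
    refine hfix r s s.2 (fun i => ψ (e i)) (τ.symm.trans σ) ?_
    rw [← h2, ← h1]
    have h5 : (⟨d r s, hmem r s⟩ : g) = τ ⟨_, hs3⟩ := Subtype.ext hτ.symm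
    rw [h5, LieEquiv.trans_apply, LieEquiv.symm_apply_apply]
    have h6 : (∑ i, ψ (lam i) • (⟨d r i, hmem r i⟩ : g)) = ⟨_, hs3⟩ :=
      Subtype.ext (map_sum g.toSubmodule.subtype _ _)
    rw [h6]

end Criterion

/-! ### Truncated polynomials: homomorphisms, induction, shifted generators. -/

section TruncPoly

variable {k : Type*} [Field k] {p : ℕ} {ι : Type*}

theorem x_pow (i : ι) : x k p i ^ p = 0 := by
  unfold x
  rw [← map_pow, Ideal.Quotient.mkₐ_eq_mk, Ideal.Quotient.eq_zero_iff_mem]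
  exact Ideal.subset_span ⟨i, rfl⟩

theorem x_pow_eq_zero (i : ι) {a : ℕ} (ha : p ≤ a) : x k p i ^ a = 0 :=
  pow_eq_zero_of_le ha (x_pow i)

theorem truncPoly_algHom_ext {B : Type*} [CommRing B] [Algebra k B]
    {φ ψ : TruncPoly k p ι →ₐ[k] B} (h : ∀ i, φ (x k p i) = ψ (x k p i)) : φ = ψ :=
  Ideal.Quotient.algHom_ext k (MvPolynomial.algHom_ext h)

/-- The algebra homomorphism with `x_i ↦ f_i`, where `f_i ^ p = 0`. -/
def truncLift {B : Type*} [CommRing B] [Algebra k B] (f : ι → B) (hf : ∀ i, f i ^ p = 0) :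
    TruncPoly k p ι →ₐ[k] B :=
  Ideal.Quotient.liftₐ _ (MvPolynomial.aeval f) fun a ha => by
    have h : Ideal.span (Set.range fun i : ι => (MvPolynomial.X i ^ p : MvPolynomial ι k)) ≤
        RingHom.ker (MvPolynomial.aeval f : MvPolynomial ι k →ₐ[k] B) := by
      rw [Ideal.span_le]
      rintro _ ⟨i, rfl⟩
      simp [hf]
    exact h ha

theorem truncLift_x {B : Type*} [CommRing B] [Algebra k B] (f : ι → B) (hf : ∀ i, f i ^ p = 0)
    (i : ι) : truncLift f hf (x k p i) = f i :=
  MvPolynomial.aeval_X f i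

/-- Induction principle for elements of the truncated polynomial ring. -/
theorem truncPoly_induction {P : TruncPoly k p ι → Prop} (hC : ∀ c : k, P (algebraMap k _ c))
    (hadd : ∀ f g, P f → P g → P (f + g)) (hmul : ∀ f i, P f → P (f * x k p i))
    (f : TruncPoly k p ι) : P f := by
  obtain ⟨f, rfl⟩ := mk_surjective k p ι f
  induction f using MvPolynomial.induction_on with
  | C c => exact hC c
  | add f g hf hg => rw [map_add]; exact hadd _ _ hf hg
  | mul_X f i hf => rw [map_mul]; exact hmul _ _ hf

variable [Fact p.Prime]

/-- Evaluation at the origin. -/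
def ev (k : Type*) [Field k] (p : ℕ) [Fact p.Prime] (ι : Type*) : TruncPoly k p ι →ₐ[k] k :=
  truncLift (fun _ => 0) fun _ => zero_pow (Fact.out : p.Prime).ne_zero

@[simp]
theorem ev_x (i : ι) : ev k p ι (x k p i) = 0 := truncLift_x _ _ i

instance : Nontrivial (TruncPoly k p ι) := (ev k p ι).toRingHom.domain_nontrivial

variable [CharP k p]

instance : CharP (TruncPoly k p ι) p :=
  charP_of_injective_algebraMap (algebraMap k (TruncPoly k p ι)).injective p

theorem z_pow (q : Prop) [Decidable q] (i : ι) :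
    (z k p q i : TruncPoly k p ι) ^ p = if q then 1 else 0 := by
  unfold z
  split_ifs
  · rw [add_pow_char, x_pow, one_pow, add_zero]
  · exact x_pow i

theorem z_congr {q q' : Prop} [Decidable q] [Decidable q'] (h : q ↔ q') (i : ι) :
    (z k p q i : TruncPoly k p ι) = z k p q' i := by
  unfold z
  simp only [h]

theorem x_eq_z_sub (q : Prop) [Decidable q] (i : ι) :
    x k p i = z k p q i - if q then 1 else 0 := by
  unfold z
  split_ifs <;> ring

theorem derivation_one_ite (D : Witt k p ι) (q : Prop) [Decidable q] :
    D (if q then 1 else 0) = 0 := by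
  split_ifs <;> simp

theorem derivation_z (D : Witt k p ι) (q : Prop) [Decidable q] (i : ι) :
    D (z k p q i) = D (x k p i) := by
  rw [x_eq_z_sub q i, map_sub, derivation_one_ite, sub_zero]

/-- `x ^ (p - 1) = ∑_{i < p} (1 + x) ^ i` in characteristic `p`. -/
theorem x_pow_pred (s : ι) : x k p s ^ (p - 1) = ∑ i ∈ Finset.range p, (1 + x k p s) ^ i := by
  have hp : p.Prime := Fact.out
  have h : (Polynomial.X : Polynomial k) ^ (p - 1) =
      ∑ i ∈ Finset.range p, (1 + Polynomial.X) ^ i := by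
    -- The geometric series in `1 + X` is `((1 + X)^p - 1) / X`, and its numerator is `X^p`.
    refine mul_right_cancel₀ Polynomial.X_ne_zero ?_
    have h1 := geom_sum_mul (1 + Polynomial.X : Polynomial k) p
    rw [add_sub_cancel_left, add_pow_char, one_pow, add_sub_cancel_left] at h1
    rw [h1, ← pow_succ, Nat.sub_add_cancel hp.one_le]
  simpa using congrArg (Polynomial.aeval (x k p s)) h

end TruncPoly

/-! ### The maximal ideal and derivations of positive degree. -/

section Maximal

variable {k : Type*} [Field k] {p : ℕ} [Fact p.Prime] {ι : Type*}

/-- The maximal ideal, generated by the `x_i`. -/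
def maxIdeal (k : Type*) [Field k] (p : ℕ) (ι : Type*) : Ideal (TruncPoly k p ι) :=
  Ideal.span (Set.range (x k p))

theorem x_mem_maxIdeal (i : ι) : x k p i ∈ maxIdeal k p ι := Ideal.subset_span ⟨i, rfl⟩

theorem sub_ev_mem_maxIdeal (f : TruncPoly k p ι) :
    f - algebraMap k _ (ev k p ι f) ∈ maxIdeal k p ι := by
  induction f using truncPoly_induction with
  | hC c => simp
  | hadd f g hf hg =>
    convert add_mem hf hg using 1
    rw [map_add, map_add]
    ring
  | hmul f i _ =>
    simpa using Ideal.mul_mem_left _ f (x_mem_maxIdeal i)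

theorem ev_eq_zero_of_mem {f : TruncPoly k p ι} (hf : f ∈ maxIdeal k p ι) : ev k p ι f = 0 := by
  have h : maxIdeal k p ι ≤ RingHom.ker (ev k p ι) := by
    unfold maxIdeal
    rw [Ideal.span_le]
    rintro _ ⟨i, rfl⟩
    exact ev_x i
  exact h hf

theorem isNilpotent_maxIdeal [Finite ι] : IsNilpotent (maxIdeal k p ι) := by
  have hfg : (maxIdeal k p ι).FG := Submodule.fg_span (Set.finite_range _)
  rw [hfg.isNilpotent_iff_le_nilradical]
  unfold maxIdeal
  rw [Ideal.span_le]
  rintro _ ⟨i, rfl⟩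
  exact ⟨p, x_pow i⟩

variable [CharP k p] [Fintype ι]

theorem derivation_eq_sum (D : Witt k p ι) (f : TruncPoly k p ι) :
    D f = ∑ l, D (x k p l) * pd k p l f := by
  conv_lhs => rw [witt_eq_sum D, witt_sum_apply]
  rfl

/-- Modulo the square of the maximal ideal, an element equals its first-order Taylor expansion at
the origin. -/
theorem mem_maxIdeal_sq {f : TruncPoly k p ι} (h0 : ev k p ι f = 0)
    (h1 : ∀ l, ev k p ι (pd k p l f) = 0) : f ∈ maxIdeal k p ι ^ 2 := by
  classical
  have key : ∀ f : TruncPoly k p ι, f - (algebraMap k _ (ev k p ι f) +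
      ∑ l, algebraMap k _ (ev k p ι (pd k p l f)) * x k p l) ∈ maxIdeal k p ι ^ 2 := by
    intro f
    induction f using truncPoly_induction with
    | hC c => simp
    | hadd f g hf hg =>
      convert add_mem hf hg using 1
      simp only [map_add, add_mul, Finset.sum_add_distrib]
      ring
    | hmul f i _ =>
      have h := Ideal.mul_mem_mul (sub_ev_mem_maxIdeal f) (x_mem_maxIdeal (k := k) (p := p) i)
      rw [← pow_two (maxIdeal k p ι)] at h
      convert h using 1
      simp only [Derivation.leibniz, pd_x, smul_eq_mul, map_add, map_mul, ev_x, zero_mul, add_zero,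
        mul_zero, map_zero, zero_add]
      rw [Finset.sum_eq_single i]
      · simp
        ring
      · intro l _ hl
        simp [hl]
      · simp
  simpa [h0, h1] using key f

theorem derivation_mem {D : Witt k p ι} {I : Ideal (TruncPoly k p ι)}
    (h : ∀ i, D (x k p i) ∈ I) (f : TruncPoly k p ι) : D f ∈ I := by
  rw [derivation_eq_sum]
  exact sum_mem fun l _ => Ideal.mul_mem_right _ _ (h l)

theorem derivation_mem_mul {D : Witt k p ι} {I : Ideal (TruncPoly k p ι)}
    (h : ∀ f, D f ∈ I) {f : TruncPoly k p ι} (hf : f ∈ maxIdeal k p ι ^ 2) :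
    D f ∈ maxIdeal k p ι * I := by
  rw [pow_two] at hf
  induction hf using Submodule.mul_induction_on' with
  | mem_mul_mem a ha b hb =>
    rw [Derivation.leibniz]
    exact add_mem (Ideal.mul_mem_mul ha (h b)) (Ideal.mul_mem_mul hb (h a))
  | add a _ b _ ha hb => rw [map_add]; exact add_mem ha hb

/-- The elements of positive degree in the standard filtration: the derivations that map the
maximal ideal into its square. -/
def posPart (k : Type*) [Field k] (p : ℕ) (ι : Type*) : Submodule k (Witt k p ι) where
  carrier := {D | ∀ i, D (x k p i) ∈ maxIdeal k p ι ^ 2}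
  zero_mem' := by simp
  add_mem' hD hE i := by simpa using add_mem (hD i) (hE i)
  smul_mem' c D hD i := by
    have := (maxIdeal k p ι ^ 2).mul_mem_left (algebraMap k _ c) (hD i)
    rwa [← Algebra.smul_def] at this

theorem derivation_pow_mem {D : Witt k p ι} (hD : D ∈ posPart k p ι) (a : ℕ)
    {f : TruncPoly k p ι} (hf : f ∈ maxIdeal k p ι ^ a) : D f ∈ maxIdeal k p ι ^ (a + 1) := by
  have h2 : ∀ f, D f ∈ maxIdeal k p ι ^ 2 := derivation_mem hD
  induction a generalizing f with
  | zero => exact Ideal.pow_le_pow_right (by norm_num) (h2 f)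
  | succ a ih =>
    rw [pow_succ' (maxIdeal k p ι)] at hf
    induction hf using Submodule.mul_induction_on' with
    | mem_mul_mem a ha b hb =>
      rw [Derivation.leibniz]
      refine add_mem ?_ ?_
      · rw [pow_succ' (maxIdeal k p ι)]
        exact Ideal.mul_mem_mul ha (ih hb)
      · have := Ideal.mul_mem_mul hb (h2 a)
        rwa [← pow_add (maxIdeal k p ι)] at this
    | add a _ b _ ha hb => rw [map_add]; exact add_mem ha hb

/-- Elements of positive degree have no eigenvectors with eigenvalue `-1`. -/
theorem eq_zero_of_lie_eq_self {D E : Witt k p ι} (hD : D ∈ posPart k p ι) (h : ⁅E, D⁆ = E) :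
    E = 0 := by
  have key : ∀ a : ℕ, ∀ i, E (x k p i) ∈ maxIdeal k p ι ^ a := by
    intro a
    induction a with
    | zero => simp
    | succ a ih =>
      intro i
      have h1 := DFunLike.congr_fun h (x k p i)
      rw [Derivation.commutator_apply] at h1
      rw [← h1]
      refine sub_mem ?_ (derivation_pow_mem hD a (ih i))
      have := derivation_mem_mul (derivation_mem ih) (hD i)
      rwa [← pow_succ' (maxIdeal k p ι)] at this
  obtain ⟨N, hN⟩ := isNilpotent_maxIdeal (k := k) (p := p) (ι := ι)
  refine witt_ext fun i => ?_
  have := key N i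
  rw [hN] at this
  simpa using this

end Maximal

/-! ### Diagonal derivations in the shifted coordinates. -/

section Diagonal

variable {k : Type*} [Field k] {p : ℕ} [Fact p.Prime] [CharP k p] {ι : Type*} [Fintype ι]
  (ε : ι → Prop) [DecidablePred ε]

/-- The derivation `∑ w_i z_i ∂_i`. -/
def diag (w : ι → k) : Witt k p ι := ∑ i, w i • z k p (ε i) i • pd k p i

theorem diag_x (w : ι → k) (i : ι) : diag ε w (x k p i) = w i • z k p (ε i) i := by
  classical
  unfold diag
  rw [witt_sum_apply, Finset.sum_eq_single i]
  · simp [pd_x]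
  · intro j _ hj
    simp [pd_x, hj]
  · simp

theorem diag_z (w : ι → k) (i : ι) :
    diag ε w (z k p (ε i) i) = w i • (z k p (ε i) i : TruncPoly k p ι) := by
  rw [derivation_z, diag_x]

theorem eq_diag {D : Witt k p ι} {w : ι → k}
    (h : ∀ i, D (x k p i) = w i • z k p (ε i) i) : D = diag ε w :=
  witt_ext fun i => by rw [h, diag_x]

theorem pMap_diag (w : ι → k) : pMap (diag ε w : Witt k p ι) = diag ε fun i => w i ^ p := by
  refine eq_diag ε fun i => ?_
  have h : ∀ j, (diag ε w)^[j] (z k p (ε i) i) = w i ^ j • (z k p (ε i) i : TruncPoly k p ι) := by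
    intro j
    induction j with
    | zero => simp
    | succ j ih => rw [Function.iterate_succ_apply', ih, Derivation.map_smul, diag_z, smul_smul,
        pow_succ]
  rw [← derivation_z _ (ε i), pMap_apply, h]

end Diagonal

/-! ### Conjugation by automorphisms of the truncated polynomial ring. -/

section Conjugation

variable {k : Type*} [Field k] {p : ℕ} {ι : Type*}

/-- Conjugation of derivations by an automorphism of the truncated polynomial ring. -/
def conj (Φ : TruncPoly k p ι ≃ₐ[k] TruncPoly k p ι) : Witt k p ι ≃ₗ⁅k⁆ Witt k p ι where
  toFun D := Derivation.mk' (Φ.toLinearMap ∘ₗ (D : TruncPoly k p ι →ₗ[k] TruncPoly k p ι) ∘ₗ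
    Φ.symm.toLinearMap) fun a b => by simp
  map_add' D E := by ext f; exact map_add Φ _ _
  map_smul' c D := by ext f; exact map_smul Φ _ _
  map_lie' {D E} := by
    ext f
    change Φ (⁅D, E⁆ (Φ.symm f)) = Φ (D (Φ.symm (Φ (E (Φ.symm f))))) -
      Φ (E (Φ.symm (Φ (D (Φ.symm f)))))
    simp only [AlgEquiv.symm_apply_apply, Derivation.commutator_apply, map_sub]
  invFun D := Derivation.mk' (Φ.symm.toLinearMap ∘ₗ
    (D : TruncPoly k p ι →ₗ[k] TruncPoly k p ι) ∘ₗ Φ.toLinearMap) fun a b => by simp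
  left_inv D := by
    ext f
    change Φ.symm (Φ (D (Φ.symm (Φ f)))) = D f
    simp only [AlgEquiv.symm_apply_apply]
  right_inv D := by
    ext f
    change Φ (Φ.symm (D (Φ (Φ.symm f)))) = D f
    simp only [AlgEquiv.apply_symm_apply]

theorem conj_apply (Φ : TruncPoly k p ι ≃ₐ[k] TruncPoly k p ι) (D : Witt k p ι)
    (f : TruncPoly k p ι) : conj Φ D f = Φ (D (Φ.symm f)) := rfl

theorem conj_smul (Φ : TruncPoly k p ι ≃ₐ[k] TruncPoly k p ι) (f : TruncPoly k p ι)
    (D : Witt k p ι) : conj Φ (f • D) = Φ f • conj Φ D := by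
  ext g
  simp [conj_apply]

theorem conj_eq {Φ : TruncPoly k p ι ≃ₐ[k] TruncPoly k p ι} {D E : Witt k p ι}
    (h : ∀ i, Φ (D (x k p i)) = E (Φ (x k p i))) : conj Φ D = E := by
  have h1 : D = (conj Φ).symm E := witt_ext fun i => by
    apply Φ.injective
    rw [h]
    exact (Φ.apply_symm_apply _).symm
  rw [h1, LieEquiv.apply_symm_apply]

theorem conj_pMap [Fact p.Prime] [CharP k p] (Φ : TruncPoly k p ι ≃ₐ[k] TruncPoly k p ι)
    (D : Witt k p ι) : conj Φ (pMap D) = pMap (conj Φ D) := by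
  ext f
  have h : ∀ j, (conj Φ D)^[j] f = Φ (D^[j] (Φ.symm f)) := by
    intro j
    induction j with
    | zero => simp
    | succ j ih => rw [Function.iterate_succ_apply', ih, conj_apply, Φ.symm_apply_apply,
        Function.iterate_succ_apply']
  rw [pMap_apply, h, conj_apply, pMap_apply]

theorem conj_symm_pMap [Fact p.Prime] [CharP k p] (Φ : TruncPoly k p ι ≃ₐ[k] TruncPoly k p ι)
    (D : Witt k p ι) : (conj Φ).symm (pMap D) = pMap ((conj Φ).symm D) := by
  have h : conj Φ ((conj Φ).symm (pMap D)) = conj Φ (pMap ((conj Φ).symm D)) := by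
    rw [LieEquiv.apply_symm_apply, conj_pMap, LieEquiv.apply_symm_apply]
  exact (conj Φ).injective h

/-- Conjugation by an algebra automorphism preserving `g` belongs to `Aut_p(g)`. -/
theorem Conj.of_conj [Fact p.Prime] [CharP k p] {g : LieSubalgebra k (Witt k p ι)}
    (Φ : TruncPoly k p ι ≃ₐ[k] TruncPoly k p ι) (h : ∀ D ∈ g, conj Φ D ∈ g)
    (h' : ∀ D ∈ g, (conj Φ).symm D ∈ g) {s t : Witt k p ι} (hs : s ∈ g)
    (hst : ∀ i, Φ (s (x k p i)) = t (Φ (x k p i))) : Conj g s t := by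
  let σ : g ≃ₗ⁅k⁆ g :=
    { toFun := fun D => ⟨conj Φ D, h D D.2⟩
      map_add' := fun D E => Subtype.ext (map_add (conj Φ) _ _)
      map_smul' := fun c D => Subtype.ext (map_smul (conj Φ) _ _)
      map_lie' := fun {D E} => Subtype.ext (LieEquiv.map_lie (conj Φ) _ _)
      invFun := fun D => ⟨(conj Φ).symm D, h' D D.2⟩
      left_inv := fun D => Subtype.ext ((conj Φ).symm_apply_apply _)
      right_inv := fun D => Subtype.ext ((conj Φ).apply_symm_apply _) }
  refine ⟨hs, σ, ?_, ?_, conj_eq hst⟩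
  · intro X Y hXY
    change conj Φ Y = pMap (conj Φ X)
    rw [hXY, conj_pMap]
  · intro X Y hXY
    change (conj Φ).symm Y = pMap ((conj Φ).symm X)
    rw [hXY, conj_symm_pMap]

end Conjugation

/-! ### Membership in derived algebras by eigenvectors. -/

section Derived

variable {k W : Type*} [Field k] [LieRing W] [LieAlgebra k W] {L : LieSubalgebra k W}

theorem derivedSubalgebra_le (j : ℕ) : derivedSubalgebra L j ≤ L := by
  rintro _ ⟨D, -, rfl⟩
  exact D.2

theorem mem_derivedSubalgebra_zero {D : W} (hD : D ∈ L) : D ∈ derivedSubalgebra L 0 :=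
  ⟨⟨D, hD⟩, by simp, rfl⟩

theorem lie_mem_derivedSubalgebra_succ {j : ℕ} {D E : W} (hD : D ∈ derivedSubalgebra L j)
    (hE : E ∈ derivedSubalgebra L j) : ⁅D, E⁆ ∈ derivedSubalgebra L (j + 1) := by
  obtain ⟨D, hD, rfl⟩ := hD
  obtain ⟨E, hE, rfl⟩ := hE
  refine ⟨⁅D, E⁆, ?_, rfl⟩
  have : ⁅D, E⁆ ∈ LieAlgebra.derivedSeries k L (j + 1) := by
    rw [LieAlgebra.derivedSeries_def, LieAlgebra.derivedSeriesOfIdeal_succ]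
    exact LieSubmodule.lie_mem_lie hD hE
  exact this

theorem map_mem_derivedSubalgebra (e : W ≃ₗ⁅k⁆ W) (h : ∀ D ∈ L, e D ∈ L) (j : ℕ) {D : W}
    (hD : D ∈ derivedSubalgebra L j) : e D ∈ derivedSubalgebra L j := by
  obtain ⟨D, hD, rfl⟩ := hD
  let σ : L →ₗ⁅k⁆ L :=
    { toFun := fun D => ⟨e D, h D D.2⟩
      map_add' := fun D E => Subtype.ext (map_add e _ _)
      map_smul' := fun c D => Subtype.ext (map_smul e _ _)
      map_lie' := fun {D E} => Subtype.ext (LieEquiv.map_lie e _ _) }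
  exact ⟨σ D, (LieIdeal.derivedSeries_map_le j) (LieIdeal.mem_map hD), rfl⟩

/-- All derived algebras of `L` contain the eigenvectors with nonzero eigenvalue of an element `a`
of `L` that belongs to an `sl_2`-triple of `L`. -/
theorem mem_derivedSubalgebra_of_triple [NeZero (2 : k)] {a e f : W} {c : k} (hc : c ≠ 0)
    (ha : a ∈ L) (he : e ∈ L) (hf : f ∈ L) (hef : ⁅e, f⁆ = c • a) (hae : ⁅a, e⁆ = (2 : k) • e) (haf : ⁅a, f⁆ = (-2 : k) • f)
    (j : ℕ) : a ∈ derivedSubalgebra L j ∧ ∀ w ∈ L, ∀ κ : k, κ ≠ 0 → ⁅a, w⁆ = κ • w →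
      w ∈ derivedSubalgebra L j := by
  induction j with
  | zero => exact ⟨mem_derivedSubalgebra_zero ha, fun w hw _ _ _ => mem_derivedSubalgebra_zero hw⟩
  | succ j ih =>
    have hscale : ∀ w : W, ∀ κ : k, κ ≠ 0 → κ • w ∈ derivedSubalgebra L (j + 1) →
        w ∈ derivedSubalgebra L (j + 1) := fun w κ hκ h => by
      have h2 := (derivedSubalgebra L (j + 1)).smul_mem κ⁻¹ h
      rwa [smul_smul, inv_mul_cancel₀ hκ, one_smul] at h2
    refine ⟨hscale _ c hc ?_, fun w hw κ hκ h => hscale _ κ hκ ?_⟩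
    -- `a` is recovered from `[e, f]`, where `e` and `f` are themselves eigenvectors with
    -- eigenvalues `±2`; an eigenvector `w` is recovered from `[a, w]`.
    · rw [← hef]
      exact lie_mem_derivedSubalgebra_succ (ih.2 e he 2 two_ne_zero hae)
        (ih.2 f hf (-2) (neg_ne_zero.2 two_ne_zero) haf)
    · rw [← h]
      exact lie_mem_derivedSubalgebra_succ ih.1 (ih.2 w hw κ hκ h)

end Derived

/-! ### Constructing sandwiches. -/

section Sandwich

variable {k : Type*} [Field k] {p : ℕ} {ι : Type*}

theorem truncPoly_smul (c : k) (f : TruncPoly k p ι) : c • f = algebraMap k _ c * f :=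
  Algebra.smul_def c f

theorem lie_lie_apply (D E : Witt k p ι) (f : TruncPoly k p ι) :
    ⁅D, ⁅D, E⁆⁆ f = D (D (E f)) - 2 * D (E (D f)) + E (D (D f)) := by
  simp only [Derivation.commutator_apply, map_sub]
  ring

/-- With `c = γ B`, the double bracket is `c² F - 2 c F c + F c²` as operators. The first two
hypotheses give `c² = 0`, and the four together kill the four terms of `c F c` given by the Leibniz
rule. -/
theorem lie_lie_smul_eq_zero {γ : TruncPoly k p ι} {B F : Witt k p ι}
    (h1 : ∀ f, γ * γ * B f = 0) (h2 : γ * B γ = 0) (h3 : ∀ f, γ * F γ * B (B f) = 0)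
    (h4 : ∀ f, γ * B (F γ) * B f = 0) : ⁅γ • B, ⁅γ • B, F⁆⁆ = 0 := by
  have hcc : ∀ f, (γ • B) ((γ • B) f) = 0 := fun f => by
    simp only [Derivation.smul_apply, smul_eq_mul, Derivation.leibniz]
    linear_combination B f * h2 + h1 (B f)
  ext f
  rw [lie_lie_apply, hcc, hcc]
  simp only [Derivation.smul_apply, smul_eq_mul, Derivation.leibniz, map_add, map_zero,
    Derivation.coe_zero, Pi.zero_apply]
  linear_combination -2 * (F (B f) * h2 + h1 (F (B f)) + h3 f + h4 f)

variable [NeZero (2 : k)]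

theorem eq_zero_of_two_mul {a : TruncPoly k p ι} (h : 2 * a = 0) : a = 0 := by
  have h1 : (2 : k) • a = 0 := by rw [← h, truncPoly_smul, map_ofNat]
  exact (smul_eq_zero.1 h1).resolve_left two_ne_zero

/-- `γ B` is a sandwich if `γ² = 0` and `B γ ∈ (γ)`. -/
theorem sandwich_of_sq_eq_zero {γ κ : TruncPoly k p ι} {B : Witt k p ι} (h : γ * γ = 0)
    (hB : B γ = κ * γ) (F : Witt k p ι) : ⁅γ • B, ⁅γ • B, F⁆⁆ = 0 := by
  have hF : γ * F γ = 0 := eq_zero_of_two_mul (by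
    have := congrArg F h
    rw [Derivation.leibniz, map_zero, smul_eq_mul] at this
    linear_combination this)
  refine lie_lie_smul_eq_zero (fun f => by rw [h, zero_mul]) ?_ (fun f => by rw [hF, zero_mul])
    fun f => ?_
  · rw [hB]
    linear_combination κ * h
  · have := congrArg B hF
    rw [Derivation.leibniz, map_zero, smul_eq_mul, smul_eq_mul, hB] at this
    linear_combination B f * this - κ * B f * hF

/-- `γ (a D + b E)` is a sandwich if `D` and `E` annihilate `a`, `b`, `γ` and
`γ² a = γ² b = 0`. -/
theorem sandwich_of_sq_mul_eq_zero {γ a b : TruncPoly k p ι} {D E : Witt k p ι}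
    (ha : γ * γ * a = 0) (hb : γ * γ * b = 0) (hDγ : D γ = 0) (hDa : D a = 0) (hDb : D b = 0)
    (hEγ : E γ = 0) (hEa : E a = 0) (hEb : E b = 0) (F : Witt k p ι) :
    ⁅γ • (a • D + b • E), ⁅γ • (a • D + b • E), F⁆⁆ = 0 := by
  have hFa := congrArg F ha
  have hFb := congrArg F hb
  simp only [Derivation.leibniz, map_zero, smul_eq_mul] at hFa hFb
  -- Differentiating `γ² a = 0` along `F` and multiplying by `a` removes the term with `F a`. The
  -- mixed and the `b`-versions are analogous.
  have haa : a * a * (γ * F γ) = 0 := eq_zero_of_two_mul (by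
    linear_combination a * hFa - F a * ha)
  have hab : a * b * (γ * F γ) = 0 := eq_zero_of_two_mul (by
    linear_combination b * hFa - F a * hb)
  have hbb : b * b * (γ * F γ) = 0 := eq_zero_of_two_mul (by
    linear_combination b * hFb - F b * hb)
  -- Since `D` and `E` annihilate `a`, `b` and `γ`, they act here on the factor `F γ` alone.
  have h1 := congrArg D haa
  have h2 := congrArg D hab
  have h3 := congrArg E hab
  have h4 := congrArg E hbb
  simp only [Derivation.leibniz, map_zero, smul_eq_mul, hDγ, hDa, hDb, hEγ, hEa, hEb, mul_zero,
    add_zero] at h1 h2 h3 h4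
  refine lie_lie_smul_eq_zero (fun f => ?_) ?_ (fun f => ?_) fun f => ?_
  · simp only [Derivation.add_apply, Derivation.smul_apply, smul_eq_mul]
    linear_combination D f * ha + E f * hb
  · simp [hDγ, hEγ]
  · simp only [Derivation.add_apply, Derivation.smul_apply, smul_eq_mul, Derivation.leibniz,
      map_add, hDa, hDb, hEa, hEb]
    linear_combination D (D f) * haa + (D (E f) + E (D f)) * hab + E (E f) * hbb
  · simp only [Derivation.add_apply, Derivation.smul_apply, smul_eq_mul]
    linear_combination D f * h1 + E f * h2 + D f * h3 + E f * h4

end Sandwich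

/-! ### Weight projection, non-conjugacy, and linear parts of sandwiches. -/

section Detection

variable {k : Type*} [Field k] {p : ℕ} [Fact p.Prime] [CharP k p]

/-- A subspace stable under `T` contains the component of weight `0` of its elements. -/
theorem mem_of_sum_eigenvectors {M : Type*} [AddCommGroup M] [Module k M] {V : Submodule k M}
    (T : Module.End k M) (hT : ∀ v ∈ V, T v ∈ V) (c : ℕ → M) (hc : ∀ i, T (c i) = (i : k) • c i)
    (h : ∑ i ∈ Finset.range p, c i ∈ V) : c 0 ∈ V := by
  have hp : p.Prime := Fact.out
  have hpow : ∀ j i, (T ^ j) (c i) = (i : k) ^ j • c i := by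
    intro j i
    induction j with
    | zero => simp
    | succ j ih => rw [pow_succ', Module.End.mul_apply, ih, map_smul, hc, smul_smul, pow_succ]
  have hpowV : ∀ j, ∀ v ∈ V, (T ^ j) v ∈ V := by
    intro j v hv
    induction j with
    | zero => simpa
    | succ j ih => rw [pow_succ', Module.End.mul_apply]; exact hT _ ih
  -- By Fermat, `i^(p-1) = 1` for `0 < i < p`, so `1 - T^(p-1)` is the projection to weight zero.
  have h1 : c 0 = ∑ i ∈ Finset.range p, c i - (T ^ (p - 1)) (∑ i ∈ Finset.range p, c i) := by
    rw [map_sum, ← Finset.sum_sub_distrib, Finset.sum_eq_single 0]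
    · simp [hpow, zero_pow (Nat.sub_ne_zero_of_lt hp.one_lt)]
    · intro i hi hi0
      have hne : (i : ZMod p) ≠ 0 := by
        rw [Ne, ZMod.natCast_eq_zero_iff]
        exact fun hdvd => hi0 (Nat.eq_zero_of_dvd_of_lt hdvd (Finset.mem_range.1 hi))
      have h2 : (i : k) ^ (p - 1) = 1 := by
        have := congrArg (ZMod.castHom dvd_rfl k) (ZMod.pow_card_sub_one_eq_one hne)
        simpa using this
      rw [hpow, h2, one_smul, sub_self]
    · intro h0
      exact absurd (Finset.mem_range.2 hp.pos) h0
  rw [h1]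
  exact sub_mem h (hpowV _ _ h)

variable {ι : Type*} [Fintype ι]

/-- Non-conjugacy criterion: the sandwiches of `g` have positive degree, `u` preserves the elements
of positive degree, whereas each `t`-stable subspace that contains the sandwiches has an element
with an eigenvector of eigenvalue `-1`. -/
theorem not_conj_of_sandwich {g : LieSubalgebra k (Witt k p ι)}
    (hpos : ∀ c ∈ g, (∀ w ∈ g, ⁅c, ⁅c, w⁆⁆ = 0) → c ∈ posPart k p ι)
    {t u : Witt k p ι} (ht : t ∈ g) (hu : ∀ D ∈ posPart k p ι, ⁅u, D⁆ ∈ posPart k p ι)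
    (hdet : ∀ V : Submodule k (Witt k p ι), (∀ c ∈ g, (∀ w ∈ g, ⁅c, ⁅c, w⁆⁆ = 0) → c ∈ V) →
      (∀ D ∈ V, ⁅t, D⁆ ∈ V) → ∃ v ∈ V, ∃ w ∈ g, w ≠ 0 ∧ ⁅w, v⁆ = w)
    (σ : g ≃ₗ⁅k⁆ g) : (σ ⟨t, ht⟩ : Witt k p ι) ≠ u := by
  intro hσ
  -- `V` is the preimage under `σ` of the positive part of `g`. It contains the sandwiches because
  -- `σ` maps sandwiches to sandwiches, and it is `t`-stable because `σ t = u` normalises the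
  -- positive part.
  let V : Submodule k (Witt k p ι) := ((posPart k p ι).comap
    (g.toSubmodule.subtype ∘ₗ (σ : g →ₗ[k] g))).map g.toSubmodule.subtype
  have hV : ∀ D : g, ((σ D : g) : Witt k p ι) ∈ posPart k p ι → (D : Witt k p ι) ∈ V :=
    fun D hD => ⟨D, hD, rfl⟩
  have hdet' := hdet V
    (fun c hc hcc => hV ⟨c, hc⟩ (hpos _ (σ (⟨c, hc⟩ : g)).2 fun w hw => by
      have h1 : (⁅(⟨c, hc⟩ : g), ⁅(⟨c, hc⟩ : g), σ.symm ⟨w, hw⟩⁆⁆ : g) = 0 :=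
        Subtype.ext (hcc _ (σ.symm ⟨w, hw⟩).2)
      have h2 := congrArg σ h1
      rw [LieEquiv.map_lie, LieEquiv.map_lie, LieEquiv.apply_symm_apply, map_zero] at h2
      exact congrArg Subtype.val h2))
    (by
      have key : ∀ D : g, ((σ D : g) : Witt k p ι) ∈ posPart k p ι → ⁅t, (D : Witt k p ι)⁆ ∈ V := by
        intro D hD
        refine hV ⁅(⟨t, ht⟩ : g), D⁆ ?_
        rw [LieEquiv.map_lie]
        have := hu _ hD
        rw [← hσ] at this
        exact this
      rintro _ ⟨D, hD, rfl⟩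
      exact key D hD)
  have key : ∀ v w : g, ((σ v : g) : Witt k p ι) ∈ posPart k p ι →
      ⁅(w : Witt k p ι), (v : Witt k p ι)⁆ = w → (w : Witt k p ι) = 0 := by
    intro v w hv hvw
    have h1 : ⁅w, v⁆ = w := Subtype.ext hvw
    have h2 := congrArg σ h1
    rw [LieEquiv.map_lie] at h2
    have h3 : σ w = 0 := Subtype.ext (eq_zero_of_lie_eq_self hv (congrArg Subtype.val h2))
    rw [(map_eq_zero_iff σ σ.injective).1 h3]
    rfl
  obtain ⟨_, ⟨v, hv, rfl⟩, w, hw, hw0, hvw⟩ := hdet'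
  exact hw0 (key v ⟨w, hw⟩ hv hvw)

theorem lie_mem_posPart_of_diagonal {u : Witt k p ι} {w : ι → k}
    (hu : ∀ i, u (x k p i) = w i • x k p i) {D : Witt k p ι} (hD : D ∈ posPart k p ι) :
    ⁅u, D⁆ ∈ posPart k p ι := by
  have h : ∀ f ∈ maxIdeal k p ι ^ 2, u f ∈ maxIdeal k p ι ^ 2 := by
    intro f hf
    have hm : ∀ f, u f ∈ maxIdeal k p ι := derivation_mem fun i => by
      rw [hu, truncPoly_smul]
      exact Ideal.mul_mem_left _ _ (x_mem_maxIdeal i)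
    have := derivation_mem_mul hm hf
    rwa [← pow_two (maxIdeal k p ι)] at this
  intro i
  rw [Derivation.commutator_apply, hu, Derivation.map_smul, truncPoly_smul]
  exact sub_mem (h _ (hD i)) (Ideal.mul_mem_left _ _ (hD i))

section LinearPart

/-- The matrix of the linear part of a derivation. -/
def linPart (D : Witt k p ι) : Matrix ι ι k :=
  Matrix.of fun j l => ev k p ι (pd k p l (D (x k p j)))

theorem ev_derivation (D : Witt k p ι) (f : TruncPoly k p ι) :
    ev k p ι (D f) = ∑ l, ev k p ι (D (x k p l)) * ev k p ι (pd k p l f) := by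
  rw [derivation_eq_sum, map_sum]
  simp only [map_mul]

theorem ev_derivation_eq_zero {D : Witt k p ι} (hD : ∀ i, ev k p ι (D (x k p i)) = 0)
    (f : TruncPoly k p ι) : ev k p ι (D f) = 0 := by
  rw [ev_derivation]
  simp [hD]

/-- Gradients at the origin are row vectors on which `D` acts by right multiplication, so linear
parts of compositions multiply in reverse order. This needs `D` to have no constant terms. -/
theorem ev_pd_derivation {D : Witt k p ι} (hD : ∀ i, ev k p ι (D (x k p i)) = 0)
    (f : TruncPoly k p ι) :
    (fun l => ev k p ι (pd k p l (D f))) =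
      Matrix.vecMul (fun l => ev k p ι (pd k p l f)) (linPart D) := by
  ext l
  rw [derivation_eq_sum D f, map_sum, map_sum]
  refine Finset.sum_congr rfl fun b _ => ?_
  rw [Derivation.leibniz, smul_eq_mul, smul_eq_mul, map_add, map_mul, map_mul, hD, zero_mul,
    zero_add]
  rfl

theorem linPart_mul {D E : Witt k p ι} (hD : ∀ i, ev k p ι (D (x k p i)) = 0) (j : ι) :
    (fun l => ev k p ι (pd k p l (D (E (x k p j))))) = (linPart E * linPart D) j := by
  rw [ev_pd_derivation hD]
  rfl

theorem linPart_mul_mul {D E F : Witt k p ι} (hD : ∀ i, ev k p ι (D (x k p i)) = 0)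
    (hE : ∀ i, ev k p ι (E (x k p i)) = 0) (j : ι) :
    (fun l => ev k p ι (pd k p l (D (E (F (x k p j)))))) =
      (linPart F * linPart E * linPart D) j := by
  rw [ev_pd_derivation hD, linPart_mul hE]
  rfl

theorem ev_derivation_of_mem_sq (D : Witt k p ι) {f : TruncPoly k p ι}
    (hf : f ∈ maxIdeal k p ι ^ 2) : ev k p ι (D f) = 0 := by
  rw [pow_two] at hf
  induction hf using Submodule.mul_induction_on' with
  | mem_mul_mem a ha b hb =>
    rw [Derivation.leibniz, map_add, smul_eq_mul, smul_eq_mul, map_mul, map_mul,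
      ev_eq_zero_of_mem ha, ev_eq_zero_of_mem hb, zero_mul, zero_mul, add_zero]
  | add a _ b _ ha hb => rw [map_add, map_add, ha, hb, add_zero]

variable [NeZero (2 : k)] {g : LieSubalgebra k (Witt k p ι)} {c : Witt k p ι}

/-- A sandwich has no constant terms. -/
theorem ev_eq_zero_of_sandwich (hc : ∀ w ∈ g, ⁅c, ⁅c, w⁆⁆ = 0) {i : ι}
    (hw : ∃ w ∈ g, w ∈ posPart k p ι ∧ ∃ l, ∃ κ : k, κ ≠ 0 ∧ w (x k p l) = κ • x k p i ^ 2) :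
    ev k p ι (c (x k p i)) = 0 := by
  obtain ⟨w, hwg, hwp, l, κ, hκ, hl⟩ := hw
  have h := congrArg (ev k p ι) (DFunLike.congr_fun (hc w hwg) (x k p l))
  have hw1 : ∀ f, w f ∈ maxIdeal k p ι ^ 2 := derivation_mem hwp
  have hw0 : ∀ f, ev k p ι (w f) = 0 := fun f =>
    ev_eq_zero_of_mem (Ideal.pow_le_self two_ne_zero (hw1 f))
  have hcw : ∀ f, ev k p ι (c (w f)) = 0 := fun f =>
    ev_derivation_of_mem_sq c (hw1 f)
  -- At the origin only `2 κ (c x_i)²` survives of the double bracket evaluated on `x_l`: every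
  -- other term has `w` outermost, or `c` applied to a value of `w`, which lies in `m²`.
  have hcc : c (c (x k p i ^ 2)) =
      2 * (c (x k p i) * c (x k p i)) + 2 * (x k p i * c (c (x k p i))) := by
    rw [pow_two, Derivation.leibniz, smul_eq_mul, map_add, Derivation.leibniz]
    simp only [smul_eq_mul]
    ring
  rw [lie_lie_apply, map_add, map_sub, map_mul, hw0, hcw, hl, Derivation.map_smul,
    Derivation.map_smul, hcc, map_smul, map_add, map_mul, map_mul, map_mul, map_mul, ev_x] at h
  have h2 : ev k p ι 2 = 2 := map_ofNat _ 2
  rw [h2] at h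
  simpa [hκ, two_ne_zero] using h

/-- The linear part of a sandwich has square zero. -/
theorem linPart_sq_of_sandwich (hc : ∀ w ∈ g, ⁅c, ⁅c, w⁆⁆ = 0)
    (h0 : ∀ i, ev k p ι (c (x k p i)) = 0) (hpd : ∀ i, pd k p i ∈ g) :
    linPart c * linPart c = 0 := by
  classical
  ext j b
  -- At the origin the double bracket with `∂_b` reduces to `∂_b (c² x_j)`, which is an entry of the
  -- square of the linear part.
  have h := congrArg (ev k p ι) (DFunLike.congr_fun (hc _ (hpd b)) (x k p j))
  rw [lie_lie_apply, map_add, map_sub, map_mul, ev_derivation_eq_zero h0,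
    ev_derivation_eq_zero h0] at h
  have h1 := congrFun (linPart_mul (E := c) h0 j) b
  rw [← h1]
  simpa using h

/-- With `C` and `M` the linear parts of `c` and `w`, the linear part of the double bracket is `M C²
- 2 C M C + C² M`. Since `C² = 0`, only the middle term remains. -/
theorem linPart_mul_mul_of_sandwich (hc : ∀ w ∈ g, ⁅c, ⁅c, w⁆⁆ = 0)
    (h0 : ∀ i, ev k p ι (c (x k p i)) = 0) (hsq : linPart c * linPart c = 0)
    {w : Witt k p ι} (hw : w ∈ g) (hw0 : ∀ i, ev k p ι (w (x k p i)) = 0) :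
    linPart c * linPart w * linPart c = 0 := by
  ext j l
  have h := congrArg (fun f => ev k p ι (pd k p l f)) (DFunLike.congr_fun (hc w hw) (x k p j))
  have h1 := congrFun (linPart_mul_mul (F := w) h0 h0 j) l
  have h2 := congrFun (linPart_mul_mul (F := c) h0 hw0 j) l
  have h3 := congrFun (linPart_mul_mul (F := c) hw0 h0 j) l
  rw [Matrix.mul_assoc, hsq, Matrix.mul_zero] at h1
  rw [hsq, Matrix.zero_mul] at h3
  simp only [Matrix.zero_apply] at h1 h3
  have h4 : (2 : k) * (linPart c * linPart w * linPart c) j l = 0 := by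
    rw [← h2]
    simp only [lie_lie_apply, map_add, map_sub, h1, h3] at h
    have h5 : (2 : TruncPoly k p ι) * c (w (c (x k p j))) =
        c (w (c (x k p j))) + c (w (c (x k p j))) := two_mul _
    rw [h5, map_add, map_add] at h
    simp only [Derivation.coe_zero, Pi.zero_apply, map_zero] at h
    linear_combination -h
  exact (mul_eq_zero.1 h4).resolve_left two_ne_zero

theorem mem_posPart_of_linPart {D : Witt k p ι} (h0 : ∀ i, ev k p ι (D (x k p i)) = 0)
    (h1 : linPart D = 0) : D ∈ posPart k p ι := fun i =>
  mem_maxIdeal_sq (h0 i) fun l => congrFun (congrFun h1 i) l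

/-- The linear part of `x_a ∂_b`. -/
theorem linPart_smul_pd [DecidableEq ι] (a b : ι) :
    linPart (x k p a • pd k p b) = Matrix.single b a 1 := by
  ext j l
  simp only [linPart, Matrix.of_apply, Derivation.smul_apply, pd_x, smul_eq_mul,
    Matrix.single_apply]
  by_cases hb : b = j <;> by_cases ha : a = l <;> simp [pd_x, hb, ha, eq_comm]

end LinearPart

end Detection

/-! ### The units `y_s`, substitutions, and extraction of the factor `x_s^(p-1)`. -/

section Units

variable {k : Type*} [Field k] {p : ℕ} {ι : Type*}

/-- The automorphism of the truncated polynomial ring with `x_i ↦ f_i` and inverse `x_i ↦ f'_i`. -/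
def truncEquiv (f f' : ι → TruncPoly k p ι) (hf : ∀ i, f i ^ p = 0) (hf' : ∀ i, f' i ^ p = 0)
    (h : ∀ i, truncLift f hf (f' i) = x k p i) (h' : ∀ i, truncLift f' hf' (f i) = x k p i) :
    TruncPoly k p ι ≃ₐ[k] TruncPoly k p ι :=
  AlgEquiv.ofAlgHom (truncLift f hf) (truncLift f' hf')
    (truncPoly_algHom_ext fun i => by
      rw [AlgHom.comp_apply, truncLift_x, h, AlgHom.id_apply])
    (truncPoly_algHom_ext fun i => by
      rw [AlgHom.comp_apply, truncLift_x, h', AlgHom.id_apply])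

theorem truncEquiv_apply (f f' : ι → TruncPoly k p ι) (hf : ∀ i, f i ^ p = 0)
    (hf' : ∀ i, f' i ^ p = 0) (h : ∀ i, truncLift f hf (f' i) = x k p i)
    (h' : ∀ i, truncLift f' hf' (f i) = x k p i) (a : TruncPoly k p ι) :
    truncEquiv f f' hf hf' h h' a = truncLift f hf a := rfl

theorem lie_smul_right (D E : Witt k p ι) (f : TruncPoly k p ι) :
    ⁅D, f • E⁆ = D f • E + f • ⁅D, E⁆ := by
  ext g
  simp only [Derivation.commutator_apply, Derivation.smul_apply, Derivation.add_apply, smul_eq_mul,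
    Derivation.leibniz]
  ring

theorem smul_smul_derivation (f g : TruncPoly k p ι) (D : Witt k p ι) :
    f • (g • D) = (f * g) • D := by
  ext h
  simp only [Derivation.smul_apply, smul_eq_mul, mul_assoc]

/-- The unit `y_s = 1 + x_s`. -/
def y (k : Type*) [Field k] (p : ℕ) {ι : Type*} (s : ι) : TruncPoly k p ι := 1 + x k p s

/-- The inverse of `y_s`. -/
def yInv (k : Type*) [Field k] (p : ℕ) {ι : Type*} (s : ι) : TruncPoly k p ι :=
  y k p s ^ (p - 1)

theorem derivation_y (D : Witt k p ι) (s : ι) : D (y k p s) = D (x k p s) := by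
  simp [y]

theorem z_of_shifted {q : Prop} [Decidable q] (hq : q) (i : ι) :
    (z k p q i : TruncPoly k p ι) = y k p i := if_pos hq

theorem z_of_not_shifted {q : Prop} [Decidable q] (hq : ¬q) (i : ι) :
    (z k p q i : TruncPoly k p ι) = x k p i := if_neg hq

variable [Fact p.Prime] [CharP k p]

theorem y_mul_yInv (s : ι) : y k p s * yInv k p s = 1 := by
  have hp : p.Prime := Fact.out
  rw [yInv, ← pow_succ', Nat.sub_add_cancel hp.one_le, y, add_pow_char, x_pow, one_pow, add_zero]

theorem yInv_pow (s : ι) : yInv k p s ^ p = 1 := by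
  rw [yInv, ← pow_mul, mul_comm, pow_mul, y, add_pow_char, x_pow, one_pow, add_zero, one_pow]

theorem y_pow (s : ι) : y k p s ^ p = 1 := by
  rw [y, add_pow_char, x_pow, one_pow, add_zero]

theorem derivation_yInv (D : Witt k p ι) (s : ι) :
    D (yInv k p s) = -(yInv k p s ^ 2 * D (x k p s)) := by
  have h := congrArg D (y_mul_yInv (k := k) (p := p) s)
  rw [Derivation.leibniz, Derivation.map_one_eq_zero, derivation_y, smul_eq_mul, smul_eq_mul] at h
  linear_combination yInv k p s * h - D (yInv k p s) * y_mul_yInv (k := k) (p := p) s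

theorem map_yInv {φ : TruncPoly k p ι →ₐ[k] TruncPoly k p ι} {s : ι}
    (h : φ (x k p s) = x k p s) : φ (yInv k p s) = yInv k p s := by
  simp [yInv, y, h]

theorem map_y {φ : TruncPoly k p ι →ₐ[k] TruncPoly k p ι} {s : ι}
    (h : φ (x k p s) = x k p s) : φ (y k p s) = y k p s := by
  simp [y, h]

/-- This makes `z_j ↦ z_j u` an admissible substitution: `u^p = 1` is exactly what the relation
`y_j^p = 1` demands in the shifted case. -/
theorem z_mul_sub_pow {q : Prop} [Decidable q] (j : ι) {u : TruncPoly k p ι} (hu : u ^ p = 1) :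
    (z k p q j * u - if q then 1 else 0) ^ p = 0 := by
  have hp : p.Prime := Fact.out
  rw [sub_pow_char, mul_pow, z_pow, hu]
  split_ifs <;> simp [hp.ne_zero]

theorem algHom_z {φ : TruncPoly k p ι →ₐ[k] TruncPoly k p ι} {q : Prop} [Decidable q] {j : ι}
    {f : TruncPoly k p ι} (h : φ (x k p j) = f - if q then 1 else 0) : φ (z k p q j) = f := by
  unfold z
  split_ifs at h ⊢ with hq <;> simp [h]

theorem y_pow_eigen {t : Witt k p ι} {s : ι} (ht : t (x k p s) = y k p s) (i : ℕ) :
    t (y k p s ^ i) = (i : k) • y k p s ^ i := by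
  induction i with
  | zero => simp
  | succ i ih =>
    rw [pow_succ, Derivation.leibniz, ih, derivation_y, ht, truncPoly_smul, truncPoly_smul,
      smul_eq_mul, smul_eq_mul]
    push_cast
    ring

/-- A subspace stable under a derivation `t` with `t (y_s) = y_s` that contains `x_s ^ (p - 1) D`
also contains `D`, provided `t` and `D` commute. -/
theorem mem_of_x_pow_smul_mem {V : Submodule k (Witt k p ι)} {t D : Witt k p ι} {s : ι}
    (ht : t (x k p s) = y k p s) (htD : ⁅t, D⁆ = 0) (hV : ∀ E ∈ V, ⁅t, E⁆ ∈ V)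
    (h : x k p s ^ (p - 1) • D ∈ V) : D ∈ V := by
  have h1 := mem_of_sum_eigenvectors (p := p) (LieAlgebra.ad k (Witt k p ι) t) hV
    (fun i => y k p s ^ i • D) (fun i => by
      rw [LieAlgebra.ad_apply, lie_smul_right, htD, smul_zero, add_zero, y_pow_eigen ht, smul_assoc])
    (by
      have e : ∑ i ∈ Finset.range p, y k p s ^ i • D = x k p s ^ (p - 1) • D := by
        rw [x_pow_pred]
        exact (Finset.sum_smul (R := TruncPoly k p ι) (M := Witt k p ι)).symm
      rwa [e])
  simpa using h1

variable [Fintype ι] [NeZero (2 : k)] {g : LieSubalgebra k (Witt k p ι)} {c : Witt k p ι}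

/-- Let `C` be the linear part of `c`. The elements `x_a ∂_b` with `a ≠ b` force `C_{lb} C_{aj} =
0`. A nonzero entry `C_{lb}` thus kills every row except row `b`, so it is diagonal, and `C² = 0`
then kills it too. This serves types `W` and `S`. -/
theorem mem_posPart_of_sandwich_of_offDiag [DecidableEq ι] (hc : ∀ w ∈ g, ⁅c, ⁅c, w⁆⁆ = 0)
    (hquad : ∀ i, ∃ w ∈ g, w ∈ posPart k p ι ∧ ∃ l, ∃ κ : k, κ ≠ 0 ∧
      w (x k p l) = κ • x k p i ^ 2)
    (hpd : ∀ i, pd k p i ∈ g) (hlin : ∀ a b, a ≠ b → x k p a • pd k p b ∈ g) :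
    c ∈ posPart k p ι := by
  have h0 : ∀ i, ev k p ι (c (x k p i)) = 0 := fun i => ev_eq_zero_of_sandwich hc (hquad i)
  refine mem_posPart_of_linPart h0 ?_
  have hsq := linPart_sq_of_sandwich hc h0 hpd
  have hprod : ∀ a b, a ≠ b → ∀ l j, linPart c l b * linPart c a j = 0 := by
    intro a b hab l j
    have h1 := linPart_mul_mul_of_sandwich hc h0 hsq (hlin a b hab) fun i => by simp
    rw [linPart_smul_pd] at h1
    have h2 := congrFun (congrFun h1 l) j
    rw [Matrix.mul_apply, Finset.sum_eq_single a] at h2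
    · simpa using h2
    · intro e _ he
      rw [Matrix.mul_single_apply_of_ne _ _ _ _ _ he, zero_mul]
    · simp
  ext l b
  by_contra hlb
  rw [Matrix.zero_apply] at hlb
  have hrow : ∀ a, a ≠ b → ∀ j, linPart c a j = 0 := fun a hab j =>
    (mul_eq_zero.1 (hprod a b hab l j)).resolve_left hlb
  have hlb' : l = b := by
    by_contra hne
    exact hlb (hrow l hne b)
  subst hlb'
  have h1 := congrFun (congrFun hsq l) l
  rw [Matrix.mul_apply, Finset.sum_eq_single l] at h1
  · exact hlb (mul_self_eq_zero.1 h1)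
  · intro e _ he
    rw [hrow e he, mul_zero]
  · simp

end Units

/-! ### Type `W`. -/

section TypeW

variable {k : Type*} [Field k] {p : ℕ} [Fact p.Prime] [CharP k p] {n : ℕ}

theorem sum_dW (r : ℕ) (lam : Fin n → k) :
    ∑ i, lam i • dW k p n r i = diag (fun i : Fin n => i.val < r) lam := rfl

theorem dW_x (r : ℕ) (s i : Fin n) :
    dW k p n r s (x k p i) = if s = i then z k p (s.val < r) s else 0 := by
  rw [dW, Derivation.smul_apply, pd_x]
  split_ifs <;> simp

theorem conj_dW {r : ℕ} {s j : Fin n} (hs : s.val < r) (hj : j ≠ s) (lam : Fin n → k) :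
    Conj (wAlg k p n) (∑ i, lam i • dW k p n r i)
      (∑ i, Function.update lam j (lam j + lam s) i • dW k p n r i) := by
  -- The substitution `z_j ↦ z_j u` for a general `u` with `u^p = 1`: taking `u = y_s⁻¹` gives the
  -- transvection and `u = y_s` its inverse.
  let f : TruncPoly k p (Fin n) → Fin n → TruncPoly k p (Fin n) := fun u =>
    Function.update (x k p) j (z k p (j.val < r) j * u - if j.val < r then 1 else 0)
  have hf : ∀ u, u ^ p = 1 → ∀ i, f u i ^ p = 0 := by
    intro u hu i
    by_cases hi : i = j
    · subst hi
      rw [show f u i = _ from Function.update_self _ _ _]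
      exact z_mul_sub_pow i hu
    · rw [show f u i = _ from Function.update_of_ne hi _ _, x_pow]
  have hfx : ∀ u (hu : u ^ p = 1) i, i ≠ j → truncLift (f u) (hf u hu) (x k p i) = x k p i :=
    fun u hu i hi => by rw [truncLift_x]; exact Function.update_of_ne hi _ _
  have hfz : ∀ u (hu : u ^ p = 1),
      truncLift (f u) (hf u hu) (z k p (j.val < r) j) = z k p (j.val < r) j * u :=
    fun u hu => algHom_z (by rw [truncLift_x]; exact Function.update_self _ _ _)
  have hinv : ∀ u v (hu : u ^ p = 1), truncLift (f u) (hf u hu) v = v → u * v = 1 → ∀ i,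
      truncLift (f u) (hf u hu) (f v i) = x k p i := by
    intro u v hu huv huv1 i
    by_cases hi : i = j
    · subst hi
      rw [show f v i = _ from Function.update_self _ _ _, map_sub, map_mul, hfz u hu, huv, mul_assoc,
        huv1, mul_one, x_eq_z_sub (i.val < r) i]
      split_ifs <;> simp
    · rw [show f v i = _ from Function.update_of_ne hi _ _, hfx u hu i hi]
  let Φ := truncEquiv (f (yInv k p s)) (f (y k p s)) (hf _ (yInv_pow s)) (hf _ (y_pow s))
    (hinv _ _ (yInv_pow s) (map_y (hfx _ (yInv_pow s) s hj.symm)) (by rw [mul_comm, y_mul_yInv]))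
    (hinv _ _ (y_pow s) (map_yInv (hfx _ (y_pow s) s hj.symm)) (y_mul_yInv s))
  refine Conj.of_conj (g := wAlg k p n) Φ (fun _ _ => trivial) (fun _ _ => trivial) trivial fun i => ?_
  rw [sum_dW, sum_dW, diag_x]
  simp only [Φ, truncEquiv_apply]
  rw [map_smul]
  by_cases hi : i = j
  · subst hi
    rw [hfz _ (yInv_pow s), truncLift_x, show f (yInv k p s) i = _ from Function.update_self _ _ _, map_sub,
      derivation_one_ite, sub_zero, Derivation.leibniz, diag_z, derivation_yInv, diag_x,
      Function.update_self, Function.update_of_ne hj.symm, z_of_shifted hs]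
    simp only [truncPoly_smul, smul_eq_mul, map_add]
    linear_combination (algebraMap k (TruncPoly k p (Fin n)) (lam s) * z k p (i.val < r) i *
      yInv k p s) * y_mul_yInv (k := k) (p := p) s
  · rw [hfx _ (yInv_pow s) i hi, diag_x, Function.update_of_ne hi]
    congr 1
    unfold z
    split_ifs
    · rw [map_add, map_one, hfx _ (yInv_pow s) i hi]
    · exact hfx _ (yInv_pow s) i hi

theorem not_conj_dW (hp : 3 ≤ p) (hn : n = 1 → 5 ≤ p) {r : ℕ} {s : Fin n} (hs : s.val < r)
    (hm : dW k p n r s ∈ wAlg k p n) (lam : Fin n → k) (σ : wAlg k p n ≃ₗ⁅k⁆ wAlg k p n) :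
    (σ ⟨dW k p n r s, hm⟩ : Witt k p (Fin n)) ≠ ∑ i, lam i • dW k p n 0 i := by
  have hp' : p.Prime := Fact.out
  have : NeZero (2 : k) := ⟨Ring.two_ne_zero (by rw [ringChar.eq k p]; omega)⟩
  have ht : dW k p n r s (x k p s) = y k p s := by rw [dW_x, if_pos rfl, z_of_shifted hs]
  refine not_conj_of_sandwich (fun c _ hc => ?_) hm (fun D hD => ?_) (fun V hCV hV => ?_) σ
  · refine mem_posPart_of_sandwich_of_offDiag hc (fun i => ?_) (fun _ => trivial)
      fun _ _ _ => trivial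
    refine ⟨x k p i ^ 2 • pd k p i, trivial, fun l => ?_, i, 1, one_ne_zero, by simp [pd_x]⟩
    rw [Derivation.smul_apply, smul_eq_mul]
    exact Ideal.mul_mem_right _ _ (Ideal.pow_mem_pow (x_mem_maxIdeal i) 2)
  · refine lie_mem_posPart_of_diagonal (w := lam) (fun i => ?_) hD
    rw [sum_dW, diag_x, z_of_not_shifted (Nat.not_lt_zero _)]
  · obtain ⟨j, htj, hj⟩ : ∃ j, ⁅dW k p n r s, z k p (j.val < r) j • pd k p j⁆ = 0 ∧
        x k p s ^ (p - 1) • (z k p (j.val < r) j • pd k p j) ∈ V := by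
      by_cases h1 : n = 1
      · have h5 := hn h1
        have hself : ⁅dW k p n r s, dW k p n r s⁆ = 0 := lie_self (dW k p n r s)
        refine ⟨s, hself, hCV _ trivial fun w _ => ?_⟩
        -- In one variable there is no second index. Since `x^(p-1) y = x^(p-1)`, the sandwich is
        -- `x^(p-1) ∂`, factored as `x^(p-2)` times `x ∂`; the square of `x^(p-2)` vanishes because
        -- `2(p - 2) ≥ p` when `p ≥ 5`.
        have h2 : x k p s ^ (p - 1) • (z k p (s.val < r) s • pd k p s) =
            x k p s ^ (p - 2) • (x k p s • pd k p s) := by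
          rw [smul_smul_derivation, smul_smul_derivation, ← pow_succ, show p - 2 + 1 = p - 1 by omega,
            z_of_shifted hs, y, mul_add, mul_one, ← pow_succ, Nat.sub_add_cancel hp'.one_le, x_pow,
            add_zero]
        rw [h2]
        refine sandwich_of_sq_eq_zero (κ := ((p - 2 : ℕ) : TruncPoly k p (Fin n))) ?_ ?_ w
        · rw [← pow_add]
          exact x_pow_eq_zero s (by omega)
        · rw [Derivation.smul_apply, Derivation.leibniz_pow, pd_x, if_pos rfl, smul_eq_mul,
            smul_eq_mul, nsmul_eq_mul, show p - 2 = p - 2 - 1 + 1 by omega, pow_succ]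
          simp
          ring
      · have : Nontrivial (Fin n) := Fin.nontrivial_iff_two_le.2 (by have := s.2; omega)
        obtain ⟨j, hj⟩ := exists_ne s
        refine ⟨j, ?_, hCV _ trivial fun w _ => ?_⟩
        · refine witt_ext fun i => ?_
          have hz : dW k p n r s (z k p (j.val < r) j) = 0 := by
            rw [derivation_z, dW_x, if_neg hj.symm]
          have hz' : pd k p j (z k p (s.val < r) s) = (0 : TruncPoly k p (Fin n)) := by
            rw [derivation_z, pd_x, if_neg hj]
          rw [Derivation.commutator_apply, Derivation.smul_apply, Derivation.smul_apply, dW_x, pd_x]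
          split_ifs <;> simp [hz, hz']
        -- With `j ≠ s`, the field `z_j ∂_j` annihilates `x_s^(p-1)`, whose square is zero, so `p ≥
        -- 3` suffices.
        · refine sandwich_of_sq_eq_zero (κ := 0) ?_ ?_ w
          · rw [← pow_add]
            exact x_pow_eq_zero s (by omega)
          · rw [Derivation.leibniz_pow, Derivation.smul_apply, pd_x, if_neg hj]
            simp
    refine ⟨_, mem_of_x_pow_smul_mem ht htj hV hj, pd k p j, trivial, fun h0 => ?_, ?_⟩
    · have := DFunLike.congr_fun h0 (x k p j)
      simp [pd_x] at this
    · refine witt_ext fun i => ?_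
      have hz : pd k p j (z k p (j.val < r) j) = (1 : TruncPoly k p (Fin n)) := by
        rw [derivation_z, pd_x, if_pos rfl]
      rw [Derivation.commutator_apply, Derivation.smul_apply, Derivation.smul_apply, pd_x]
      split_ifs <;> simp [hz]

theorem mem_torusIndex_dW [Algebra (ZMod p) k] (hp : 3 ≤ p) (hn : n = 1 → 5 ≤ p) {r : ℕ}
    (hr : 1 ≤ r) (hrn : r ≤ n) (lam : Fin n → k) :
    (∑ i, lam i • dW k p n r i) ∈ torusIndex (wAlg k p n) (dW k p n) r ↔
      LinearIndependent (ZMod p) (fun i : {i : Fin n // i.val < r} => lam i) := by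
  refine mem_torusIndex_iff (g := wAlg k p n) (fun _ _ => trivial) (fun r lam => ?_) (fun r r' i h => ?_)
    (fun r s j hs hj lam => conj_dW hs hj lam)
    (fun r s hs lam σ => not_conj_dW hp hn hs trivial lam σ) hr hrn lam
  · rw [sum_dW, sum_dW, pMap_diag]
  · rw [dW, dW, z_congr h]

end TypeW

/-! ### Divergence and its behaviour under automorphisms. -/

section Divergence

variable {k : Type*} [Field k] {p : ℕ} [Fact p.Prime] [CharP k p] {ι : Type*}

theorem pd_x_self (i : ι) : pd k p i (x k p i) = 1 := by
  classical
  rw [pd_x, if_pos rfl]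

theorem pd_x_of_ne {i j : ι} (h : i ≠ j) : pd k p i (x k p j) = 0 := by
  classical
  rw [pd_x, if_neg h]

theorem lie_pd_of_diagonal {u : Witt k p ι} {w : ι → k}
    (hu : ∀ i, u (x k p i) = w i • x k p i) (j : ι) : ⁅u, pd k p j⁆ = (-w j) • pd k p j := by
  classical
  refine witt_ext fun i => ?_
  rw [Derivation.commutator_apply, hu, Derivation.map_smul, Derivation.smul_apply, pd_x]
  split_ifs with h
  · rw [Derivation.map_one_eq_zero, zero_sub, h, neg_smul]
  · simp

theorem derivation_sum_apply {κ : Type*} (s : Finset κ) (D : κ → Witt k p ι)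
    (f : TruncPoly k p ι) : (∑ i ∈ s, D i) f = ∑ i ∈ s, D i f :=
  map_sum ({ toFun := fun E => E f, map_zero' := rfl, map_add' := fun _ _ => rfl } :
    Witt k p ι →+ TruncPoly k p ι) D s

theorem lie_eq_self_of_lie_eq_neg {D E : Witt k p ι} (h : ⁅D, E⁆ = (-1 : k) • E) : ⁅E, D⁆ = E := by
  ext f
  have h1 := DFunLike.congr_fun h f
  rw [Derivation.commutator_apply, Derivation.smul_apply,
    truncPoly_smul, map_neg, map_one] at h1
  rw [Derivation.commutator_apply]
  linear_combination -h1

variable [Fintype ι]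

theorem divergence_add (D E : Witt k p ι) : divergence (D + E) = divergence D + divergence E := by
  simp [divergence, Finset.sum_add_distrib]

theorem divergence_zero : divergence (0 : Witt k p ι) = 0 := by
  simp [divergence]

theorem divergence_sub (D E : Witt k p ι) : divergence (D - E) = divergence D - divergence E := by
  simp [divergence, Finset.sum_sub_distrib]

theorem divergence_sum {κ : Type*} (s : Finset κ) (D : κ → Witt k p ι) :
    divergence (∑ i ∈ s, D i) = ∑ i ∈ s, divergence (D i) := by
  classical
  induction s using Finset.induction_on with
  | empty => simpa using divergence_zero
  | insert a s ha ih => rw [Finset.sum_insert ha, Finset.sum_insert ha, divergence_add, ih]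

theorem divergence_smul (f : TruncPoly k p ι) (D : Witt k p ι) :
    divergence (f • D) = D f + f * divergence D := by
  unfold divergence
  rw [derivation_eq_sum D f, Finset.mul_sum, ← Finset.sum_add_distrib]
  refine Finset.sum_congr rfl fun i _ => ?_
  rw [Derivation.smul_apply, smul_eq_mul, Derivation.leibniz, smul_eq_mul, smul_eq_mul, add_comm]

theorem divergence_pd (i : ι) : divergence (pd k p i) = 0 := by
  classical
  refine Finset.sum_eq_zero fun l _ => ?_
  rw [pd_x]
  exact derivation_one_ite _ _

theorem divergence_smul_pd (f : TruncPoly k p ι) (i : ι) : divergence (f • pd k p i) = pd k p i f := by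
  rw [divergence_smul, divergence_pd, mul_zero, add_zero]

theorem mem_divFree {D : Witt k p ι} : D ∈ divFree k p ι ↔ divergence D = 0 := Iff.rfl

/-- An automorphism that maps the partial derivatives to derivations of divergence zero is
compatible with divergence. -/
theorem divergence_conj {Φ : TruncPoly k p ι ≃ₐ[k] TruncPoly k p ι}
    (h : ∀ i, divergence (conj Φ (pd k p i)) = 0) (D : Witt k p ι) :
    divergence (conj Φ D) = Φ (divergence D) := by
  conv_lhs => rw [witt_eq_sum D, map_sum, divergence_sum]
  unfold divergence
  rw [map_sum]
  refine Finset.sum_congr rfl fun i _ => ?_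
  change divergence _ = _
  -- If `E_i` is the conjugate of `∂_i`, then `f ∂_i` becomes `Φ(f) E_i`. As `E_i` has divergence
  -- zero, the divergence is `E_i(Φ f) = Φ(∂_i f)`.
  rw [conj_smul, divergence_smul, h, mul_zero, add_zero, conj_apply, Φ.symm_apply_apply]

theorem conj_mem_derived_divFree {Φ : TruncPoly k p ι ≃ₐ[k] TruncPoly k p ι}
    (h : ∀ i, divergence (conj Φ (pd k p i)) = 0) (m : ℕ) :
    (∀ D ∈ derivedSubalgebra (divFree k p ι) m, conj Φ D ∈ derivedSubalgebra (divFree k p ι) m) ∧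
      ∀ D ∈ derivedSubalgebra (divFree k p ι) m,
        (conj Φ).symm D ∈ derivedSubalgebra (divFree k p ι) m := by
  refine ⟨fun D hD => map_mem_derivedSubalgebra _ (fun D hD => ?_) _ hD,
    fun D hD => map_mem_derivedSubalgebra _ (fun D hD => ?_) _ hD⟩
  · rw [mem_divFree] at hD ⊢
    rw [divergence_conj h, hD, map_zero]
  · rw [mem_divFree] at hD ⊢
    have h1 := divergence_conj h ((conj Φ).symm D)
    rw [LieEquiv.apply_symm_apply, hD] at h1
    exact (map_eq_zero_iff Φ Φ.injective).1 h1.symm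

end Divergence

/-! ### Elements of the special algebra. -/

section Special

variable {k : Type*} [Field k] {p : ℕ} [Fact p.Prime] [CharP k p] {ι : Type*} [Fintype ι] [DecidableEq ι]

/-- The element `x_a ∂_a - x_b ∂_b`. -/
def coroot (k : Type*) [Field k] (p : ℕ) [CharP k p] {ι : Type*} (a b : ι) : Witt k p ι :=
  x k p a • pd k p a - x k p b • pd k p b

theorem coroot_x {a b : ι} (i : ι) :
    coroot k p a b (x k p i) = ((if i = a then 1 else 0) - if i = b then 1 else 0 : k) • x k p i := by
  rw [coroot, Derivation.sub_apply, Derivation.smul_apply, Derivation.smul_apply, pd_x, pd_x,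
    sub_smul]
  congr 1
  · by_cases h : i = a
    · simp [h]
    · simp [h, Ne.symm h]
  · by_cases h : i = b
    · simp [h]
    · simp [h, Ne.symm h]

theorem smul_pd_mem_divFree {f : TruncPoly k p ι} {i : ι} (h : pd k p i f = 0) :
    f • pd k p i ∈ divFree k p ι := by
  rw [mem_divFree, divergence_smul_pd, h]

theorem coroot_mem_divFree (a b : ι) : coroot k p a b ∈ divFree k p ι := by
  rw [mem_divFree, coroot, divergence_sub, divergence_smul_pd, divergence_smul_pd, pd_x_self,
    pd_x_self, sub_self]

theorem coroot_lie_smul_pd {a b : ι} {f : TruncPoly k p ι} {ω : k} (hf : coroot k p a b f = ω • f)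
    (j : ι) : ⁅coroot k p a b, f • pd k p j⁆ =
      (ω - ((if j = a then 1 else 0) - if j = b then 1 else 0)) • (f • pd k p j) := by
  rw [lie_smul_right, lie_pd_of_diagonal coroot_x, hf]
  ext g
  simp only [Derivation.add_apply, Derivation.smul_apply, smul_eq_mul, truncPoly_smul, map_sub,
    map_neg]
  ring

theorem lie_x_smul_pd (a b : ι) :
    ⁅x k p a • pd k p b, x k p b • pd k p a⁆ = coroot k p a b := by
  refine witt_ext fun i => ?_
  simp only [coroot, Derivation.commutator_apply, Derivation.smul_apply, Derivation.sub_apply,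
    smul_eq_mul, Derivation.leibniz, pd_x]
  split_ifs <;> simp_all

variable [NeZero (2 : k)]

/-- The `sl_2`-triple is `x_a ∂_b`, `x_b ∂_a`, `coroot`. Membership in a derived algebra becomes a
check that the weight under a suitable `coroot` is nonzero. -/
theorem mem_derived_divFree {a b : ι} (hab : a ≠ b) (m : ℕ) :
    coroot k p a b ∈ derivedSubalgebra (divFree k p ι) m ∧ ∀ w ∈ divFree k p ι, ∀ κ : k, κ ≠ 0 →
      ⁅coroot k p a b, w⁆ = κ • w → w ∈ derivedSubalgebra (divFree k p ι) m := by
  refine mem_derivedSubalgebra_of_triple one_ne_zero (coroot_mem_divFree a b)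
    (smul_pd_mem_divFree (pd_x_of_ne hab.symm)) (smul_pd_mem_divFree (pd_x_of_ne hab))
    (by rw [lie_x_smul_pd, one_smul]) ?_ ?_ m
  · rw [coroot_lie_smul_pd (coroot_x a), if_pos rfl, if_neg hab, if_neg hab.symm, if_pos rfl]
    norm_num
  · rw [coroot_lie_smul_pd (coroot_x b), if_pos rfl, if_neg hab, if_neg hab.symm, if_pos rfl]
    congr 1
    norm_num

theorem pd_mem_derived_divFree [Nontrivial ι] (b : ι) (m : ℕ) :
    pd k p b ∈ derivedSubalgebra (divFree k p ι) m := by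
  obtain ⟨a, hab⟩ := exists_ne b
  refine (mem_derived_divFree hab.symm m).2 _ (mem_divFree.2 (divergence_pd b)) (-1)
    (neg_ne_zero.2 one_ne_zero) ?_
  rw [lie_pd_of_diagonal coroot_x, if_pos rfl, if_neg hab.symm, sub_zero]

theorem x_smul_pd_mem_derived_divFree {a b : ι} (hab : a ≠ b) (m : ℕ) :
    x k p a • pd k p b ∈ derivedSubalgebra (divFree k p ι) m := by
  refine (mem_derived_divFree hab m).2 _ (smul_pd_mem_divFree (pd_x_of_ne hab.symm)) 2 two_ne_zero ?_
  rw [coroot_lie_smul_pd (coroot_x a), if_pos rfl, if_neg hab, if_neg hab.symm, if_pos rfl]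
  norm_num

theorem coroot_x_pow (a b i : ι) (e : ℕ) : coroot k p a b (x k p i ^ e) =
    (e * ((if i = a then 1 else 0) - if i = b then 1 else 0) : k) • x k p i ^ e := by
  rcases Nat.eq_zero_or_pos e with rfl | he
  · simp
  · rw [Derivation.leibniz_pow, coroot_x, truncPoly_smul, truncPoly_smul, map_mul, map_natCast,
      smul_eq_mul, nsmul_eq_mul]
    have h : x k p i ^ (e - 1) * x k p i = x k p i ^ e := by
      rw [← pow_succ, Nat.sub_add_cancel he]
    linear_combination (e : TruncPoly k p ι) * algebraMap k (TruncPoly k p ι)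
      ((if i = a then 1 else 0) - if i = b then 1 else 0) * h

/-- The third index `c` is there for `p = 3`: with respect to `coroot i j` the weight would be `3`,
whereas `coroot i c` gives weight `2`. -/
theorem x_sq_smul_pd_mem_derived_divFree {i j c : ι} (hij : i ≠ j) (hic : i ≠ c) (hjc : j ≠ c)
    (m : ℕ) : x k p i ^ 2 • pd k p j ∈ derivedSubalgebra (divFree k p ι) m := by
  refine (mem_derived_divFree hic m).2 _ (smul_pd_mem_divFree ?_) 2 two_ne_zero ?_
  · rw [Derivation.leibniz_pow, pd_x_of_ne hij.symm, smul_zero, smul_zero]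
  · rw [coroot_lie_smul_pd (coroot_x_pow i c i 2), if_pos rfl, if_neg hic, if_neg hij.symm,
      if_neg hjc]
    norm_num

/-- These become the sandwiches of type `S`. The weight under `coroot s n` is `p - 1 = -1`, hence
nonzero. -/
theorem x_pow_smul_coroot_mem_derived_divFree {s j n : ι} (hsj : s ≠ j) (hsn : s ≠ n)
    (m : ℕ) : x k p s ^ (p - 1) • coroot k p j n ∈ derivedSubalgebra (divFree k p ι) m := by
  have hp : p.Prime := Fact.out
  refine (mem_derived_divFree hsn m).2 _ ?_ (-1) (neg_ne_zero.2 one_ne_zero) ?_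
  · rw [mem_divFree, divergence_smul, mem_divFree.1 (coroot_mem_divFree j n), mul_zero, add_zero,
      coroot_x_pow, if_neg hsj, if_neg hsn, sub_zero, mul_zero, zero_smul]
  · have hcomm : ⁅coroot k p s n, coroot k p j n⁆ = 0 := witt_ext fun i => by
      rw [Derivation.commutator_apply, coroot_x, coroot_x, Derivation.map_smul, Derivation.map_smul,
        coroot_x, coroot_x, smul_comm, sub_self]
      rfl
    rw [lie_smul_right, hcomm, smul_zero, add_zero, coroot_x_pow, if_pos rfl, if_neg hsn, sub_zero,
      mul_one, Nat.cast_sub hp.one_le, CharP.cast_eq_zero, Nat.cast_one, zero_sub]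
    ext g
    simp only [Derivation.smul_apply, smul_eq_mul, truncPoly_smul, map_neg]
    ring

end Special

/-! ### Transvections preserving divergence. -/

section SpecialTransvection

variable {k : Type*} [Field k] {p : ℕ} [Fact p.Prime] [CharP k p] {ι : Type*} [DecidableEq ι]
  (q : Prop) [Decidable q] (j n : ι)

/-- The images of the generators under the substitution `z_j ↦ z_j u`, `x_n ↦ x_n v`. -/
def specialSubst (u v : TruncPoly k p ι) (i : ι) : TruncPoly k p ι :=
  if i = j then z k p q j * u - (if q then 1 else 0) else if i = n then x k p n * v else x k p i

variable {j n}

theorem specialSubst_pow {u : TruncPoly k p ι} (hu : u ^ p = 1) (v : TruncPoly k p ι) (i : ι) :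
    specialSubst q j n u v i ^ p = 0 := by
  unfold specialSubst
  split_ifs with h1 h2 h3
  · simpa [h2] using z_mul_sub_pow (q := q) j hu
  · simpa [h2] using z_mul_sub_pow (q := q) j hu
  · rw [mul_pow, x_pow, zero_mul]
  · exact x_pow i

theorem lift_specialSubst_of_ne {u v : TruncPoly k p ι} (hu : u ^ p = 1) {i : ι} (hj : i ≠ j)
    (hn : i ≠ n) : truncLift _ (specialSubst_pow q (j := j) (n := n) hu v) (x k p i) = x k p i := by
  rw [truncLift_x, specialSubst, if_neg hj, if_neg hn]

theorem lift_specialSubst_z {u v : TruncPoly k p ι} (hu : u ^ p = 1) :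
    truncLift _ (specialSubst_pow q (j := j) (n := n) hu v) (z k p q j) = z k p q j * u :=
  algHom_z (by rw [truncLift_x, specialSubst, if_pos rfl])

theorem lift_specialSubst_last {u v : TruncPoly k p ι} (hu : u ^ p = 1) (hjn : j ≠ n) :
    truncLift _ (specialSubst_pow q (j := j) (n := n) hu v) (x k p n) = x k p n * v := by
  rw [truncLift_x, specialSubst, if_neg hjn.symm, if_pos rfl]

theorem lift_specialSubst_specialSubst {u v : TruncPoly k p ι} (hu : u ^ p = 1) (hjn : j ≠ n)
    (huv : u * v = 1)
    (h : truncLift _ (specialSubst_pow q (j := j) (n := n) hu v) v = v)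
    (h' : truncLift _ (specialSubst_pow q (j := j) (n := n) hu v) u = u) (i : ι) :
    truncLift _ (specialSubst_pow q (j := j) (n := n) hu v) (specialSubst q j n v u i) =
      x k p i := by
  by_cases hij : i = j
  · subst hij
    have e : specialSubst q i n v u i = z k p q i * v - (if q then 1 else 0) := if_pos rfl
    rw [e, map_sub, map_mul, lift_specialSubst_z q hu, h, mul_assoc, huv, mul_one, x_eq_z_sub q i]
    split_ifs <;> simp
  · by_cases hin : i = n
    · subst hin
      have e : specialSubst q j i v u i = x k p i * u := by
        rw [specialSubst, if_neg hij, if_pos rfl]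
      rw [e, map_mul, lift_specialSubst_last q hu hjn, h', mul_assoc, mul_comm v, huv, mul_one]
    · rw [specialSubst, if_neg hij, if_neg hin, lift_specialSubst_of_ne q hu hij hin]

/-- The automorphism with `z_j ↦ z_j y_s⁻¹`, `x_n ↦ x_n y_s`. -/
def specialEquiv {s : ι} (hjs : j ≠ s) (hns : n ≠ s) (hjn : j ≠ n) :
    TruncPoly k p ι ≃ₐ[k] TruncPoly k p ι :=
  truncEquiv (specialSubst q j n (yInv k p s) (y k p s)) (specialSubst q j n (y k p s) (yInv k p s))
    (specialSubst_pow q (yInv_pow s) _) (specialSubst_pow q (y_pow s) _)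
    (lift_specialSubst_specialSubst q (yInv_pow s) hjn (by rw [mul_comm, y_mul_yInv])
      (map_y (lift_specialSubst_of_ne q (yInv_pow s) hjs.symm hns.symm))
      (map_yInv (lift_specialSubst_of_ne q (yInv_pow s) hjs.symm hns.symm)))
    (lift_specialSubst_specialSubst q (y_pow s) hjn (y_mul_yInv s)
      (map_yInv (lift_specialSubst_of_ne q (y_pow s) hjs.symm hns.symm))
      (map_y (lift_specialSubst_of_ne q (y_pow s) hjs.symm hns.symm)))

variable {s : ι} (hjs : j ≠ s) (hns : n ≠ s) (hjn : j ≠ n)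

theorem specialEquiv_x {i : ι} (hij : i ≠ j) (hin : i ≠ n) :
    specialEquiv (k := k) (p := p) q hjs hns hjn (x k p i) = x k p i :=
  lift_specialSubst_of_ne q (yInv_pow s) hij hin

theorem specialEquiv_z :
    specialEquiv (k := k) (p := p) q hjs hns hjn (z k p q j) = z k p q j * yInv k p s :=
  lift_specialSubst_z q (yInv_pow s)

theorem specialEquiv_x_target : specialEquiv (k := k) (p := p) q hjs hns hjn (x k p j) =
    z k p q j * yInv k p s - if q then 1 else 0 := by
  rw [x_eq_z_sub q j, map_sub, specialEquiv_z]
  split_ifs <;> simp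

theorem specialEquiv_x_last :
    specialEquiv (k := k) (p := p) q hjs hns hjn (x k p n) = x k p n * y k p s :=
  lift_specialSubst_last q (yInv_pow s) hjn

theorem specialEquiv_y :
    specialEquiv (k := k) (p := p) q hjs hns hjn (y k p s) = y k p s :=
  map_y (φ := (specialEquiv q hjs hns hjn).toAlgHom)
    (specialEquiv_x q hjs hns hjn hjs.symm hns.symm)

theorem specialEquiv_yInv :
    specialEquiv (k := k) (p := p) q hjs hns hjn (yInv k p s) = yInv k p s :=
  map_yInv (φ := (specialEquiv q hjs hns hjn).toAlgHom)
    (specialEquiv_x q hjs hns hjn hjs.symm hns.symm)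

theorem specialEquiv_symm_x (i : ι) :
    (specialEquiv (k := k) (p := p) q hjs hns hjn).symm (x k p i) =
      specialSubst q j n (y k p s) (yInv k p s) i :=
  truncLift_x _ (specialSubst_pow q (y_pow s) _) i

variable [Fintype ι]

/-- Scaling `x_n` by `y_s` compensates for scaling `z_j` by `y_s⁻¹`: for `i = s` the contributions
of `j` and `n` are `y_s⁻¹` and `-y_s⁻¹`; all others vanish. -/
theorem divergence_conj_specialEquiv (i : ι) :
    divergence (conj (specialEquiv (k := k) (p := p) q hjs hns hjn) (pd k p i)) = 0 := by
  unfold divergence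
  have hterm : ∀ l, l ≠ j → l ≠ n → pd k p l
      (conj (specialEquiv (k := k) (p := p) q hjs hns hjn) (pd k p i) (x k p l)) = 0 := by
    intro l hlj hln
    rw [conj_apply, specialEquiv_symm_x, specialSubst, if_neg hlj, if_neg hln, pd_x]
    split_ifs <;> simp
  have hone : ∀ a b : ι, (if a = b then (1 : TruncPoly k p ι) else 0) =
      algebraMap k _ (if a = b then 1 else 0) := fun a b => by split_ifs <;> simp
  have hj : pd k p j (conj (specialEquiv (k := k) (p := p) q hjs hns hjn) (pd k p i) (x k p j)) =
      yInv k p s * if i = s then 1 else 0 := by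
    rw [conj_apply, specialEquiv_symm_x, specialSubst, if_pos rfl, map_sub, derivation_one_ite,
      sub_zero, Derivation.leibniz, derivation_z, derivation_y, pd_x, pd_x, hone, hone, smul_eq_mul,
      smul_eq_mul, map_add, map_mul, map_mul, specialEquiv_z, specialEquiv_y, AlgEquiv.commutes,
      AlgEquiv.commutes, map_add]
    simp only [Derivation.leibniz, Derivation.map_algebraMap, derivation_z, derivation_y,
      derivation_yInv, pd_x_self, pd_x_of_ne hjs, smul_eq_mul]
    ring
  have hn : pd k p n (conj (specialEquiv (k := k) (p := p) q hjs hns hjn) (pd k p i) (x k p n)) =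
      -(yInv k p s * if i = s then 1 else 0) := by
    rw [conj_apply, specialEquiv_symm_x, specialSubst, if_neg hjn.symm, if_pos rfl,
      Derivation.leibniz, derivation_yInv, pd_x, pd_x, hone, hone, smul_eq_mul,
      smul_eq_mul, map_add, map_mul, map_mul, map_neg, map_mul, map_pow, specialEquiv_x_last,
      specialEquiv_yInv, AlgEquiv.commutes, AlgEquiv.commutes, map_add]
    simp only [Derivation.leibniz, Derivation.map_algebraMap, derivation_y, map_neg,
      Derivation.leibniz_pow,
      derivation_yInv, pd_x_self, pd_x_of_ne hns, smul_eq_mul, smul_zero, mul_zero, zero_add,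
      add_zero, neg_zero, mul_one]
    have h := y_mul_yInv (k := k) (p := p) s
    linear_combination (-yInv k p s * algebraMap k _ (if i = s then 1 else 0)) * h
  rw [← Finset.add_sum_erase _ _ (Finset.mem_univ j), ← Finset.add_sum_erase _ _
    (Finset.mem_erase.2 ⟨hjn.symm, Finset.mem_univ n⟩), Finset.sum_eq_zero, hj, hn]
  · ring
  · intro l hl
    simp only [Finset.mem_erase] at hl
    exact hterm l hl.2.1 hl.1

end SpecialTransvection

/-! ### Type `S`. -/

section TypeS

variable {k : Type*} [Field k] {p : ℕ} [Fact p.Prime] [CharP k p] {l : ℕ}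

/-- The weights of `∑ lam_i d_i` on the generators. -/
def weightS (lam : Fin l → k) : Fin (l + 1) → k :=
  Fin.snoc (α := fun _ => k) lam (-∑ i, lam i)

/-- The indices of the shifted generators. -/
def shiftedS (l r : ℕ) (i : Fin (l + 1)) : Prop := i.val < r ∧ i ≠ Fin.last l

instance (l r : ℕ) : DecidablePred (shiftedS l r) := fun i => by
  unfold shiftedS
  infer_instance

theorem shiftedS_castSucc (r : ℕ) (i : Fin l) : shiftedS l r i.castSucc ↔ i.val < r := by
  simp [shiftedS, Fin.castSucc_ne_last]

theorem shiftedS_last (r : ℕ) : ¬ shiftedS l r (Fin.last l) := by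
  simp [shiftedS]

theorem dS_castSucc (r : ℕ) (i j : Fin l) : dS k p l r i (x k p j.castSucc) =
    if i = j then z k p (i.val < r) i.castSucc else 0 := by
  rw [dS, Derivation.sub_apply, Derivation.smul_apply, Derivation.smul_apply, pd_x,
    pd_x_of_ne (Fin.castSucc_ne_last j).symm]
  simp only [Fin.castSucc_inj]
  split_ifs <;> simp

theorem dS_last (r : ℕ) (i : Fin l) : dS k p l r i (x k p (Fin.last l)) = -x k p (Fin.last l) := by
  rw [dS, Derivation.sub_apply, Derivation.smul_apply, Derivation.smul_apply, pd_x_self,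
    pd_x_of_ne (Fin.castSucc_ne_last i)]
  simp

theorem sum_dS (r : ℕ) (lam : Fin l → k) :
    ∑ i, lam i • dS k p l r i = diag (shiftedS l r) (weightS lam) := by
  refine eq_diag _ fun i => ?_
  rw [derivation_sum_apply]
  induction i using Fin.lastCases with
  | last =>
    rw [z_of_not_shifted (shiftedS_last r), weightS, Fin.snoc_last]
    simp only [Derivation.smul_apply, dS_last, truncPoly_smul, ← Finset.sum_mul, map_neg, map_sum]
    ring
  | cast j =>
    rw [z_congr (shiftedS_castSucc r j), weightS, Fin.snoc_castSucc, Finset.sum_eq_single j]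
    · rw [Derivation.smul_apply, dS_castSucc, if_pos rfl]
    · intro b _ hb
      rw [Derivation.smul_apply, dS_castSucc, if_neg hb, smul_zero]
    · simp

theorem dS_mem_sAlg [NeZero (2 : k)] (hl : 1 ≤ l) (r : ℕ) (i : Fin l) :
    dS k p l r i ∈ sAlg k p (l + 1) := by
  have : Nontrivial (Fin (l + 1)) := Fin.nontrivial_iff_two_le.2 (by omega)
  have h1 := (mem_derived_divFree (k := k) (p := p) (Fin.castSucc_ne_last i) 1).1
  by_cases h : i.val < r
  · have h2 := add_mem h1 (pd_mem_derived_divFree (k := k) (p := p) i.castSucc 1)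
    have e : dS k p l r i = coroot k p i.castSucc (Fin.last l) + pd k p i.castSucc := by
      rw [dS, coroot, z_of_shifted h, y]
      ext f
      simp
      ring
    rw [e]
    exact h2
  · rw [dS, z_of_not_shifted h]
    exact h1

theorem sum_update_add (lam : Fin l → k) (j : Fin l) (c : k) :
    ∑ i, Function.update lam j (lam j + c) i = ∑ i, lam i + c := by
  have h : Function.update lam j (lam j + c) = lam + Pi.single j c := by
    ext i
    by_cases hi : i = j
    · subst hi; simp
    · simp [hi]
  rw [h]
  simp [Finset.sum_add_distrib]

/-- The weight of `x_n` is minus the sum of the coordinates, so it drops by `λ_s` when `λ_j` grows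
by `λ_s`. The factor `y_s` in the image of `x_n` restores it. -/
theorem conj_dS [NeZero (2 : k)] {r : ℕ} {s j : Fin l} (hs : s.val < r) (hj : j ≠ s)
    (lam : Fin l → k) : Conj (sAlg k p (l + 1)) (∑ i, lam i • dS k p l r i)
      (∑ i, Function.update lam j (lam j + lam s) i • dS k p l r i) := by
  have hmem : ∑ i, lam i • dS k p l r i ∈ sAlg k p (l + 1) :=
    sum_mem fun i _ => LieSubalgebra.smul_mem _ _ (dS_mem_sAlg (by have := s.2; omega) r i)
  have hjs : j.castSucc ≠ s.castSucc := fun h => hj (Fin.castSucc_injective _ h)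
  have hns := (Fin.castSucc_ne_last s).symm
  have hjn := Fin.castSucc_ne_last j
  have hΦ := conj_mem_derived_divFree (divergence_conj_specialEquiv (k := k) (p := p)
    (shiftedS l r j.castSucc) hjs hns hjn) 1
  refine Conj.of_conj (specialEquiv (shiftedS l r j.castSucc) hjs hns hjn) hΦ.1 hΦ.2 hmem fun i => ?_
  have hss : shiftedS l r s.castSucc := (shiftedS_castSucc r s).2 hs
  have hws : weightS (Function.update lam j (lam j + lam s)) s.castSucc = lam s := by
    rw [weightS, Fin.snoc_castSucc, Function.update_of_ne hj.symm]
  rw [sum_dS, sum_dS, diag_x, map_smul]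
  induction i using Fin.lastCases with
  | last =>
    rw [z_of_not_shifted (shiftedS_last r), specialEquiv_x_last, Derivation.leibniz, derivation_y,
      diag_x, diag_x, z_of_not_shifted (shiftedS_last r), z_of_shifted hss, hws, weightS, weightS,
      Fin.snoc_last, Fin.snoc_last, sum_update_add]
    simp only [truncPoly_smul, smul_eq_mul, map_add, map_neg]
    ring
  | cast i =>
    by_cases hi : i = j
    · subst hi
      rw [specialEquiv_z, specialEquiv_x_target, map_sub, derivation_one_ite, sub_zero,
        Derivation.leibniz, diag_z, derivation_yInv, diag_x, hws, weightS, weightS,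
        Fin.snoc_castSucc, Fin.snoc_castSucc, Function.update_self, z_of_shifted hss]
      simp only [truncPoly_smul, smul_eq_mul, map_add]
      linear_combination (algebraMap k (TruncPoly k p (Fin (l + 1))) (lam s) *
        z k p (shiftedS l r i.castSucc) i.castSucc * yInv k p s.castSucc) *
          y_mul_yInv (k := k) (p := p) s.castSucc
    · have hij : i.castSucc ≠ j.castSucc := fun h => hi (Fin.castSucc_injective _ h)
      have hx := specialEquiv_x (k := k) (p := p) (shiftedS l r j.castSucc) hjs hns hjn hij
        (Fin.castSucc_ne_last i)
      rw [hx, diag_x, weightS, weightS, Fin.snoc_castSucc, Fin.snoc_castSucc,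
        Function.update_of_ne hi]
      congr 1
      unfold z
      split_ifs
      · rw [map_add, map_one, hx]
      · exact hx

/-- The sandwich is `x_s^(p-1)` times `x_j ∂_j - x_n ∂_n` with `j ≠ s`. The second factor
annihilates `x_s`, commutes with `dS`, and has `∂_j` as an eigenvector of eigenvalue `-1`. -/
theorem not_conj_dS (hp : 3 ≤ p) (hl : 2 ≤ l) {r : ℕ} {s : Fin l} (hs : s.val < r)
    (hm : dS k p l r s ∈ sAlg k p (l + 1)) (lam : Fin l → k)
    (σ : sAlg k p (l + 1) ≃ₗ⁅k⁆ sAlg k p (l + 1)) :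
    (σ ⟨dS k p l r s, hm⟩ : Witt k p (Fin (l + 1))) ≠ ∑ i, lam i • dS k p l 0 i := by
  have : NeZero (2 : k) := ⟨Ring.two_ne_zero (by rw [ringChar.eq k p]; omega)⟩
  have : Nontrivial (Fin (l + 1)) := Fin.nontrivial_iff_two_le.2 (by omega)
  have ht : dS k p l r s (x k p s.castSucc) = y k p s.castSucc := by
    rw [dS_castSucc, if_pos rfl, z_of_shifted hs]
  refine not_conj_of_sandwich (fun c _ hc => ?_) hm (fun D hD => ?_) (fun V hCV hV => ?_) σ
  · refine mem_posPart_of_sandwich_of_offDiag hc (fun i => ?_) (fun b => pd_mem_derived_divFree b 1)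
      fun a b hab => x_smul_pd_mem_derived_divFree hab 1
    obtain ⟨j, hji, c, hci, hcj⟩ : ∃ j, j ≠ i ∧ ∃ c, c ≠ i ∧ c ≠ j := by
      obtain ⟨j, hj⟩ := exists_ne i
      have hcard : ({i, j} : Finset (Fin (l + 1))).card <
          (Finset.univ : Finset (Fin (l + 1))).card := by
        rw [Finset.card_fin]
        exact lt_of_le_of_lt Finset.card_le_two (by omega)
      obtain ⟨c, -, hc⟩ := Finset.exists_mem_notMem_of_card_lt_card hcard
      simp only [Finset.mem_insert, Finset.mem_singleton, not_or] at hc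
      exact ⟨j, hj, c, hc⟩
    refine ⟨x k p i ^ 2 • pd k p j, x_sq_smul_pd_mem_derived_divFree hji.symm hci.symm hcj.symm 1,
      fun l => ?_, j, 1, one_ne_zero, by simp [pd_x_self]⟩
    rw [Derivation.smul_apply, smul_eq_mul]
    exact Ideal.mul_mem_right _ _ (Ideal.pow_mem_pow (x_mem_maxIdeal i) 2)
  · refine lie_mem_posPart_of_diagonal (w := weightS lam) (fun i => ?_) hD
    rw [sum_dS, diag_x, z_of_not_shifted (by simp [shiftedS])]
  · obtain ⟨j, hj⟩ : ∃ j : Fin l, j ≠ s :=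
      have : Nontrivial (Fin l) := Fin.nontrivial_iff_two_le.2 hl
      exists_ne s
    have hjs : j.castSucc ≠ s.castSucc := fun h => hj (Fin.castSucc_injective _ h)
    have htj : ⁅dS k p l r s, coroot k p j.castSucc (Fin.last l)⁆ = 0 := by
      refine witt_ext fun i => ?_
      rw [Derivation.commutator_apply, coroot_x, Derivation.map_smul]
      induction i using Fin.lastCases with
      | last =>
        rw [dS_last, map_neg, coroot_x, smul_neg, sub_self]
        rfl
      | cast i =>
        rw [dS_castSucc]
        by_cases hi : s = i
        · subst hi
          rw [if_pos rfl, derivation_z, coroot_x, if_neg hjs.symm, if_neg (Fin.castSucc_ne_last s),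
            sub_zero, zero_smul, zero_smul, sub_zero]
          rfl
        · simp [hi]
    refine ⟨_, mem_of_x_pow_smul_mem ht htj hV (hCV _
      (x_pow_smul_coroot_mem_derived_divFree hjs.symm (Fin.castSucc_ne_last s) 1) fun w _ => ?_),
      pd k p j.castSucc, pd_mem_derived_divFree _ 1, fun h0 => ?_, ?_⟩
    · refine sandwich_of_sq_eq_zero (κ := 0) ?_ ?_ w
      · rw [← pow_add]
        exact x_pow_eq_zero _ (by omega)
      · rw [Derivation.leibniz_pow, coroot_x, if_neg hjs.symm, if_neg (Fin.castSucc_ne_last s)]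
        simp
    · have := DFunLike.congr_fun h0 (x k p j.castSucc)
      simp [pd_x_self] at this
    · have h := lie_pd_of_diagonal (coroot_x (k := k) (p := p) (a := j.castSucc)
        (b := Fin.last l)) j.castSucc
      rw [if_pos rfl, if_neg (Fin.castSucc_ne_last j), sub_zero] at h
      exact lie_eq_self_of_lie_eq_neg h

theorem mem_torusIndex_dS [Algebra (ZMod p) k] (hp : 3 ≤ p) (hl : 2 ≤ l) {r : ℕ}
    (hr : 1 ≤ r) (hrl : r ≤ l) (lam : Fin l → k) :
    (∑ i, lam i • dS k p l r i) ∈ torusIndex (sAlg k p (l + 1)) (dS k p l) r ↔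
      LinearIndependent (ZMod p) (fun i : {i : Fin l // i.val < r} => lam i) := by
  have : NeZero (2 : k) := ⟨Ring.two_ne_zero (by rw [ringChar.eq k p]; omega)⟩
  have hmem : ∀ r i, dS k p l r i ∈ sAlg k p (l + 1) := dS_mem_sAlg (by omega)
  refine mem_torusIndex_iff hmem (fun r lam => ?_) (fun r r' i h => ?_)
    (fun r s j hs hj lam => conj_dS hs hj lam)
    (fun r s hs lam σ => not_conj_dS hp hl hs (hmem r s) lam σ) hr hrl lam
  · rw [sum_dS, sum_dS, pMap_diag]
    congr 1
    ext i
    induction i using Fin.lastCases with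
    | last =>
      rw [weightS, weightS, Fin.snoc_last, Fin.snoc_last, ← frobenius_def, map_neg, map_sum]
      rfl
    | cast i => rw [weightS, weightS, Fin.snoc_castSucc, Fin.snoc_castSucc]
  · rw [dS, dS, z_congr h]

end TypeS

/-! ### The Poisson bracket and the Hamiltonian algebra. -/

section Poisson

variable {k : Type*} [Field k] {p : ℕ} [Fact p.Prime] [CharP k p] {m : ℕ}

theorem sgn_mul_self (i : Fin m ⊕ Fin m) : sgn k i * sgn k i = 1 := by
  cases i <;> simp [sgn]

theorem sgn_ne_zero (i : Fin m ⊕ Fin m) : sgn k i ≠ 0 := by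
  cases i <;> simp [sgn]

theorem swap_ne_self (i : Fin m ⊕ Fin m) : i.swap ≠ i := by
  cases i <;> simp

theorem pd_pd_comm {ι : Type*} (i j : ι) (f : TruncPoly k p ι) :
    pd k p i (pd k p j f) = pd k p j (pd k p i f) := by
  classical
  have h : ⁅pd k p i, pd k p j⁆ = (0 : Witt k p ι) := witt_ext fun l => by
    rw [Derivation.commutator_apply, pd_x, pd_x, derivation_one_ite, derivation_one_ite, sub_zero]
    rfl
  have h1 := DFunLike.congr_fun h f
  rw [Derivation.commutator_apply] at h1
  exact sub_eq_zero.1 h1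

/-- The Hamiltonian vector field `{f, ·}` of `f`. -/
def hamVF (f : TruncPoly k p (Fin m ⊕ Fin m)) : Witt k p (Fin m ⊕ Fin m) :=
  ∑ l, sgn k l • pd k p l f • pd k p l.swap

theorem hamVF_apply (f g : TruncPoly k p (Fin m ⊕ Fin m)) :
    hamVF f g = ∑ l, sgn k l • (pd k p l f * pd k p l.swap g) := by
  rw [hamVF, derivation_sum_apply]
  rfl

theorem hamVF_apply_x (f : TruncPoly k p (Fin m ⊕ Fin m)) (i : Fin m ⊕ Fin m) :
    hamVF f (x k p i) = -(sgn k i • pd k p i.swap f) := by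
  rw [hamVF_apply, Finset.sum_eq_single i.swap]
  · rw [Sum.swap_swap, pd_x_self, mul_one, sgn_swap, neg_smul]
  · intro b _ hb
    rw [pd_x_of_ne, mul_zero, smul_zero]
    rintro rfl
    exact hb (Sum.swap_swap b).symm
  · simp

theorem hamVF_apply_comm (f g : TruncPoly k p (Fin m ⊕ Fin m)) : hamVF f g = -hamVF g f := by
  rw [hamVF_apply, hamVF_apply, ← Finset.sum_neg_distrib,
    ← Equiv.sum_comp (Equiv.sumComm (Fin m) (Fin m))]
  refine Finset.sum_congr rfl fun l _ => ?_
  simp only [Equiv.sumComm_apply, Sum.swap_swap, sgn_swap, neg_smul, mul_comm]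

theorem hamVF_add (f g : TruncPoly k p (Fin m ⊕ Fin m)) : hamVF (f + g) = hamVF f + hamVF g := by
  ext h
  rw [Derivation.add_apply, hamVF_apply_comm, map_add, hamVF_apply_comm f, hamVF_apply_comm g,
    neg_add]

theorem hamVF_mul (f g : TruncPoly k p (Fin m ⊕ Fin m)) :
    hamVF (f * g) = f • hamVF g + g • hamVF f := by
  ext h
  rw [Derivation.add_apply, Derivation.smul_apply, Derivation.smul_apply, hamVF_apply_comm,
    Derivation.leibniz, hamVF_apply_comm f, hamVF_apply_comm g]
  simp only [smul_eq_mul]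
  ring

theorem hamVF_smul (c : k) (f : TruncPoly k p (Fin m ⊕ Fin m)) : hamVF (c • f) = c • hamVF f := by
  ext h
  rw [Derivation.smul_apply, hamVF_apply_comm, Derivation.map_smul, hamVF_apply_comm f, smul_neg]

theorem hamVF_algebraMap (c : k) :
    hamVF (algebraMap k (TruncPoly k p (Fin m ⊕ Fin m)) c) = 0 := by
  ext h
  rw [hamVF_apply_comm, Derivation.map_algebraMap, neg_zero, Derivation.zero_apply]

theorem hamVF_sum {κ : Type*} (s : Finset κ) (f : κ → TruncPoly k p (Fin m ⊕ Fin m)) :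
    hamVF (∑ i ∈ s, f i) = ∑ i ∈ s, hamVF (f i) := by
  classical
  induction s using Finset.induction_on with
  | empty => simpa using hamVF_algebraMap (k := k) (p := p) (m := m) 0
  | insert a s ha ih => rw [Finset.sum_insert ha, Finset.sum_insert ha, hamVF_add, ih]

theorem hamVF_pow (f : TruncPoly k p (Fin m ⊕ Fin m)) (n : ℕ) :
    hamVF (f ^ n) = ((n : TruncPoly k p (Fin m ⊕ Fin m)) * f ^ (n - 1)) • hamVF f := by
  ext h
  rw [Derivation.smul_apply, hamVF_apply_comm, Derivation.leibniz_pow, hamVF_apply_comm f,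
    smul_eq_mul, smul_eq_mul, nsmul_eq_mul]
  ring

theorem hamVF_x (i : Fin m ⊕ Fin m) : hamVF (x k p i) = sgn k i • pd k p i.swap := by
  refine witt_ext fun j => ?_
  rw [Derivation.smul_apply, hamVF_apply_x]
  by_cases h : i.swap = j
  · rw [← h, Sum.swap_swap, pd_x_self, pd_x_self, sgn_swap, neg_smul, neg_neg]
  · rw [pd_x_of_ne h, pd_x_of_ne, smul_zero, smul_zero, neg_zero]
    rintro rfl
    exact h (Sum.swap_swap j)

theorem hamVF_mem_ham (f : TruncPoly k p (Fin m ⊕ Fin m)) : hamVF f ∈ ham k p m := by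
  intro i j
  rw [hamVF_apply_x, hamVF_apply_x, map_neg, map_neg, Derivation.map_smul, Derivation.map_smul,
    smul_neg, smul_neg, smul_smul, smul_smul, sgn_mul_self, sgn_mul_self, pd_pd_comm]

/-- The elements of `H` are the derivations of the Poisson bracket. -/
theorem mem_ham_iff {D : Witt k p (Fin m ⊕ Fin m)} :
    D ∈ ham k p m ↔ ∀ f, ⁅D, hamVF f⁆ = hamVF (D f) := by
  constructor
  · intro hD f
    refine witt_ext fun i => ?_
    -- The defining symmetry of `H` matches `{f, D x_i}` term by term with the correction arising
    -- when `∂_{i'}` is moved past `D`.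
    have h : ∀ l, sgn k l • (pd k p l f * pd k p l.swap (D (x k p i))) =
        sgn k i • (pd k p i.swap (D (x k p l)) * pd k p l f) := by
      intro l
      have h1 := congrArg (fun a => (sgn k l * sgn k i) • a) (hD i l)
      simp only [smul_smul] at h1
      rw [mul_assoc, sgn_mul_self, mul_right_comm, sgn_mul_self, mul_one, one_mul] at h1
      rw [← mul_smul_comm, h1, mul_smul_comm, mul_comm]
    rw [Derivation.commutator_apply, hamVF_apply_x, hamVF_apply_x, pd_comm, map_neg,
      Derivation.map_smul, hamVF_apply, Finset.sum_congr rfl fun l _ => h l, ← Finset.smul_sum,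
      smul_add]
    abel
  · intro h i j
    have h1 := DFunLike.congr_fun (h (x k p j)) (x k p i)
    rw [Derivation.commutator_apply, hamVF_apply_x, hamVF_apply_x, hamVF_x, map_neg,
      Derivation.map_smul, Derivation.smul_apply] at h1
    have h2 : D (pd k p i.swap (x k p j)) = 0 := by
      rw [pd_x]
      exact derivation_one_ite _ _
    rw [h2, smul_zero, neg_zero, zero_sub, neg_inj] at h1
    have h3 := congrArg (fun a => (sgn k i * sgn k j) • a) h1
    simp only [smul_smul] at h3
    rwa [mul_assoc, sgn_mul_self, mul_right_comm, sgn_mul_self, mul_one, one_mul] at h3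

/-- An automorphism that preserves the Poisson brackets of the generators preserves the Poisson
bracket. -/
theorem conj_hamVF {Φ : TruncPoly k p (Fin m ⊕ Fin m) ≃ₐ[k] TruncPoly k p (Fin m ⊕ Fin m)}
    (h : ∀ i j, hamVF (Φ (x k p i)) (Φ (x k p j)) = hamVF (x k p i) (x k p j))
    (f : TruncPoly k p (Fin m ⊕ Fin m)) : conj Φ (hamVF f) = hamVF (Φ f) := by
  induction f using truncPoly_induction with
  | hC c => rw [AlgEquiv.commutes, hamVF_algebraMap, map_zero]
  | hadd f g hf hg => rw [map_add, hamVF_add, hamVF_add, map_add, hf, hg]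
  | hmul f i hf =>
    have hx : conj Φ (hamVF (x k p i)) = hamVF (Φ (x k p i)) := conj_eq fun j => by
      rw [h, hamVF_x, Derivation.smul_apply, pd_x, map_smul]
      split_ifs <;> simp
    rw [map_mul, hamVF_mul, hamVF_mul, map_add, conj_smul, conj_smul, hf, hx]

theorem conj_mem_ham {Φ : TruncPoly k p (Fin m ⊕ Fin m) ≃ₐ[k] TruncPoly k p (Fin m ⊕ Fin m)}
    (h : ∀ f, conj Φ (hamVF f) = hamVF (Φ f)) {D : Witt k p (Fin m ⊕ Fin m)} (hD : D ∈ ham k p m) :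
    conj Φ D ∈ ham k p m := by
  rw [mem_ham_iff] at hD ⊢
  intro f
  have h1 := congrArg (conj Φ) (hD (Φ.symm f))
  rwa [LieEquiv.map_lie, h, h, Φ.apply_symm_apply] at h1

theorem conj_mem_derived_ham
    {Φ : TruncPoly k p (Fin m ⊕ Fin m) ≃ₐ[k] TruncPoly k p (Fin m ⊕ Fin m)}
    (h : ∀ i j, hamVF (Φ (x k p i)) (Φ (x k p j)) = hamVF (x k p i) (x k p j)) (e : ℕ) :
    (∀ D ∈ derivedSubalgebra (ham k p m) e, conj Φ D ∈ derivedSubalgebra (ham k p m) e) ∧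
      ∀ D ∈ derivedSubalgebra (ham k p m) e,
        (conj Φ).symm D ∈ derivedSubalgebra (ham k p m) e := by
  have hsymm : ∀ D, (conj Φ).symm D = conj Φ.symm D := fun D => rfl
  refine ⟨fun D hD => map_mem_derivedSubalgebra _ (fun D hD => conj_mem_ham (conj_hamVF h) hD) _ hD,
    fun D hD => map_mem_derivedSubalgebra _ (fun D hD => ?_) _ hD⟩
  rw [hsymm]
  refine conj_mem_ham (fun f => ?_) hD
  rw [← hsymm]
  have h1 := conj_hamVF h (Φ.symm f)
  rw [Φ.apply_symm_apply] at h1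
  rw [← h1, LieEquiv.symm_apply_apply]

theorem hamVF_x_mul_x_swap (i : Fin m ⊕ Fin m) :
    hamVF (x k p i * x k p i.swap) = (-sgn k i) • coroot k p i i.swap := by
  rw [hamVF_mul, hamVF_x, hamVF_x, Sum.swap_swap, sgn_swap, coroot]
  ext f
  simp only [Derivation.add_apply, Derivation.smul_apply, Derivation.sub_apply, smul_eq_mul,
    truncPoly_smul, map_neg]
  ring

theorem coroot_mem_ham (i : Fin m ⊕ Fin m) : coroot k p i i.swap ∈ ham k p m := by
  have h := (ham k p m).smul_mem (-sgn k i) (hamVF_mem_ham (x k p i * x k p i.swap))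
  rwa [hamVF_x_mul_x_swap, smul_smul, neg_mul_neg, sgn_mul_self, one_smul] at h

variable [NeZero (2 : k)]

/-- The `sl_2`-triple consists of the fields of `x_i²` and `x_{i'}²`, whose bracket is `-4` times
`coroot`; this constant is nonzero because `2` is. -/
theorem mem_derived_ham (i : Fin m ⊕ Fin m) (e : ℕ) :
    coroot k p i i.swap ∈ derivedSubalgebra (ham k p m) e ∧ ∀ w ∈ ham k p m, ∀ κ : k, κ ≠ 0 →
      ⁅coroot k p i i.swap, w⁆ = κ • w → w ∈ derivedSubalgebra (ham k p m) e := by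
  have hne := swap_ne_self i
  have h4 : (-4 : k) ≠ 0 := by
    have : (4 : k) = 2 * 2 := by norm_num
    rw [this]
    exact neg_ne_zero.2 (mul_ne_zero two_ne_zero two_ne_zero)
  refine mem_derivedSubalgebra_of_triple h4 (coroot_mem_ham i)
    (hamVF_mem_ham (x k p i ^ 2)) (hamVF_mem_ham (x k p i.swap ^ 2)) ?_ ?_ ?_ e
  · rw [mem_ham_iff.1 (hamVF_mem_ham _), hamVF_pow]
    have h : (((2 : ℕ) : TruncPoly k p (Fin m ⊕ Fin m)) * x k p i ^ (2 - 1)) • hamVF (x k p i)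
        = (2 * sgn k i) • x k p i • pd k p i.swap := by
      rw [hamVF_x]
      ext f
      simp only [Derivation.smul_apply, smul_eq_mul, truncPoly_smul, map_mul, map_ofNat]
      push_cast
      ring
    have h' : ((2 * sgn k i) • x k p i • pd k p i.swap : Witt k p (Fin m ⊕ Fin m))
        (x k p i.swap ^ 2) = (4 * sgn k i) • (x k p i * x k p i.swap) := by
      rw [Derivation.leibniz_pow, Derivation.smul_apply, Derivation.smul_apply, pd_x_self]
      simp only [smul_eq_mul, truncPoly_smul, map_mul, map_ofNat, nsmul_eq_mul]
      push_cast
      ring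
    rw [h, h', hamVF_smul, hamVF_x_mul_x_swap, smul_smul]
    congr 1
    linear_combination -4 * sgn_mul_self (k := k) i
  · rw [mem_ham_iff.1 (coroot_mem_ham i), coroot_x_pow, if_pos rfl, if_neg hne.symm, hamVF_smul]
    norm_num
  · rw [mem_ham_iff.1 (coroot_mem_ham i), coroot_x_pow, if_pos rfl, if_neg hne, hamVF_smul]
    congr 1
    norm_num

theorem hamVF_mem_derived {f : TruncPoly k p (Fin m ⊕ Fin m)} (i : Fin m ⊕ Fin m) {κ : k}
    (hκ : κ ≠ 0) (h : coroot k p i i.swap f = κ • f) (e : ℕ) :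
    hamVF f ∈ derivedSubalgebra (ham k p m) e := by
  refine (mem_derived_ham i e).2 _ (hamVF_mem_ham f) κ hκ ?_
  rw [mem_ham_iff.1 (coroot_mem_ham i), h, hamVF_smul]

theorem pd_mem_derived_ham (i : Fin m ⊕ Fin m) (e : ℕ) :
    pd k p i ∈ derivedSubalgebra (ham k p m) e := by
  refine (mem_derived_ham i e).2 _ (fun a b => ?_) (-1) (neg_ne_zero.2 one_ne_zero) ?_
  · rw [pd_x, pd_x, derivation_one_ite, derivation_one_ite, smul_zero, smul_zero]
  · rw [lie_pd_of_diagonal coroot_x, if_pos rfl, if_neg (swap_ne_self i).symm, sub_zero]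

theorem hamVF_x_sq (i : Fin m ⊕ Fin m) :
    hamVF (x k p i ^ 2) = (2 * sgn k i) • x k p i • pd k p i.swap := by
  rw [hamVF_pow, hamVF_x]
  ext f
  simp only [Derivation.smul_apply, smul_eq_mul, truncPoly_smul, map_mul, map_ofNat]
  push_cast
  ring

theorem x_smul_pd_mem_derived_ham (i : Fin m ⊕ Fin m) (e : ℕ) :
    x k p i • pd k p i.swap ∈ derivedSubalgebra (ham k p m) e := by
  have h1 : hamVF (x k p i ^ 2) ∈ derivedSubalgebra (ham k p m) e :=
    hamVF_mem_derived i (two_ne_zero) (by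
      rw [coroot_x_pow, if_pos rfl, if_neg (swap_ne_self i).symm]
      norm_num) e
  have hne : 2 * sgn k i ≠ 0 := mul_ne_zero two_ne_zero (sgn_ne_zero i)
  have h2 := (derivedSubalgebra (ham k p m) e).smul_mem (2 * sgn k i)⁻¹ h1
  rwa [hamVF_x_sq, smul_smul, inv_mul_cancel₀ hne, one_smul] at h2

/-- Among the elements `x_a ∂_b` only those with `b = a'` are used here, so the off-diagonal
criterion is replaced by the symplectic symmetry of the linear part `C`: up to sign `C_{lb}` equals
`C_{b'l'}`, and the sandwich condition says that their product is zero. -/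
theorem mem_posPart_of_sandwich_ham {e : ℕ} {c : Witt k p (Fin m ⊕ Fin m)}
    (hcm : c ∈ derivedSubalgebra (ham k p m) e)
    (hc : ∀ w ∈ derivedSubalgebra (ham k p m) e, ⁅c, ⁅c, w⁆⁆ = 0) : c ∈ posPart k p _ := by
  have h0 : ∀ i, ev k p _ (c (x k p i)) = 0 := by
    -- The field of `x_i² x_{i'}` sends `x_i` to a nonzero multiple of `x_i²`, and its weight under
    -- `coroot` is `2 - 1 = 1`.
    refine fun i => ev_eq_zero_of_sandwich hc ⟨hamVF (x k p i ^ 2 * x k p i.swap),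
      hamVF_mem_derived i one_ne_zero ?_ e, fun l => ?_, i, sgn k i.swap, sgn_ne_zero _, ?_⟩
    · rw [Derivation.leibniz, coroot_x_pow, coroot_x, if_pos rfl, if_pos rfl,
        if_neg (swap_ne_self i), if_neg (swap_ne_self i).symm]
      simp only [smul_eq_mul, truncPoly_smul, map_mul, map_sub, map_one, map_zero, map_natCast]
      push_cast
      ring
    · rw [hamVF_apply_x, Derivation.leibniz, Derivation.leibniz_pow, truncPoly_smul]
      have hm := fun i => x_mem_maxIdeal (k := k) (p := p) (ι := Fin m ⊕ Fin m) i
      refine neg_mem (Ideal.mul_mem_left _ _ (add_mem ?_ ?_))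
      · exact Ideal.mul_mem_right _ _ (Ideal.pow_mem_pow (hm i) 2)
      · have h := Ideal.mul_mem_mul (hm i.swap) (hm i)
        rw [← pow_two (maxIdeal k p (Fin m ⊕ Fin m))] at h
        have h2 := Ideal.mul_mem_right (2 * pd k p l.swap (x k p i)) _ h
        convert h2 using 1
        simp only [smul_eq_mul, nsmul_eq_mul]
        push_cast
        ring
    · rw [hamVF_apply_x, Derivation.leibniz, Derivation.leibniz_pow, pd_x_self,
        pd_x_of_ne (swap_ne_self i), sgn_swap, truncPoly_smul, truncPoly_smul, map_neg]
      simp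
      ring
  refine mem_posPart_of_linPart h0 ?_
  have hsq := linPart_sq_of_sandwich hc h0 fun i => pd_mem_derived_ham i e
  have hham : c ∈ ham k p m := derivedSubalgebra_le e hcm
  have hsymm : ∀ i j, sgn k i * linPart c i j.swap = sgn k j * linPart c j i.swap := by
    intro i j
    have h1 := congrArg (ev k p _) (hham i j)
    rwa [map_smul, map_smul] at h1
  have hprod : ∀ l a, linPart c l a.swap * linPart c a l.swap = 0 := by
    intro l a
    have h1 := linPart_mul_mul_of_sandwich hc h0 hsq (x_smul_pd_mem_derived_ham a e)
      fun i => by simp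
    rw [linPart_smul_pd] at h1
    have h2 := congrFun (congrFun h1 l) l.swap
    rw [Matrix.mul_apply, Finset.sum_eq_single a] at h2
    · simpa using h2
    · intro b _ hb
      rw [Matrix.mul_single_apply_of_ne _ _ _ _ _ hb, zero_mul]
    · simp
  ext l b
  have h1 := hprod l b.swap
  have h2 := hsymm l b.swap
  rw [Sum.swap_swap] at h1 h2
  have h3 : linPart c l b * linPart c l b = 0 := by
    have h4 := sgn_mul_self (k := k) l
    linear_combination (-(linPart c l b) ^ 2) * h4 + sgn k l * linPart c l b * h2 +
      sgn k l * sgn k b.swap * h1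
  simpa using h3

end Poisson

/-! ### Transvections preserving the Poisson bracket. -/

section HamiltonianTransvection

variable {k : Type*} [Field k] {p : ℕ} [Fact p.Prime] [CharP k p] {m : ℕ} (q : Prop) [Decidable q]

/-- The images of the generators under the substitution `x_{s'} ↦ x_{s'} + c z_j x_{j'} y_s⁻¹`. -/
def shearSubst (j s : Fin m) (c : k) :
    Fin m ⊕ Fin m → TruncPoly k p (Fin m ⊕ Fin m) :=
  Function.update (x k p) (Sum.inr s)
    (x k p (Sum.inr s) + c • (z k p q (Sum.inl j) * x k p (Sum.inr j) * yInv k p (Sum.inl s)))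

theorem shearSubst_self (j s : Fin m) (c : k) : shearSubst (p := p) q j s c (Sum.inr s) =
    x k p (Sum.inr s) + c • (z k p q (Sum.inl j) * x k p (Sum.inr j) * yInv k p (Sum.inl s)) :=
  Function.update_self ..

theorem shearSubst_of_ne (j s : Fin m) (c : k) {i : Fin m ⊕ Fin m} (h : i ≠ Sum.inr s) :
    shearSubst (p := p) q j s c i = x k p i :=
  Function.update_of_ne h ..

theorem shearSubst_pow (j s : Fin m) (c : k) (i : Fin m ⊕ Fin m) :
    (shearSubst q j s c i : TruncPoly k p (Fin m ⊕ Fin m)) ^ p = 0 := by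
  by_cases h : i = Sum.inr s
  · rw [h, shearSubst_self, add_pow_char, x_pow, truncPoly_smul, mul_pow, mul_pow, mul_pow, x_pow]
    ring
  · rw [shearSubst_of_ne q j s c h, x_pow]

theorem lift_shearSubst_of_ne {j s : Fin m} (c : k) {i : Fin m ⊕ Fin m} (h : i ≠ Sum.inr s) :
    truncLift _ (shearSubst_pow (p := p) q j s c) (x k p i) = x k p i := by
  rw [truncLift_x, shearSubst_of_ne q j s c h]

theorem lift_shearSubst_shearSubst {j s : Fin m} (hjs : j ≠ s) (c : k) (i : Fin m ⊕ Fin m) :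
    truncLift _ (shearSubst_pow (p := p) q j s c) (shearSubst q j s (-c) i) = x k p i := by
  have hz : truncLift _ (shearSubst_pow (p := p) q j s c) (z k p q (Sum.inl j)) =
      z k p q (Sum.inl j) := by
    unfold z
    split_ifs
    · rw [map_add, map_one, lift_shearSubst_of_ne q c (by simp)]
    · rw [lift_shearSubst_of_ne q c (by simp)]
  by_cases h : i = Sum.inr s
  · rw [h, shearSubst_self, map_add, map_smul, map_mul, map_mul, hz,
      map_yInv (lift_shearSubst_of_ne q c (by simp)),
      lift_shearSubst_of_ne q c (i := Sum.inr j) (by simpa using hjs), truncLift_x, shearSubst_self, neg_smul,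
      add_neg_cancel_right]
  · rw [shearSubst_of_ne q j s (-c) h, lift_shearSubst_of_ne q c h]

/-- The automorphism with `x_{s'} ↦ x_{s'} + z_j x_{j'} y_s⁻¹`. -/
def shearEquiv {j s : Fin m} (hjs : j ≠ s) :
    TruncPoly k p (Fin m ⊕ Fin m) ≃ₐ[k] TruncPoly k p (Fin m ⊕ Fin m) :=
  truncEquiv (shearSubst q j s 1) (shearSubst q j s (-1)) (shearSubst_pow q j s 1)
    (shearSubst_pow q j s (-1)) (lift_shearSubst_shearSubst q hjs 1)
    (by simpa using lift_shearSubst_shearSubst (k := k) (p := p) q hjs (-1))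

variable {j s : Fin m} (hjs : j ≠ s)

/-- The symplectic automorphism with `z_j ↦ z_j y_s⁻¹`, `x_{j'} ↦ x_{j'} y_s`,
`x_{s'} ↦ x_{s'} + z_j x_{j'} y_s⁻¹`. -/
def hamEquiv : TruncPoly k p (Fin m ⊕ Fin m) ≃ₐ[k] TruncPoly k p (Fin m ⊕ Fin m) :=
  (shearEquiv q hjs).trans (specialEquiv q (j := Sum.inl j) (n := Sum.inr j) (s := Sum.inl s)
    (by simpa using hjs) (by simp) (by simp))

theorem hamEquiv_of_ne {i : Fin m ⊕ Fin m} (h : i ≠ Sum.inr s) :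
    hamEquiv (k := k) (p := p) q hjs (x k p i) =
      specialEquiv q (j := Sum.inl j) (n := Sum.inr j) (s := Sum.inl s)
        (by simpa using hjs) (by simp) (by simp) (x k p i) :=
  congrArg _ (lift_shearSubst_of_ne q 1 h)

theorem hamEquiv_x {i : Fin m ⊕ Fin m} (h : i ≠ Sum.inr s) (h1 : i ≠ Sum.inl j)
    (h2 : i ≠ Sum.inr j) : hamEquiv (k := k) (p := p) q hjs (x k p i) = x k p i := by
  rw [hamEquiv_of_ne q hjs h, specialEquiv_x _ _ _ _ h1 h2]

theorem hamEquiv_inl_target : hamEquiv (k := k) (p := p) q hjs (x k p (Sum.inl j)) =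
    z k p q (Sum.inl j) * yInv k p (Sum.inl s) - if q then 1 else 0 := by
  rw [hamEquiv_of_ne q hjs (by simp), specialEquiv_x_target]

theorem hamEquiv_z : hamEquiv (k := k) (p := p) q hjs (z k p q (Sum.inl j)) =
    z k p q (Sum.inl j) * yInv k p (Sum.inl s) :=
  algHom_z (φ := (hamEquiv q hjs).toAlgHom) (hamEquiv_inl_target q hjs)

theorem hamEquiv_inr_target : hamEquiv (k := k) (p := p) q hjs (x k p (Sum.inr j)) =
    x k p (Sum.inr j) * y k p (Sum.inl s) := by
  rw [hamEquiv_of_ne q hjs (by simpa using hjs), specialEquiv_x_last]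

theorem hamEquiv_inr_source : hamEquiv (k := k) (p := p) q hjs (x k p (Sum.inr s)) =
    x k p (Sum.inr s) + z k p q (Sum.inl j) * x k p (Sum.inr j) * yInv k p (Sum.inl s) := by
  have h : shearEquiv (k := k) (p := p) q hjs (x k p (Sum.inr s)) =
      x k p (Sum.inr s) + (1 : k) • (z k p q (Sum.inl j) * x k p (Sum.inr j) *
        yInv k p (Sum.inl s)) := by
    rw [shearEquiv, truncEquiv_apply, truncLift_x, shearSubst_self]
  rw [hamEquiv, AlgEquiv.trans_apply, h, one_smul, map_add, map_mul, map_mul, specialEquiv_z,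
    specialEquiv_x_last, specialEquiv_yInv,
    specialEquiv_x _ _ _ _ (by simp) (by simpa using hjs.symm)]
  linear_combination (z k p q (Sum.inl j) * x k p (Sum.inr j) * yInv k p (Sum.inl s)) *
    y_mul_yInv (k := k) (p := p) (Sum.inl s : Fin m ⊕ Fin m)

/-- The Poisson brackets with a generator that is fixed and whose conjugate variable is not
involved. -/
theorem hamVF_hamEquiv_of_ne {i : Fin m ⊕ Fin m} (h : i ≠ Sum.inr s) (h1 : i ≠ Sum.inl j)
    (h2 : i ≠ Sum.inr j) (l : Fin m ⊕ Fin m) :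
    hamVF (x k p i) (hamEquiv (k := k) (p := p) q hjs (x k p l)) = hamVF (x k p i) (x k p l) := by
  have e1 : i.swap ≠ Sum.inl s := fun e => h (by rw [← Sum.swap_swap i, e]; rfl)
  have e2 : i.swap ≠ Sum.inr j := fun e => h1 (by rw [← Sum.swap_swap i, e]; rfl)
  have e3 : i.swap ≠ Sum.inl j := fun e => h2 (by rw [← Sum.swap_swap i, e]; rfl)
  simp only [hamVF_x, Derivation.smul_apply]
  congr 1
  by_cases hl1 : l = Sum.inl j
  · rw [hl1, hamEquiv_inl_target, map_sub, derivation_one_ite, Derivation.leibniz, derivation_z,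
      derivation_yInv, pd_x_of_ne e1, pd_x_of_ne e3]
    simp
  by_cases hl2 : l = Sum.inr j
  · rw [hl2, hamEquiv_inr_target, Derivation.leibniz, derivation_y, pd_x_of_ne e1, pd_x_of_ne e2]
    simp
  by_cases hl3 : l = Sum.inr s
  · rw [hl3, hamEquiv_inr_source, map_add, Derivation.leibniz, Derivation.leibniz, derivation_z,
      derivation_yInv, pd_x_of_ne e1, pd_x_of_ne e2, pd_x_of_ne e3]
    simp
  · rw [hamEquiv_x q hjs hl3 hl1 hl2]

/-- By antisymmetry, only the three pairs among the images of `x_j`, `x_{j'}`, `x_{s'}` need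
computation. The shear of `x_{s'}` is chosen so that its brackets with the other two cancel the
terms coming from `{y_s, x_{s'}} = 1`. -/
theorem hamVF_hamEquiv (i l : Fin m ⊕ Fin m) :
    hamVF (hamEquiv (k := k) (p := p) q hjs (x k p i)) (hamEquiv q hjs (x k p l)) =
      hamVF (x k p i) (x k p l) := by
  by_cases hi : i ≠ Sum.inr s ∧ i ≠ Sum.inl j ∧ i ≠ Sum.inr j
  · rw [hamEquiv_x q hjs hi.1 hi.2.1 hi.2.2, hamVF_hamEquiv_of_ne q hjs hi.1 hi.2.1 hi.2.2]
  by_cases hl : l ≠ Sum.inr s ∧ l ≠ Sum.inl j ∧ l ≠ Sum.inr j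
  · rw [hamVF_apply_comm, hamVF_apply_comm (x k p i), hamEquiv_x q hjs hl.1 hl.2.1 hl.2.2,
      hamVF_hamEquiv_of_ne q hjs hl.1 hl.2.1 hl.2.2]
  have hself : ∀ f : TruncPoly k p (Fin m ⊕ Fin m), hamVF f f = 0 := fun f => by
    rw [hamVF_apply]
    simp only [Fintype.sum_sum_type, Sum.swap_inl, Sum.swap_inr, sgn, Sum.elim_inl, Sum.elim_inr,
      one_smul, neg_smul, Finset.sum_neg_distrib, mul_comm, add_neg_cancel]
  have hY := y_mul_yInv (k := k) (p := p) (Sum.inl s : Fin m ⊕ Fin m)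
  have hx : ∀ a b : Fin m ⊕ Fin m, a.swap ≠ b → hamVF (x k p a) (x k p b) = 0 := fun a b h => by
    rw [hamVF_x, Derivation.smul_apply, pd_x_of_ne h, smul_zero]
  have hxx : ∀ a : Fin m,
      hamVF (x k p (Sum.inl a)) (x k p (Sum.inr a) : TruncPoly k p (Fin m ⊕ Fin m)) = 1 := by
    intro a
    rw [hamVF_x, Derivation.smul_apply, Sum.swap_inl, pd_x_self, sgn, Sum.elim_inl, one_smul]
  have hxx' : ∀ a : Fin m,
      hamVF (x k p (Sum.inr a)) (x k p (Sum.inl a) : TruncPoly k p (Fin m ⊕ Fin m)) = -1 :=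
    fun a => by rw [hamVF_apply_comm, hxx]
  have hA : ∀ f, hamVF (hamEquiv (k := k) (p := p) q hjs (x k p (Sum.inl j))) f =
      yInv k p (Sum.inl s) * hamVF (x k p (Sum.inl j)) f -
        z k p q (Sum.inl j) * yInv k p (Sum.inl s) ^ 2 * hamVF (x k p (Sum.inl s)) f := by
    intro f
    rw [hamVF_apply_comm, hamEquiv_inl_target, map_sub, derivation_one_ite, Derivation.leibniz,
      derivation_z, derivation_yInv, hamVF_apply_comm f, hamVF_apply_comm f]
    simp only [smul_eq_mul]
    ring
  have hB : ∀ f, hamVF (hamEquiv (k := k) (p := p) q hjs (x k p (Sum.inr j))) f =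
      y k p (Sum.inl s) * hamVF (x k p (Sum.inr j)) f +
        x k p (Sum.inr j) * hamVF (x k p (Sum.inl s)) f := by
    intro f
    rw [hamVF_apply_comm, hamEquiv_inr_target, Derivation.leibniz, derivation_y,
      hamVF_apply_comm f, hamVF_apply_comm f]
    simp only [smul_eq_mul]
    ring
  have hsj : s ≠ j := hjs.symm
  have h1 : hamVF (hamEquiv (k := k) (p := p) q hjs (x k p (Sum.inl j)))
      (hamEquiv q hjs (x k p (Sum.inr j))) = 1 := by
    rw [hA, hamEquiv_inr_target, Derivation.leibniz, Derivation.leibniz, derivation_y,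
      derivation_y, hxx, hx _ (Sum.inl s) (by simp), hx (Sum.inl s) (Sum.inr j) (by simpa using hsj),
      hx (Sum.inl s) (Sum.inl s) (by simp)]
    simp only [smul_eq_mul]
    linear_combination hY
  have h2 : hamVF (hamEquiv (k := k) (p := p) q hjs (x k p (Sum.inl j)))
      (hamEquiv q hjs (x k p (Sum.inr s))) = 0 := by
    rw [hA, hamEquiv_inr_source, map_add, map_add, Derivation.leibniz, Derivation.leibniz,
      Derivation.leibniz, Derivation.leibniz, derivation_z, derivation_z, derivation_yInv,
      derivation_yInv, hxx, hxx, hx (Sum.inl j) (Sum.inl s) (by simp),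
      hx (Sum.inl j) (Sum.inr s) (by simpa using hjs), hx (Sum.inl j) (Sum.inl j) (by simp),
      hx (Sum.inl s) (Sum.inr j) (by simpa using hsj),
      hx (Sum.inl s) (Sum.inl s) (by simp), hx (Sum.inl s) (Sum.inl j) (by simp)]
    simp only [smul_eq_mul]
    ring
  have h3 : hamVF (hamEquiv (k := k) (p := p) q hjs (x k p (Sum.inr j)))
      (hamEquiv q hjs (x k p (Sum.inr s))) = 0 := by
    rw [hB, hamEquiv_inr_source, map_add, map_add, Derivation.leibniz, Derivation.leibniz,
      Derivation.leibniz, Derivation.leibniz, derivation_z, derivation_z, derivation_yInv,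
      derivation_yInv, hxx, hxx', hx (Sum.inr j) (Sum.inl s) (by simpa using hjs),
      hx (Sum.inr j) (Sum.inr s) (by simp), hx (Sum.inr j) (Sum.inr j) (by simp),
      hx (Sum.inl s) (Sum.inr j) (by simpa using hsj),
      hx (Sum.inl s) (Sum.inl s) (by simp), hx (Sum.inl s) (Sum.inl j) (by simp)]
    simp only [smul_eq_mul]
    linear_combination -(x k p (Sum.inr j)) * hY
  have hi' : i = Sum.inr s ∨ i = Sum.inl j ∨ i = Sum.inr j := by tauto
  have hl' : l = Sum.inr s ∨ l = Sum.inl j ∨ l = Sum.inr j := by tauto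
  rcases hi' with rfl | rfl | rfl <;> rcases hl' with rfl | rfl | rfl
  · rw [hself, hself]
  · rw [hamVF_apply_comm, h2, hx _ _ (by simpa using hsj), neg_zero]
  · rw [hamVF_apply_comm, h3, hx _ _ (by simp), neg_zero]
  · rw [h2, hx _ _ (by simpa using hjs)]
  · rw [hself, hself]
  · rw [h1, hxx]
  · rw [h3, hx _ _ (by simp)]
  · rw [hamVF_apply_comm, h1, hxx']
  · rw [hself, hself]

end HamiltonianTransvection

/-! ### Type `H`. -/

section TypeH

variable {k : Type*} [Field k] {p : ℕ} [Fact p.Prime] [CharP k p] {m : ℕ}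

/-- The indices for which `y_i` takes the place of `x_i` in the torus `t_r` of `H`. -/
def shiftedH (m r : ℕ) : Fin m ⊕ Fin m → Prop := Sum.elim (fun i => i.val < r) fun _ => False

instance (r : ℕ) : DecidablePred (shiftedH m r) := fun i =>
  match i with
  | Sum.inl i => inferInstanceAs (Decidable (i.val < r))
  | Sum.inr _ => inferInstanceAs (Decidable False)

/-- The weights of `∑ lam_i d_i` on the generators. -/
def weightH (lam : Fin m → k) : Fin m ⊕ Fin m → k := Sum.elim lam (-lam)

theorem dH_inl (r : ℕ) (i j : Fin m) : dH k p m r i (x k p (Sum.inl j)) =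
    if i = j then z k p (j.val < r) (Sum.inl j) else 0 := by
  rw [dH, Derivation.sub_apply, Derivation.smul_apply, Derivation.smul_apply,
    pd_x_of_ne (i := Sum.inr i) (by simp), smul_zero, sub_zero]
  split_ifs with h
  · subst h
    rw [pd_x_self, smul_eq_mul, mul_one]
  · rw [pd_x_of_ne (by simpa using h), smul_zero]

theorem dH_inr (r : ℕ) (i j : Fin m) : dH k p m r i (x k p (Sum.inr j)) =
    if i = j then -x k p (Sum.inr j) else 0 := by
  rw [dH, Derivation.sub_apply, Derivation.smul_apply, Derivation.smul_apply,
    pd_x_of_ne (i := Sum.inl i) (by simp), smul_zero, zero_sub]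
  split_ifs with h
  · subst h
    rw [pd_x_self, smul_eq_mul, mul_one]
  · rw [pd_x_of_ne (by simpa using h), smul_zero, neg_zero]

theorem sum_dH (r : ℕ) (lam : Fin m → k) :
    ∑ i, lam i • dH k p m r i = diag (shiftedH m r) (weightH lam) := by
  refine eq_diag _ fun i => ?_
  rw [derivation_sum_apply]
  rcases i with j | j
  · rw [Finset.sum_eq_single j, Derivation.smul_apply, dH_inl, if_pos rfl]
    · rfl
    · intro b _ hb
      rw [Derivation.smul_apply, dH_inl, if_neg hb, smul_zero]
    · simp
  · rw [Finset.sum_eq_single j, Derivation.smul_apply, dH_inr, if_pos rfl,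
      z_of_not_shifted (by simp [shiftedH]), weightH, Sum.elim_inr, Pi.neg_apply, neg_smul, smul_neg]
    · intro b _ hb
      rw [Derivation.smul_apply, dH_inr, if_neg hb, smul_zero]
    · simp

theorem dH_mem_hAlg [NeZero (2 : k)] (r : ℕ) (i : Fin m) : dH k p m r i ∈ hAlg k p m := by
  have h1 := (mem_derived_ham (k := k) (p := p) (Sum.inl i : Fin m ⊕ Fin m) 2).1
  by_cases h : i.val < r
  · have h2 := add_mem h1 (pd_mem_derived_ham (k := k) (p := p) (Sum.inl i : Fin m ⊕ Fin m) 2)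
    have e : dH k p m r i = coroot k p (Sum.inl i) (Sum.inr i) + pd k p (Sum.inl i) := by
      rw [dH, coroot, z_of_shifted h, y]
      ext f
      simp
      ring
    rw [e]
    exact h2
  · rw [dH, z_of_not_shifted h]
    exact h1

/-- In the new coordinates `z_j x_{j'}` has weight zero, so the shear term `z_j x_{j'} y_s⁻¹` has
weight `-λ_s`, the same as `x_{s'}`. -/
theorem conj_dH [NeZero (2 : k)] {r : ℕ} {s j : Fin m} (hs : s.val < r) (hj : j ≠ s)
    (lam : Fin m → k) : Conj (hAlg k p m) (∑ i, lam i • dH k p m r i)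
      (∑ i, Function.update lam j (lam j + lam s) i • dH k p m r i) := by
  have hmem : ∑ i, lam i • dH k p m r i ∈ hAlg k p m :=
    sum_mem fun i _ => LieSubalgebra.smul_mem _ _ (dH_mem_hAlg r i)
  have hΦ := conj_mem_derived_ham (hamVF_hamEquiv (k := k) (p := p)
    (shiftedH m r (Sum.inl j)) hj) 2
  refine Conj.of_conj (hamEquiv (shiftedH m r (Sum.inl j)) hj) hΦ.1 hΦ.2 hmem fun i => ?_
  have hss : shiftedH m r (Sum.inl s) := hs
  have hns : ∀ a, ¬ shiftedH m r (Sum.inr a) := fun a => id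
  have hws : Function.update lam j (lam j + lam s) s = lam s := Function.update_of_ne hj.symm ..
  have hY := y_mul_yInv (k := k) (p := p) (Sum.inl s : Fin m ⊕ Fin m)
  rw [sum_dH, sum_dH, diag_x, map_smul]
  by_cases h1 : i = Sum.inl j
  · subst h1
    rw [hamEquiv_z, hamEquiv_inl_target, map_sub, derivation_one_ite, sub_zero,
      Derivation.leibniz, diag_z, derivation_yInv, diag_x, z_of_shifted hss]
    simp only [weightH, Sum.elim_inl, hws, Function.update_self, truncPoly_smul, smul_eq_mul,
      map_add]
    linear_combination (algebraMap k (TruncPoly k p (Fin m ⊕ Fin m)) (lam s) *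
      z k p (shiftedH m r (Sum.inl j)) (Sum.inl j) * yInv k p (Sum.inl s)) * hY
  by_cases h2 : i = Sum.inr j
  · subst h2
    rw [z_of_not_shifted (hns j), hamEquiv_inr_target, Derivation.leibniz, derivation_y, diag_x,
      diag_x, z_of_shifted hss, z_of_not_shifted (hns j)]
    simp only [weightH, Sum.elim_inl, Sum.elim_inr, Pi.neg_apply, hws, Function.update_self,
      truncPoly_smul, smul_eq_mul, map_add, map_neg]
    ring
  by_cases h3 : i = Sum.inr s
  · subst h3
    rw [z_of_not_shifted (hns s), hamEquiv_inr_source, map_add, Derivation.leibniz,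
      Derivation.leibniz, diag_z, derivation_yInv, diag_x, diag_x, diag_x, z_of_shifted hss,
      z_of_not_shifted (hns j), z_of_not_shifted (hns s)]
    simp only [weightH, Sum.elim_inl, Sum.elim_inr, Pi.neg_apply, hws, Function.update_self,
      truncPoly_smul, smul_eq_mul, map_add, map_neg]
    linear_combination (algebraMap k (TruncPoly k p (Fin m ⊕ Fin m)) (lam s) *
      z k p (shiftedH m r (Sum.inl j)) (Sum.inl j) * x k p (Sum.inr j) * yInv k p (Sum.inl s)) * hY
  · have hx := hamEquiv_x (k := k) (p := p) (shiftedH m r (Sum.inl j)) hj h3 h1 h2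
    have hw : weightH (Function.update lam j (lam j + lam s)) i = weightH lam i := by
      rcases i with i | i
      · exact Function.update_of_ne (fun h => h1 (congrArg _ h)) ..
      · exact congrArg Neg.neg (Function.update_of_ne (fun h => h2 (congrArg _ h)) ..)
    rw [hx, diag_x, hw]
    congr 1
    unfold z
    split_ifs
    · rw [map_add, map_one, hx]
    · exact hx

/-- A subspace stable under `t` that contains the Hamiltonian field of `x_s ^ (p - 1) g` also contains
that of `g`, provided `t` annihilates `g` and maps `x_s` to `y_s`. -/
theorem hamVF_mem_of_x_pow_mul {V : Submodule k (Witt k p (Fin m ⊕ Fin m))}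
    {t : Witt k p (Fin m ⊕ Fin m)} {s : Fin m ⊕ Fin m} {g : TruncPoly k p (Fin m ⊕ Fin m)}
    (htm : t ∈ ham k p m) (ht : t (x k p s) = y k p s) (htg : t g = 0) (hV : ∀ E ∈ V, ⁅t, E⁆ ∈ V)
    (h : hamVF (x k p s ^ (p - 1) * g) ∈ V) : hamVF g ∈ V := by
  have h1 := mem_of_sum_eigenvectors (p := p) (LieAlgebra.ad k (Witt k p _) t) hV
    (fun i => hamVF (y k p s ^ i * g)) (fun i => by
      rw [LieAlgebra.ad_apply, mem_ham_iff.1 htm, Derivation.leibniz, htg, y_pow_eigen ht,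
        smul_zero, zero_add, smul_eq_mul, mul_smul_comm, mul_comm g, hamVF_smul])
    (by
      rw [← hamVF_sum, ← Finset.sum_mul]
      rwa [x_pow_pred] at h)
  simpa using h1

variable [NeZero (2 : k)]

theorem pred_cast_eq_neg_one {R : Type*} [CommRing R] [Algebra k R] :
    ((p - 1 : ℕ) : R) = -1 := by
  have hp : p.Prime := Fact.out
  rw [← map_natCast (algebraMap k R), Nat.cast_sub hp.one_le, CharP.cast_eq_zero, Nat.cast_one,
    zero_sub, map_neg, map_one]

/-- Because `p - 1 = -1` in `k`, the field is `x_s^(p-2)` times a scalar multiple of the Euler field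
in `x_s, x_{s'}`, which maps `x_s^(p-2)` to a multiple of itself. Here `2(p - 2) ≥ p` is used. -/
theorem sandwich_hamVF_x_pow_mul_x (hp : 5 ≤ p) (s : Fin m ⊕ Fin m) (F : Witt k p (Fin m ⊕ Fin m)) :
    ⁅hamVF (x k p s ^ (p - 1) * x k p s.swap), ⁅hamVF (x k p s ^ (p - 1) * x k p s.swap), F⁆⁆ =
      0 := by
  have e : hamVF (x k p s ^ (p - 1) * x k p s.swap) = x k p s ^ (p - 2) •
      ((-sgn k s) • (x k p s • pd k p s + x k p s.swap • pd k p s.swap)) := by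
    have h := pow_succ (x k p s) (p - 2)
    rw [show p - 2 + 1 = p - 1 by omega] at h
    rw [hamVF_mul, hamVF_pow, hamVF_x, hamVF_x, Sum.swap_swap, sgn_swap,
      pred_cast_eq_neg_one (k := k), show p - 1 - 1 = p - 2 by omega, h]
    ext f
    simp only [Derivation.add_apply, Derivation.smul_apply, smul_eq_mul, truncPoly_smul, map_neg]
    ring
  rw [e]
  refine sandwich_of_sq_eq_zero
    (κ := algebraMap k _ (-sgn k s) * ((p - 2 : ℕ) : TruncPoly k p (Fin m ⊕ Fin m))) ?_ ?_ F
  · rw [← pow_add]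
    exact x_pow_eq_zero s (by omega)
  · have h := pow_succ (x k p s) (p - 2 - 1)
    rw [show p - 2 - 1 + 1 = p - 2 by omega] at h
    rw [Derivation.leibniz_pow, h]
    simp only [Derivation.add_apply, Derivation.smul_apply, pd_x_self,
      pd_x_of_ne (swap_ne_self s), smul_eq_mul, truncPoly_smul, nsmul_eq_mul]
    ring

/-- For `p = 3` the common factor `γ = x_s^(p-2) x_a` has nonzero square; only `γ² x_s` and `γ² x_a`
vanish, which is the case covered by `sandwich_of_sq_mul_eq_zero`. -/
theorem sandwich_hamVF_x_pow_mul_x_sq (hp : 3 ≤ p) {s a : Fin m ⊕ Fin m}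
    (has' : a.swap ≠ s) (F : Witt k p (Fin m ⊕ Fin m)) :
    ⁅hamVF (x k p s ^ (p - 1) * x k p a ^ 2), ⁅hamVF (x k p s ^ (p - 1) * x k p a ^ 2), F⁆⁆ = 0 := by
  have hsa : s.swap ≠ a := fun h => has' (by rw [← h, Sum.swap_swap])
  have e : hamVF (x k p s ^ (p - 1) * x k p a ^ 2) = (x k p s ^ (p - 2) * x k p a) •
      (x k p s • ((2 * sgn k a) • pd k p a.swap) + x k p a • ((-sgn k s) • pd k p s.swap)) := by
    have h := pow_succ (x k p s) (p - 2)
    rw [show p - 2 + 1 = p - 1 by omega] at h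
    rw [hamVF_mul, hamVF_x_sq, hamVF_pow, hamVF_x, pred_cast_eq_neg_one (k := k),
      show p - 1 - 1 = p - 2 by omega, h]
    ext f
    simp only [Derivation.add_apply, Derivation.smul_apply, smul_eq_mul, truncPoly_smul, map_neg]
    ring
  have hD : ∀ (c : k) (i j : Fin m ⊕ Fin m), i ≠ j → (c • pd k p i : Witt k p _) (x k p j) = 0 :=
    fun c i j h => by rw [Derivation.smul_apply, pd_x_of_ne h, smul_zero]
  have hDγ : ∀ D : Witt k p (Fin m ⊕ Fin m), D (x k p s) = 0 → D (x k p a) = 0 →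
      D (x k p s ^ (p - 2) * x k p a) = 0 := fun D h1 h2 => by
    rw [Derivation.leibniz, Derivation.leibniz_pow, h1, h2]
    simp
  rw [e]
  have h1 := hD (2 * sgn k a) _ _ has'
  have h2 := hD (2 * sgn k a) _ _ (swap_ne_self a)
  have h3 := hD (-sgn k s) _ _ (swap_ne_self s)
  have h4 := hD (-sgn k s) _ _ hsa
  refine sandwich_of_sq_mul_eq_zero ?_ ?_ (hDγ _ h1 h2) h1 h2 (hDγ _ h3 h4) h3 h4 F
  · have h : x k p s ^ (p - 2 + (p - 2) + 1) = 0 := x_pow_eq_zero s (by omega)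
    rw [pow_add, pow_add, pow_one] at h
    linear_combination x k p a ^ 2 * h
  · rcases hp.eq_or_lt with rfl | hp'
    · linear_combination x k 3 s ^ 2 * x_pow (k := k) (p := 3) a
    · have h : x k p s ^ (p - 2 + (p - 2)) = 0 := x_pow_eq_zero s (by omega)
      rw [pow_add] at h
      linear_combination x k p a ^ 3 * h

theorem not_conj_dH (hp : 3 ≤ p) (hm : m = 1 → 5 ≤ p) {r : ℕ} {s : Fin m} (hs : s.val < r)
    (hd : dH k p m r s ∈ hAlg k p m) (lam : Fin m → k) (σ : hAlg k p m ≃ₗ⁅k⁆ hAlg k p m) :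
    (σ ⟨dH k p m r s, hd⟩ : Witt k p (Fin m ⊕ Fin m)) ≠ ∑ i, lam i • dH k p m 0 i := by
  have htm : dH k p m r s ∈ ham k p m := derivedSubalgebra_le 2 hd
  have ht : dH k p m r s (x k p (Sum.inl s)) = y k p (Sum.inl s) := by
    rw [dH_inl, if_pos rfl, z_of_shifted hs]
  refine not_conj_of_sandwich (fun c hcm hc => mem_posPart_of_sandwich_ham hcm hc) hd
    (fun D hD => ?_) (fun V hCV hV => ?_) σ
  · refine lie_mem_posPart_of_diagonal (w := weightH lam) (fun i => ?_) hD
    rw [sum_dH, diag_x, z_of_not_shifted]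
    cases i <;> simp [shiftedH]
  have hpd : ∀ i : Fin m ⊕ Fin m, pd k p i ∈ ham k p m :=
    fun i => derivedSubalgebra_le 2 (pd_mem_derived_ham i 2)
  -- For `p ≥ 5` the index `s` alone suffices, whatever `m` is. Otherwise `m ≥ 2`, and a second pair
  -- `j, j'` is available.
  by_cases hp5 : 5 ≤ p
  · have hss : (Sum.inr s : Fin m ⊕ Fin m) ≠ Sum.inl s := by simp
    have hxy : x k p (Sum.inl s : Fin m ⊕ Fin m) ^ (p - 1) *
        (y k p (Sum.inl s) * x k p (Sum.inr s)) = x k p (Sum.inl s) ^ (p - 1) * x k p (Sum.inr s) := by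
      have h := pow_succ (x k p (Sum.inl s : Fin m ⊕ Fin m)) (p - 1)
      rw [Nat.sub_add_cancel (by omega), x_pow] at h
      rw [y]
      linear_combination -x k p (Sum.inr s) * h
    -- The function `y_s x_{s'}` has weight zero under `dH`, and `x_s^(p-1) y_s = x_s^(p-1)` links
    -- it to the sandwich. The bracket of `∂_{s'}` with its field is the field of `y_s`, which is
    -- `∂_{s'}` again.
    refine ⟨hamVF (y k p (Sum.inl s) * x k p (Sum.inr s)),
      hamVF_mem_of_x_pow_mul htm ht ?_ hV (hCV _ ?_ ?_), pd k p (Sum.inr s),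
      pd_mem_derived_ham _ 2, fun h0 => ?_, ?_⟩
    · rw [Derivation.leibniz, derivation_y, ht, dH_inr, if_pos rfl]
      simp only [smul_eq_mul]
      ring
    · rw [hxy]
      refine hamVF_mem_derived (Sum.inl s) (κ := -2) (neg_ne_zero.2 two_ne_zero) ?_ 2
      rw [Derivation.leibniz, coroot_x_pow, Sum.swap_inl, coroot_x, if_pos rfl, if_pos rfl,
        if_neg hss, if_neg hss.symm, pred_cast_eq_neg_one (k := k)]
      simp only [smul_eq_mul, truncPoly_smul, map_mul, map_sub, map_one, map_zero, map_neg,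
        map_ofNat]
      ring
    · rw [hxy]
      exact fun F _ => sandwich_hamVF_x_pow_mul_x hp5 (Sum.inl s) F
    · have := DFunLike.congr_fun h0 (x k p (Sum.inr s))
      simp [pd_x_self] at this
    · rw [mem_ham_iff.1 (hpd _), Derivation.leibniz, derivation_y, pd_x_self, pd_x_of_ne hss,
        smul_zero, add_zero, smul_eq_mul, mul_one, y, hamVF_add, ← map_one (algebraMap k _),
        hamVF_algebraMap, zero_add, hamVF_x]
      simp [sgn]
  · obtain ⟨j, hj⟩ : ∃ j : Fin m, j ≠ s := by
      have hs' := s.2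
      have : Nontrivial (Fin m) := Fin.nontrivial_iff_two_le.2 (by
        by_contra h
        exact hp5 (hm (by omega)))
      exact exists_ne s
    have key : ∀ a : Fin m ⊕ Fin m, (a = Sum.inl j ∨ a = Sum.inr j) → hamVF (x k p a ^ 2) ∈ V := by
      intro a ha
      have has : a ≠ Sum.inl s := by rcases ha with rfl | rfl <;> simp [hj]
      have has' : a.swap ≠ Sum.inl s := by rcases ha with rfl | rfl <;> simp [hj]
      refine hamVF_mem_of_x_pow_mul htm ht ?_ hV (hCV _ ?_ fun F _ =>
        sandwich_hamVF_x_pow_mul_x_sq hp has' F)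
      · have h0 : dH k p m r s (x k p a) = 0 := by
          rcases ha with rfl | rfl
          · rw [dH_inl, if_neg hj.symm]
          · rw [dH_inr, if_neg hj.symm]
        rw [Derivation.leibniz_pow, h0]
        simp
      · refine hamVF_mem_derived a (κ := 2) two_ne_zero ?_ 2
        rw [Derivation.leibniz, coroot_x_pow, coroot_x_pow, if_pos rfl, if_neg has.symm,
          if_neg has'.symm, if_neg (swap_ne_self a).symm]
        simp only [smul_eq_mul, truncPoly_smul, map_mul, map_sub, map_one, map_zero, map_ofNat,
          Nat.cast_ofNat]
        ring
    -- The linear fields of `x_j²` and `x_{j'}²` are nilpotent, but half the difference of these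
    -- squares gives a field with eigenvalues `±1`: `∂_j + ∂_{j'}` sends this function to `x_j -
    -- x_{j'}`, whose field is `∂_j + ∂_{j'}`.
    refine ⟨hamVF ((2⁻¹ : k) • (x k p (Sum.inl j) ^ 2 - x k p (Sum.inr j) ^ 2)), ?_,
      pd k p (Sum.inl j) + pd k p (Sum.inr j),
      add_mem (pd_mem_derived_ham _ 2) (pd_mem_derived_ham _ 2), fun h0 => ?_, ?_⟩
    · have h := V.add_mem (V.smul_mem (2⁻¹ : k) (key _ (Or.inl rfl)))
        (V.smul_mem (-2⁻¹ : k) (key _ (Or.inr rfl)))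
      rw [← hamVF_smul, ← hamVF_smul, ← hamVF_add] at h
      convert h using 2
      rw [smul_sub, neg_smul, sub_eq_add_neg]
    · have := DFunLike.congr_fun h0 (x k p (Sum.inr j))
      rw [Derivation.add_apply, pd_x_self, pd_x_of_ne (by simp), zero_add] at this
      exact one_ne_zero this
    · have hw : (pd k p (Sum.inl j) + pd k p (Sum.inr j) : Witt k p (Fin m ⊕ Fin m))
          ((2⁻¹ : k) • (x k p (Sum.inl j) ^ 2 - x k p (Sum.inr j) ^ 2)) =
          x k p (Sum.inl j) + (-1 : k) • x k p (Sum.inr j) := by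
        have h2 : algebraMap k (TruncPoly k p (Fin m ⊕ Fin m)) 2⁻¹ * 2 = 1 := by
          have h := congrArg (algebraMap k (TruncPoly k p (Fin m ⊕ Fin m)))
            (inv_mul_cancel₀ (two_ne_zero (α := k)))
          rwa [map_mul, map_ofNat, map_one] at h
        rw [Derivation.map_smul, map_sub, Derivation.leibniz_pow, Derivation.leibniz_pow,
          Derivation.add_apply, Derivation.add_apply, pd_x_self, pd_x_self, pd_x_of_ne (by simp),
          pd_x_of_ne (by simp)]
        simp only [smul_eq_mul, truncPoly_smul, nsmul_eq_mul, map_neg, map_one, Nat.cast_ofNat]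
        linear_combination (x k p (Sum.inl j) - x k p (Sum.inr j)) * h2
      rw [mem_ham_iff.1 (add_mem (hpd _) (hpd _)), hw, hamVF_add, hamVF_smul, hamVF_x, hamVF_x]
      ext f
      simp only [Derivation.add_apply, Derivation.smul_apply, sgn, Sum.elim_inl, Sum.elim_inr,
        Sum.swap_inl, Sum.swap_inr, truncPoly_smul, map_neg, map_one]
      ring

theorem mem_torusIndex_dH [Algebra (ZMod p) k] (hp : 3 ≤ p) (hm : m = 1 → 5 ≤ p) {r : ℕ}
    (hr : 1 ≤ r) (hrm : r ≤ m) (lam : Fin m → k) :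
    (∑ i, lam i • dH k p m r i) ∈ torusIndex (hAlg k p m) (dH k p m) r ↔
      LinearIndependent (ZMod p) (fun i : {i : Fin m // i.val < r} => lam i) := by
  refine mem_torusIndex_iff dH_mem_hAlg (fun r lam => ?_) (fun r r' i h => ?_)
    (fun r s j hs hj lam => conj_dH hs hj lam)
    (fun r s hs lam σ => not_conj_dH hp hm hs (dH_mem_hAlg r s) lam σ) hr hrm lam
  · rw [sum_dH, sum_dH, pMap_diag]
    congr 1
    ext i
    rcases i with i | i
    · rfl
    · rw [weightH, weightH, Sum.elim_inr, Sum.elim_inr, Pi.neg_apply, Pi.neg_apply,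
        ← frobenius_def, map_neg]
      rfl
  · rw [dH, dH, z_congr h]

end TypeH

end CartanType

end

theorem lemma4p1 {k : Type*} [Field k] [IsAlgClosed k] {p : ℕ} [Fact p.Prime] [CharP k p]
    [Algebra (ZMod p) k] (hp : 3 ≤ p) :
    -- type `W`, with `μ = n`
    (∀ n : ℕ, (n = 1 → 5 ≤ p) → ∀ r : ℕ, 1 ≤ r → r ≤ n → ∀ lam : Fin n → k,
      ((∑ i, lam i • CartanType.dW k p n r i) ∈
          CartanType.torusIndex (CartanType.wAlg k p n) (CartanType.dW k p n) r ↔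
        LinearIndependent (ZMod p) (fun i : {i : Fin n // i.val < r} => lam i))) ∧
    -- type `S`, with `n = l + 1 ≥ 3` variables and `μ = n - 1 = l`
    (∀ l : ℕ, 2 ≤ l → ∀ r : ℕ, 1 ≤ r → r ≤ l → ∀ lam : Fin l → k,
      ((∑ i, lam i • CartanType.dS k p l r i) ∈
          CartanType.torusIndex (CartanType.sAlg k p (l + 1)) (CartanType.dS k p l) r ↔
        LinearIndependent (ZMod p) (fun i : {i : Fin l // i.val < r} => lam i))) ∧
    -- type `H`, with `2m` variables and `μ = m`
    (∀ m : ℕ, (m = 1 → 5 ≤ p) → ∀ r : ℕ, 1 ≤ r → r ≤ m → ∀ lam : Fin m → k,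
      ((∑ i, lam i • CartanType.dH k p m r i) ∈
          CartanType.torusIndex (CartanType.hAlg k p m) (CartanType.dH k p m) r ↔
        LinearIndependent (ZMod p) (fun i : {i : Fin m // i.val < r} => lam i))) := by
  have : NeZero (2 : k) := ⟨Ring.two_ne_zero (by rw [ringChar.eq k p]; omega)⟩
  exact ⟨fun n hn r hr hrn lam => CartanType.mem_torusIndex_dW hp hn hr hrn lam,
    fun l hl r hr hrl lam => CartanType.mem_torusIndex_dS hp hl hr hrl lam,
    fun m hm r hr hrm lam => CartanType.mem_torusIndex_dH hp hm hr hrm lam⟩
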